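/- Let $A\in\mathbb R^{n\times n}$, $B\in\mathbb R^{n\times 1}$, $C\in\mathbb R^{1\times n}$ be a minimal (i.e. controllable and observable) realization, $\dot x=Ax+Bu$, $y=Cx$, of the SISO transfer function $G(s)=C(sI-A)^{-1}B$, and suppose that $G$ is negative imaginary: $G$ has no pole at the origin or in $\operatorname{Re}s>0$; $j\,(G(j\omega)-G(j\omega)^*)\ge 0$ for every $\omega>0$ such that $j\omega$ is not a pole of $G$; and every pole $j\omega_0$ of $G$ with $\omega_0>0$ is simple with $\lim_{s\to j\omega_0}(s-j\omega_0)\,s\,G(s)$ real and nonnegative. A hybrid integrator-gain system (HIGS) with integrator frequency $\omega_i\ge 0$ and gain value $k_i>0$, with input $e_i$ and with state and output $x_i$, satisfies the sector constraint $(e_i,x_i,\dot e_i)\in\mathcal F_i=\{(e,u,\dot e)\in\mathbb R^3: eu\ge u^2/k_i\}$ and $$\dot x_i=\omega_i e_i\ \text{ if }(e_i,x_i,\dot e_i)\in\mathcal F_i\setminus\mathcal F_{i,2},\qquad x_i=k_ie_i\ \text{ if }(e_i,x_i,\dot e_i)\in\mathcal F_{i,2},$$ where $\mathcal F_{i,2}=\{(e,u,\dot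 e)\in\mathcal F_i: u=k_ie,\ \omega_ie^2>k_i\dot e e\}$; these relations are required for almost every $t\ge 0$, with $e_i$ and $x_i$ locally absolutely continuous on $[0,\infty)$. Then there exist two HIGS $\mathcal H_1$ (parameters $\omega_1,k_1$) and $\mathcal H_2$ (parameters $\omega_2,k_2$) such that the positive feedback interconnection of the plant with the serial cascade of $\mathcal H_1$ and $\mathcal H_2$, given by $e_1=y=Cx$, $e_2=x_1$, $u=x_2$, is asymptotically stable. That is: for every initial state $(x,x_1,x_2)\in\mathbb R^n\times\mathbb R\times\mathbb R$ that satisfies both sector constraints $Cx\,x_1\ge x_1^2/k_1$ and $x_1x_2\ge x_2^2/k_2$ there is a solution on $[0,\infty)$; for every $\varepsilon>0$ there is $\delta>0$ such that every solution on $[0,\infty)$ with $\|(x,x_1,x_2)(0)\|<\delta$ satisfies $\|(x,x_1,x_2)(t)\|<\varepsilon$ for all $t\ge0$; and every solution on $[0,\infty)$ satisfies $(x,x_1,x_2)(t)\to 0$ as $t\to\infty$. -/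

import Mathlib

open Filter Topology MeasureTheory Matrix

noncomputable section

/-! ## Linear single-input single-output plants `x' = A x + b u`, `y = c x` -/

/-- The transfer function `G(s) = c (s I - A)⁻¹ b` of the plant. At the finitely many eigenvalues
of `A` its value is irrelevant. -/
def transferFunction {n : ℕ} (A : Matrix (Fin n) (Fin n) ℝ) (b c : Fin n → ℝ) (s : ℂ) : ℂ :=
  (fun i => (c i : ℂ)) ⬝ᵥ
    ((s • (1 : Matrix (Fin n) (Fin n) ℂ) - A.map Complex.ofReal)⁻¹ *ᵥ fun i => (b i : ℂ))

/-- The vectors `b, A b, …, Aⁿ⁻¹ b` span the state space. -/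
def IsControllable {n : ℕ} (A : Matrix (Fin n) (Fin n) ℝ) (b : Fin n → ℝ) : Prop :=
  Submodule.span ℝ (Set.range fun i : Fin n => (A ^ (i : ℕ)) *ᵥ b) = ⊤

/-- The common kernel of `c, c A, …, c Aⁿ⁻¹` is trivial. -/
def IsObservable {n : ℕ} (A : Matrix (Fin n) (Fin n) ℝ) (c : Fin n → ℝ) : Prop :=
  ∀ x : Fin n → ℝ, (∀ i : Fin n, c ⬝ᵥ ((A ^ (i : ℕ)) *ᵥ x) = 0) → x = 0

/-- A realization is minimal when it is controllable and observable. -/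
def IsMinimalRealization {n : ℕ} (A : Matrix (Fin n) (Fin n) ℝ) (b c : Fin n → ℝ) : Prop :=
  IsControllable A b ∧ IsObservable A c

/-- `s` is a pole of the rational function `G`. -/
def IsPole (G : ℂ → ℂ) (s : ℂ) : Prop := meromorphicOrderAt G s < 0

/-- The scalar real-rational proper transfer function `G` is negative imaginary. -/
structure IsNegativeImaginary (G : ℂ → ℂ) : Prop where
  /-- There is no pole in the open right half-plane. -/
  not_isPole_of_re_pos : ∀ s : ℂ, 0 < s.re → ¬ IsPole G s
  /-- There is no pole at the origin. -/
  not_isPole_zero : ¬ IsPole G 0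
  /-- `j (G(jω) - G(jω)^*) ≥ 0` for all `ω > 0` such that `jω` is not a pole
  (this number is always real). -/
  frequency : ∀ ω : ℝ, 0 < ω → ¬ IsPole G (Complex.I * ω) →
    0 ≤ (Complex.I * (G (Complex.I * ω) - star (G (Complex.I * ω)))).re
  /-- A pole `jω` with `ω > 0` is simple. -/
  simple_pole : ∀ ω : ℝ, 0 < ω → IsPole G (Complex.I * ω) →
    meromorphicOrderAt G (Complex.I * ω) = -1
  /-- At a pole `jω` with `ω > 0`, the residue of `s G(s)` is real and nonnegative. -/
  residue : ∀ ω : ℝ, 0 < ω → IsPole G (Complex.I * ω) →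
    ∃ K : ℝ, 0 ≤ K ∧
      Tendsto (fun s : ℂ => (s - Complex.I * ω) * (s * G s))
        (𝓝[≠] (Complex.I * ω)) (𝓝 (K : ℂ))

/-! ## Hybrid integrator-gain systems -/

/-- A hybrid integrator-gain system is given by its integrator frequency `ω ≥ 0` and its gain
value `k > 0`. -/
structure HIGS where
  /-- integrator frequency -/
  ω : ℝ
  /-- gain value -/
  k : ℝ
  ω_nonneg : 0 ≤ ω
  k_pos : 0 < k

namespace HIGS

/-- The set `F` of triples `(e, u, e')` which satisfy the sector constraint. -/
def sector (H : HIGS) : Set (ℝ × ℝ × ℝ) :=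
  {p | p.1 * p.2.1 ≥ 1 / H.k * p.2.1 ^ 2}

/-- The set `F₂` of triples `(e, u, e')` for which the system is in gain mode. -/
def gainMode (H : HIGS) : Set (ℝ × ℝ × ℝ) :=
  {p | p ∈ H.sector ∧ p.2.1 = H.k * p.1 ∧ H.ω * p.1 ^ 2 > H.k * p.2.2 * p.1}

/-- The set `F₁ = F \ F₂` of triples for which the system is in integrator mode. -/
def integratorMode (H : HIGS) : Set (ℝ × ℝ × ℝ) := H.sector \ H.gainMode

end HIGS

/-- `f` is absolutely continuous on every compact interval `[0, T]`. -/
def IsLocallyAC (f : ℝ → ℝ) : Prop :=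
  ∀ T : ℝ, 0 < T → AbsolutelyContinuousOnInterval f 0 T

/-- `x` is a state trajectory (equivalently, output trajectory) on `[0, ∞)` of `H` under the
input `e`: both are locally absolutely continuous, and for almost every time the sector
constraint holds together with the equation of the active mode. In particular `x' = k e'` holds
at almost every time spent in gain mode. -/
structure HIGS.IsSolution (H : HIGS) (e x : ℝ → ℝ) : Prop where
  input_ac : IsLocallyAC e
  state_ac : IsLocallyAC x
  sector : ∀ᵐ t ∂volume.restrict (Set.Ici (0 : ℝ)), (e t, x t, deriv e t) ∈ H.sector
  integrator : ∀ᵐ t ∂volume.restrict (Set.Ici (0 : ℝ)),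
    (e t, x t, deriv e t) ∈ H.integratorMode → HasDerivAt x (H.ω * e t) t
  gain : ∀ᵐ t ∂volume.restrict (Set.Ici (0 : ℝ)),
    (e t, x t, deriv e t) ∈ H.gainMode → x t = H.k * e t

/-! ## The closed loop of a plant and the cascade of two hybrid integrator-gain systems -/

/-- `z = (x, x₁, x₂)` is a trajectory on `[0, ∞)` of the positive feedback interconnection:
`x' = A x + b u` with `u = x₂`, `H₁` has the input `e₁ = y = c x` and the output `x₁`, and `H₂`
has the input `e₂ = x₁` and the output `x₂`. -/
structure IsCascadeSolution {n : ℕ} (A : Matrix (Fin n) (Fin n) ℝ) (b c : Fin n → ℝ)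
    (H₁ H₂ : HIGS) (z : ℝ → (Fin n → ℝ) × ℝ × ℝ) : Prop where
  plant : ∀ t : ℝ, 0 ≤ t →
    HasDerivWithinAt (fun τ => (z τ).1) (A *ᵥ (z t).1 + (z t).2.2 • b) (Set.Ici 0) t
  first : H₁.IsSolution (fun t => c ⬝ᵥ (z t).1) (fun t => (z t).2.1)
  second : H₂.IsSolution (fun t => (z t).2.1) (fun t => (z t).2.2)

/-- The states of the closed loop at which both sector constraints hold. -/
def cascadeStates {n : ℕ} (c : Fin n → ℝ) (H₁ H₂ : HIGS) : Set ((Fin n → ℝ) × ℝ × ℝ) :=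
  {z | (c ⬝ᵥ z.1) * z.2.1 ≥ 1 / H₁.k * z.2.1 ^ 2 ∧ z.2.1 * z.2.2 ≥ 1 / H₂.k * z.2.2 ^ 2}

/-- Asymptotic stability of the equilibrium `0` of a system with state constraint set `D` whose
trajectories on `[0, ∞)` are the `z` with `Sol z`. Attractivity is required from every
admissible initial state, not only from those near `0`. -/
structure IsAsymptoticallyStable {E : Type*} [NormedAddCommGroup E]
    (D : Set E) (Sol : (ℝ → E) → Prop) : Prop where
  /-- Every admissible initial state is the start of a trajectory on `[0, ∞)`. -/
  exists_sol : ∀ z₀ ∈ D, ∃ z : ℝ → E, Sol z ∧ z 0 = z₀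
  /-- Lyapunov stability. -/
  stable : ∀ ε : ℝ, 0 < ε → ∃ δ : ℝ, 0 < δ ∧
    ∀ z : ℝ → E, Sol z → ‖z 0‖ < δ → ∀ t : ℝ, 0 ≤ t → ‖z t‖ < ε
  /-- Attractivity. -/
  attractive : ∀ z : ℝ → E, Sol z → Tendsto z atTop (𝓝 0)

end

/-! Both hybrid systems are taken balanced: `H₁` has frequency and gain 1, `H₂` has frequency and
gain κ, with κ small. The loop is then an O(κ) perturbation of the free flow x' = A x whose output y
= c x drives `H₁`, and a damping of order κ has to beat errors of order κ².

The plant. By minimality every root of the minimal polynomial of A is a pole of G. Hence the roots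
lie in the open left half-plane, or are simple, nonzero, on the imaginary axis, with a positive
residue of s G(s). Left eigenvectors weighted by these residues, together with a Lyapunov form for
the stable part, give a positive definite P with 2 P(x, A x) ≤ -‖N x‖² and with P(b, x) = c A x on
ker N (`exists_storage`).

The energy. Let p and v be the states of `H₁` and `H₂`, and W = P(x, x) + v²/κ - 2 y v. The cascade
satisfies (y - v/κ) v' ≥ κ (|y| - |p|) |p| (`cascade_supply_ge`). The mismatch P(b, x) - c A x is
controlled by ‖N x‖, so W' ≤ C κ² ‖x‖² - 2κ (‖N x‖² + (|y| - |p|) |p|) almost everywhere; this is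
used in integrated form (`exists_cascadeEnergy_sub_le`).

The window. The dissipation may vanish at single instants, but not on a whole window of suitable
length T along the nonzero free flow. Otherwise N x = 0, the motion conserves P, and |p| sticks to
|y|. Since A is injective, y is the derivative of a bounded function, so it has a zero inside the
window. From that zero on |y| is at most the integral of |y|, so y = 0, and x = 0 by observability.
Compactness and homogeneity turn this into a bound d ‖x‖² (`exists_dissipation_lower_bound`), which
loses only O(κ) when the feedback is switched on. Thus W contracts over each window once κ is small.

The tool throughout is that |p| is an integrator of |y| reflected at the barrier |y|, given by an
explicit minimum formula (`IsReflected`). This yields uniqueness and continuity in the data for the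
compactness argument, and Lipschitz dependence on the input for the existence of trajectories by
Picard iteration. -/

noncomputable section

/-! ## Absolutely continuous functions on the line -/

/-- At almost every zero of a function of a real variable, any derivative vanishes. -/
theorem ae_hasDerivAt_eq_zero_of_eq_zero (f : ℝ → ℝ) :
    ∀ᵐ t : ℝ, f t = 0 → ∀ f' : ℝ, HasDerivAt f f' t → f' = 0 := by
  -- Zeros isolated from the right form a countable set. At any other zero the slopes vanish along
  -- zeros that approach it from the right.
  have hc : {x ∈ {t : ℝ | f t = 0} | 𝓝[{t : ℝ | f t = 0} ∩ Set.Ioi x] x = ⊥}.Countable :=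
    countable_setOfPred_isolated_right_within
  have hae := hc.ae_notMem (volume : Measure ℝ)
  filter_upwards [hae] with t ht h0 f' hf'
  have hne : (𝓝[{t : ℝ | f t = 0} ∩ Set.Ioi t] t).NeBot := by
    refine ⟨fun h => ht ⟨h0, h⟩⟩
  have h1 : Tendsto (slope f t) (𝓝[{t : ℝ | f t = 0} ∩ Set.Ioi t] t) (𝓝 f') :=
    (hasDerivAt_iff_tendsto_slope.1 hf').mono_left
      (nhdsWithin_mono _ fun r hr => (ne_of_gt hr.2 : r ≠ t))
  have h2 : Tendsto (slope f t) (𝓝[{t : ℝ | f t = 0} ∩ Set.Ioi t] t) (𝓝 0) := by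
    refine tendsto_const_nhds.congr' ?_
    filter_upwards [self_mem_nhdsWithin] with r hr
    have hr0 : f r = 0 := hr.1
    simp [slope_def_field, hr0, h0]
  exact tendsto_nhds_unique h1 h2

/-- An almost everywhere bound on the derivative of an absolutely continuous function
integrates. -/
theorem AbsolutelyContinuousOnInterval.sub_le_integral {f g : ℝ → ℝ} {a b : ℝ} (hab : a ≤ b)
    (hf : AbsolutelyContinuousOnInterval f a b) (hg : ContinuousOn g (Set.Icc a b))
    (h : ∀ᵐ t : ℝ, t ∈ Set.Ioo a b → ∀ f' : ℝ, HasDerivAt f f' t → f' ≤ g t) :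
    f b - f a ≤ ∫ t in a..b, g t := by
  rw [← hf.integral_deriv_eq_sub]
  have hgi : IntervalIntegrable g volume a b := by
    apply ContinuousOn.intervalIntegrable
    rwa [Set.uIcc_of_le hab]
  refine intervalIntegral.integral_mono_ae_restrict hab hf.intervalIntegrable_deriv hgi ?_
  rw [Filter.EventuallyLE, ae_restrict_iff' measurableSet_Icc]
  have hnb : ∀ᵐ t : ℝ, t ≠ b := by
    have := (Set.countable_singleton b).ae_notMem (volume : Measure ℝ)
    simpa using this
  have hna : ∀ᵐ t : ℝ, t ≠ a := by
    have := (Set.countable_singleton a).ae_notMem (volume : Measure ℝ)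
    simpa using this
  filter_upwards [h, hna, hnb, hf.ae_differentiableAt] with t ht ha hb hd htI
  exact ht ⟨lt_of_le_of_ne htI.1 ha.symm, lt_of_le_of_ne htI.2 hb⟩ _
    (hd (by rwa [Set.uIcc_of_le hab])).hasDerivAt

theorem IsLocallyAC.on {f : ℝ → ℝ} (hf : IsLocallyAC f) {a b : ℝ} (ha : 0 ≤ a) (hab : a ≤ b) :
    AbsolutelyContinuousOnInterval f a b := by
  refine (hf (b + 1) (by linarith)).mono ?_
  rw [Set.uIcc_of_le hab, Set.uIcc_of_le (by linarith)]
  exact Set.Icc_subset_Icc ha (by linarith)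

theorem IsLocallyAC.continuousOn {f : ℝ → ℝ} (hf : IsLocallyAC f) :
    ContinuousOn f (Set.Ici 0) := by
  intro t ht
  have h := (hf (t + 1) (by have : (0 : ℝ) ≤ t := ht; linarith)).continuousOn
  have ht0 : (0 : ℝ) ≤ t := ht
  rw [Set.uIcc_of_le (by linarith)] at h
  refine (h t ⟨ht0, by linarith⟩).mono_of_mem_nhdsWithin ?_
  rw [mem_nhdsWithin]
  exact ⟨Set.Iio (t + 1), isOpen_Iio, by simp, fun r hr => ⟨hr.2, le_of_lt hr.1⟩⟩

theorem AbsolutelyContinuousOnInterval.abs {f : ℝ → ℝ} {a b : ℝ}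
    (hf : AbsolutelyContinuousOnInterval f a b) :
    AbsolutelyContinuousOnInterval (fun t => |f t|) a b := by
  rw [absolutelyContinuousOnInterval_iff] at hf ⊢
  intro ε hε
  obtain ⟨δ, hδ, h⟩ := hf ε hε
  refine ⟨δ, hδ, fun E hE hl => lt_of_le_of_lt (Finset.sum_le_sum fun i _ => ?_) (h E hE hl)⟩
  simp only [Real.dist_eq]
  exact abs_abs_sub_abs_le_abs_sub _ _

/-! ## One-sided reflection -/

/-- On `[a, b]`, the function `ξ ≥ 0` grows at rate `|e|` and is reflected downwards at the barrier
`|e|`. -/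
structure IsReflected (e ξ : ℝ → ℝ) (a b : ℝ) : Prop where
  continuousOn_input : ContinuousOn e (Set.Icc a b)
  continuousOn_state : ContinuousOn ξ (Set.Icc a b)
  nonneg : ∀ t ∈ Set.Icc a b, 0 ≤ ξ t
  le_abs : ∀ t ∈ Set.Icc a b, ξ t ≤ |e t|
  upper : ∀ s t, a ≤ s → s ≤ t → t ≤ b → ξ t ≤ ξ s + ∫ r in s..t, |e r|
  -- With `upper` and `le_abs` this says that ξ t is the minimum of ξ a + ∫ₐᵗ |e| and of all |e s| +
  -- ∫ₛᵗ |e| with s in [a, t]. In the second alternative s is a time of contact with the barrier.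
  lower : ∀ t ∈ Set.Icc a b, ξ a + (∫ r in a..t, |e r|) ≤ ξ t ∨
    ∃ s ∈ Set.Icc a t, |e s| + (∫ r in s..t, |e r|) ≤ ξ t

namespace IsReflected

variable {e ξ e' ξ' : ℝ → ℝ} {a b : ℝ}

theorem intervalIntegrable (h : IsReflected e ξ a b) {s t : ℝ} (hs : a ≤ s) (hst : s ≤ t)
    (ht : t ≤ b) : IntervalIntegrable (fun r => |e r|) volume s t := by
  apply ContinuousOn.intervalIntegrable
  rw [Set.uIcc_of_le hst]
  exact (h.continuousOn_input.mono (Set.Icc_subset_Icc hs ht)).abs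

theorem shift {c : ℝ} (h : IsReflected e ξ a b) :
    IsReflected (fun t => e (c + t)) (fun t => ξ (c + t)) (a - c) (b - c) := by
  have hm : Set.MapsTo (fun t => c + t) (Set.Icc (a - c) (b - c)) (Set.Icc a b) := by
    intro t ht
    exact ⟨by linarith [ht.1], by linarith [ht.2]⟩
  have hi : ∀ s t, ∫ r in s..t, |e (c + r)| = ∫ r in (c + s)..(c + t), |e r| := fun s t =>
    intervalIntegral.integral_comp_add_left (fun r => |e r|) c
  refine ⟨h.continuousOn_input.comp (by fun_prop) hm, h.continuousOn_state.comp (by fun_prop) hm,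
    fun t ht => h.nonneg _ (hm ht), fun t ht => h.le_abs _ (hm ht), ?_, ?_⟩
  · intro s t hs hst ht
    rw [hi]
    exact h.upper _ _ (by linarith) (by linarith) (by linarith)
  · intro t ht
    rw [hi]
    rcases h.lower _ (hm ht) with h1 | ⟨s, hs, h1⟩
    · left
      simpa using h1
    · right
      refine ⟨s - c, ⟨by linarith [hs.1], by linarith [hs.2]⟩, ?_⟩
      rw [hi]
      simpa using h1

theorem smul {l : ℝ} (hl : 0 ≤ l) (h : IsReflected e ξ a b) :
    IsReflected (fun t => l * e t) (fun t => l * ξ t) a b := by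
  have hi : ∀ s t, ∫ r in s..t, |l * e r| = l * ∫ r in s..t, |e r| := fun s t => by
    rw [← intervalIntegral.integral_const_mul]
    simp only [abs_mul, abs_of_nonneg hl]
  refine ⟨continuousOn_const.mul h.continuousOn_input, continuousOn_const.mul h.continuousOn_state,
    fun t ht => mul_nonneg hl (h.nonneg _ ht), fun t ht => ?_, ?_, ?_⟩
  · rw [abs_mul, abs_of_nonneg hl]
    exact mul_le_mul_of_nonneg_left (h.le_abs _ ht) hl
  · intro s t hs hst ht
    rw [hi, ← mul_add]
    exact mul_le_mul_of_nonneg_left (h.upper s t hs hst ht) hl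
  · intro t ht
    rw [hi, ← mul_add]
    rcases h.lower _ ht with h1 | ⟨s, hs, h1⟩
    · exact Or.inl (mul_le_mul_of_nonneg_left h1 hl)
    · right
      refine ⟨s, hs, ?_⟩
      rw [hi, abs_mul, abs_of_nonneg hl, ← mul_add]
      exact mul_le_mul_of_nonneg_left h1 hl

/-- Monotone dependence of the reflected state on the input, with an explicit error. -/
theorem le_add (h : IsReflected e ξ a b) (h' : IsReflected e' ξ' a b) (h0 : ξ' a ≤ ξ a)
    {D : ℝ → ℝ} (hD : Continuous D) (hD0 : ∀ r, 0 ≤ D r) {t Q : ℝ} (ht : t ∈ Set.Icc a b)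
    (he : ∀ r ∈ Set.Icc a t, |e' r| ≤ |e r| + D r)
    (hQ : ∀ r ∈ Set.Icc a t, D r + (∫ q in r..t, D q) ≤ Q) : ξ' t ≤ ξ t + Q := by
  have key : ∀ s ∈ Set.Icc a t, ∫ r in s..t, |e' r| ≤ (∫ r in s..t, |e r|) + ∫ r in s..t, D r := by
    intro s hs
    have i1 := h.intervalIntegrable hs.1 hs.2 ht.2
    have i2 := h'.intervalIntegrable hs.1 hs.2 ht.2
    have i3 : IntervalIntegrable D volume s t := hD.intervalIntegrable _ _
    rw [← intervalIntegral.integral_add i1 i3]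
    exact intervalIntegral.integral_mono_on hs.2 i2 (i1.add i3)
      fun r hr => he r ⟨hs.1.trans hr.1, hr.2⟩
  -- The candidate that attains the minimum for ξ t is also a competitor in the minimum for ξ' t, so
  -- only D s and the integral of D after s are lost.
  rcases h.lower t ht with h1 | ⟨s, hs, h1⟩
  · have ha : a ∈ Set.Icc a t := ⟨le_rfl, ht.1⟩
    have := h'.upper a t le_rfl ht.1 ht.2
    linarith [key a ha, hQ a ha, hD0 a]
  · have h2 := h'.upper s t hs.1 hs.2 ht.2
    have h3 := h'.le_abs s ⟨hs.1, hs.2.trans ht.2⟩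
    linarith [key s hs, hQ s hs, he s hs]

theorem eq_of_initial (h : IsReflected e ξ a b) (h' : IsReflected e ξ' a b) (h0 : ξ a = ξ' a)
    {t : ℝ} (ht : t ∈ Set.Icc a b) : ξ t = ξ' t := by
  apply le_antisymm
  · simpa using h'.le_add h h0.le (D := fun _ => 0) continuous_const (by simp) (Q := 0) ht
      (by simp) (by simp)
  · simpa using h.le_add h' h0.ge (D := fun _ => 0) continuous_const (by simp) (Q := 0) ht
      (by simp) (by simp)

/-- Away from the barrier the state is the integral of the rate. -/
theorem eq_add_integral (h : IsReflected e ξ a b) {s t : ℝ} (hs : a ≤ s) (hst : s ≤ t) (ht : t ≤ b)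
    (hlt : ∀ r ∈ Set.Icc s t, ξ r < |e r|) : ξ t = ξ s + ∫ r in s..t, |e r| := by
  refine le_antisymm (h.upper s t hs hst ht) ?_
  have hadd : ∀ r, a ≤ r → r ≤ s →
      ∫ q in r..t, |e q| = (∫ q in r..s, |e q|) + ∫ q in s..t, |e q| := fun r hr hrs =>
    (intervalIntegral.integral_add_adjacent_intervals
      (h.intervalIntegrable hr hrs (hst.trans ht)) (h.intervalIntegrable hs hst ht)).symm
  rcases h.lower t ⟨hs.trans hst, ht⟩ with h1 | ⟨r, hr, h1⟩
  · rw [hadd a le_rfl hs] at h1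
    linarith [h.upper a s le_rfl hs (hst.trans ht)]
  -- A contact inside [s, t] is excluded by hypothesis; a contact before s also bounds ξ s from
  -- above, and the common part cancels.
  · rcases le_total s r with hsr | hrs
    · have := h.upper r t hr.1 hr.2 ht
      linarith [hlt r ⟨hsr, hr.2⟩]
    · rw [hadd r hr.1 hrs] at h1
      have := h.upper r s hr.1 hrs (hst.trans ht)
      linarith [h.le_abs r ⟨hr.1, hr.2.trans ht⟩]

/-- The state inherits a Lipschitz constant from the input. -/
theorem abs_sub_le (h : IsReflected e ξ a b) {L : ℝ} (hb : ∀ t ∈ Set.Icc a b, |e t| ≤ L)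
    (hL : ∀ s ∈ Set.Icc a b, ∀ t ∈ Set.Icc a b, s ≤ t → |e t - e s| ≤ L * (t - s)) {s t : ℝ}
    (hs : a ≤ s) (hst : s ≤ t) (ht : t ≤ b) : |ξ t - ξ s| ≤ L * (t - s) := by
  have hI : ∀ q r, a ≤ q → q ≤ r → r ≤ b →
      0 ≤ (∫ x in q..r, |e x|) := fun q r _ hqr _ =>
    intervalIntegral.integral_nonneg hqr fun _ _ => abs_nonneg _
  have hmem : ∀ r, a ≤ r → r ≤ t → r ∈ Set.Icc a b := fun r h1 h2 => ⟨h1, h2.trans ht⟩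
  have hup : ∫ x in s..t, |e x| ≤ L * (t - s) := by
    have := intervalIntegral.integral_mono_on hst (h.intervalIntegrable hs hst ht)
      (intervalIntegrable_const (c := L)) fun r hr => hb r ⟨hs.trans hr.1, hr.2.trans ht⟩
    simpa [mul_comm] using this
  have hL0 : 0 ≤ L * (t - s) := (hI s t hs hst ht).trans hup
  rw [abs_le]
  constructor
  · rcases h.lower t ⟨hs.trans hst, ht⟩ with h1 | ⟨r, hr, h1⟩
    · have h2 := intervalIntegral.integral_add_adjacent_intervals
        (h.intervalIntegrable le_rfl hs (hst.trans ht)) (h.intervalIntegrable hs hst ht)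
      linarith [h.upper a s le_rfl hs (hst.trans ht), hI s t hs hst ht]
    -- After a contact at r ≥ s the state is at least |e r|, and the barrier has dropped by at most
    -- L (r - s) since time s.
    · rcases le_total s r with hsr | hrs
      · have h3 := hL s (hmem s hs hst) r (hmem r hr.1 hr.2) hsr
        have hbs := (abs_nonneg _).trans (hb s (hmem s hs hst))
        have h4 : L * (r - s) ≤ L * (t - s) :=
          mul_le_mul_of_nonneg_left (by linarith [hr.2]) hbs
        have h5 := h.le_abs s (hmem s hs hst)
        have h6 : |e s| - |e r| ≤ |e r - e s| := by
          rw [abs_sub_comm]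
          exact abs_sub_abs_le_abs_sub _ _
        linarith [hI r t hr.1 hr.2 ht]
      · have h2 := intervalIntegral.integral_add_adjacent_intervals
          (h.intervalIntegrable hr.1 hrs (hst.trans ht)) (h.intervalIntegrable hs hst ht)
        linarith [h.upper r s hr.1 hrs (hst.trans ht), hI s t hs hst ht,
          h.le_abs r ⟨hr.1, hr.2.trans ht⟩]
  · linarith [h.upper s t hs hst ht]

/-- If the state only takes the values `0` and `|e|` at each time, it sticks to the barrier. -/
theorem eq_abs_of_mul_eq_zero (h : IsReflected e ξ a b)
    (h0 : ∀ t ∈ Set.Icc a b, (|e t| - ξ t) * ξ t = 0) {t : ℝ} (hat : a < t) (htb : t ≤ b) :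
    ξ t = |e t| := by
  have htI : t ∈ Set.Icc a b := ⟨hat.le, htb⟩
  by_contra hne
  have hξ : ξ t = 0 := by
    rcases mul_eq_zero.1 (h0 t htI) with h1 | h1
    · exact absurd (by linarith) hne
    · exact h1
  have hpos : 0 < |e t| := lt_of_le_of_ne (abs_nonneg _) (by rw [← hξ]; exact hne)
  -- The rate is positive near t, so either alternative of `lower` makes ξ t positive.
  have hI : ∀ s, a ≤ s → s < t → 0 < ∫ r in s..t, |e r| := by
    intro s hs hst
    refine intervalIntegral.integral_pos hst
      ((h.continuousOn_input.mono (Set.Icc_subset_Icc hs htb)).abs) (fun _ _ => abs_nonneg _)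
      ⟨t, ⟨hst.le, le_rfl⟩, hpos⟩
  rcases h.lower t htI with h1 | ⟨s, hs, h1⟩
  · linarith [hI a le_rfl hat, h.nonneg a ⟨le_rfl, hat.le.trans htb⟩]
  · rcases eq_or_lt_of_le hs.2 with rfl | hst
    · simp only [intervalIntegral.integral_same] at h1
      linarith
    · linarith [hI s hs.1 hst, abs_nonneg (e s)]

end IsReflected

/-- The reflected state with input `e` and initial value `w`. -/
def reflectedState (e : ℝ → ℝ) (w t : ℝ) : ℝ :=
  -- The minimum formula with the integral over [0, t] pulled out. Contact times are written t τ
  -- with τ in the fixed compact set [0, 1], so that the infimum is visibly continuous in t.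
  (∫ r in (0 : ℝ)..t, |e r|) +
    min w (sInf ((fun τ : ℝ => |e (t * τ)| - ∫ r in (0 : ℝ)..(t * τ), |e r|) '' Set.Icc 0 1))

/-- Joint continuity in input, initial value and time is what the compactness argument for the
dissipation needs. -/
theorem continuous_reflectedState {X : Type*} [TopologicalSpace X] {e : X → ℝ → ℝ}
    (he : Continuous e.uncurry) {w : X → ℝ} (hw : Continuous w) {t : X → ℝ} (ht : Continuous t) :
    Continuous fun x => reflectedState (e x) (w x) (t x) := by
  have h1 : Continuous fun p : X × ℝ => ∫ r in (0 : ℝ)..p.2, |e p.1 r| := by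
    refine intervalIntegral.continuous_parametric_intervalIntegral_of_continuous
      (f := fun (p : X × ℝ) r => |e p.1 r|) ?_ continuous_snd
    exact (he.comp (by fun_prop : Continuous fun q : (X × ℝ) × ℝ => (q.1.1, q.2))).abs
  unfold reflectedState
  refine (h1.comp (continuous_id.prodMk ht)).add (hw.min ?_)
  refine isCompact_Icc.continuous_sInf
    (f := fun (x : X) (τ : ℝ) => |e x (t x * τ)| - ∫ r in (0 : ℝ)..(t x * τ), |e x r|) ?_
  have h2 : Continuous fun p : X × ℝ => (p.1, t p.1 * p.2) := by fun_prop
  exact (he.comp h2).abs.sub (h1.comp h2)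

theorem isReflected_reflectedState {e : ℝ → ℝ} (he : Continuous e) {w : ℝ} (hw : 0 ≤ w)
    (hw' : w ≤ |e 0|) (T : ℝ) : IsReflected e (reflectedState e w) 0 T := by
  set I : ℝ → ℝ := fun t => ∫ r in (0 : ℝ)..t, |e r| with hIdef
  have hii : ∀ s t, IntervalIntegrable (fun r => |e r|) volume s t := fun s t =>
    he.abs.intervalIntegrable s t
  have hI : ∀ s t, ∫ r in s..t, |e r| = I t - I s := fun s t => by
    rw [hIdef, intervalIntegral.integral_interval_sub_left (hii _ _) (hii _ _)]
  have hIc : Continuous I := intervalIntegral.continuous_primitive hii 0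
  have hmono : ∀ s t, s ≤ t → I s ≤ I t := fun s t hst => by
    have : 0 ≤ ∫ r in s..t, |e r| := intervalIntegral.integral_nonneg hst fun _ _ => abs_nonneg _
    rw [hI] at this
    linarith
  set S : ℝ → Set ℝ := fun t => (fun τ : ℝ => |e (t * τ)| - I (t * τ)) '' Set.Icc 0 1 with hS
  have hcomp : ∀ t, IsCompact (S t) := fun t => isCompact_Icc.image (by fun_prop)
  have hmemS : ∀ {s t}, 0 ≤ s → s ≤ t → |e s| - I s ∈ S t := by
    intro s t hs hst
    rcases eq_or_lt_of_le (hs.trans hst) with h0 | h0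
    · refine ⟨0, by simp, ?_⟩
      have : s = 0 := by linarith
      simp [this]
    · refine ⟨s / t, ⟨by positivity, (div_le_one h0).2 hst⟩, ?_⟩
      have : t * (s / t) = s := by field_simp
      simp only [this]
  have hne : ∀ t, (S t).Nonempty := fun t => ⟨_, 0, by simp, rfl⟩
  have hSle : ∀ {s t}, 0 ≤ s → s ≤ t → sInf (S t) ≤ |e s| - I s := fun hs hst =>
    csInf_le (hcomp _).bddBelow (hmemS hs hst)
  have hSex : ∀ {t}, 0 ≤ t → ∃ s ∈ Set.Icc 0 t, sInf (S t) = |e s| - I s := by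
    intro t ht
    obtain ⟨τ, hτ, h⟩ := (hcomp t).sInf_mem (hne t)
    exact ⟨t * τ, ⟨mul_nonneg ht hτ.1, mul_le_of_le_one_right ht hτ.2⟩, h.symm⟩
  have hdef : ∀ t, reflectedState e w t = I t + min w (sInf (S t)) := fun t => rfl
  have hI0 : I 0 = 0 := by simp [hIdef]
  have hinit : reflectedState e w 0 = w := by
    rw [hdef, hI0, zero_add, min_eq_left]
    obtain ⟨s, hs, h⟩ := hSex (le_refl 0)
    have : s = 0 := le_antisymm hs.2 hs.1
    rw [h, this, hI0]
    linarith
  refine ⟨he.continuousOn, ?_, ?_, ?_, ?_, ?_⟩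
  · exact (continuous_reflectedState (X := ℝ) (e := fun _ => e) (by
      exact he.comp continuous_snd) continuous_const continuous_id).continuousOn
  · intro t ht
    rw [hdef]
    obtain ⟨s, hs, h⟩ := hSex ht.1
    have h1 := hmono s t hs.2
    have h2 := hmono 0 t ht.1
    rcases min_choice w (sInf (S t)) with h3 | h3 <;> rw [h3]
    · linarith
    · rw [h]
      linarith [abs_nonneg (e s)]
  · intro t ht
    rw [hdef]
    linarith [min_le_right w (sInf (S t)), hSle ht.1 le_rfl]
  · intro s t hs hst _
    rw [hI, hdef, hdef]
    have : min w (sInf (S t)) ≤ min w (sInf (S s)) := by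
      refine min_le_min le_rfl ?_
      obtain ⟨r, hr, h⟩ := hSex hs
      rw [h]
      exact hSle hr.1 (hr.2.trans hst)
    linarith
  · intro t ht
    rw [hI, hinit, hI0, hdef]
    rcases min_choice w (sInf (S t)) with h3 | h3 <;> rw [h3]
    · left
      linarith
    · right
      obtain ⟨s, hs, h⟩ := hSex ht.1
      refine ⟨s, hs, ?_⟩
      rw [hI, h]
      linarith

theorem reflectedState_zero {e : ℝ → ℝ} {w : ℝ} (hw' : w ≤ |e 0|) :
    reflectedState e w 0 = w := by
  simp [reflectedState, hw']

/-! ## Trajectories of hybrid integrator-gain systems with equal frequency and gain -/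

/-- The hybrid integrator-gain system whose integrator frequency and gain value are both `κ`. -/
def HIGS.balanced (κ : ℝ) (hκ : 0 < κ) : HIGS := ⟨κ, κ, hκ.le, hκ⟩

theorem IsLocallyAC.ae_differentiableAt {f : ℝ → ℝ} (hf : IsLocallyAC f) :
    ∀ᵐ t : ℝ, 0 ≤ t → DifferentiableAt ℝ f t := by
  have h : ∀ n : ℕ, ∀ᵐ t : ℝ, t ∈ Set.uIcc (0 : ℝ) (n + 1) → DifferentiableAt ℝ f t := fun n =>
    (hf (n + 1) (by positivity)).ae_differentiableAt
  filter_upwards [ae_all_iff.2 h] with t ht h0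
  obtain ⟨n, hn⟩ := exists_nat_ge t
  refine ht n ?_
  rw [Set.uIcc_of_le (by positivity)]
  exact ⟨h0, by linarith⟩

namespace HIGS.IsSolution

/-- Both sides are continuous, so the almost everywhere constraint holds at every nonnegative time.
-/
theorem sector_le {H : HIGS} {e x : ℝ → ℝ} (h : H.IsSolution e x) {t : ℝ} (ht : 0 ≤ t) :
    1 / H.k * x t ^ 2 ≤ e t * x t := by
  set g : ℝ → ℝ := fun t => e t * x t - 1 / H.k * x t ^ 2 with hg
  have he := h.input_ac.continuousOn
  have hx := h.state_ac.continuousOn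
  have hgc : ContinuousOn g (Set.Ici 0) := (he.mul hx).sub (continuousOn_const.mul (hx.pow 2))
  have hae : g =ᵐ[volume.restrict (Set.Ici (0 : ℝ))] fun t => max (g t) 0 := by
    filter_upwards [h.sector] with r hr
    have : 0 ≤ g r := by
      have h1 : e r * x r ≥ 1 / H.k * x r ^ 2 := hr
      simp only [hg]
      linarith
    exact (max_eq_left this).symm
  have := Measure.eqOn_of_ae_eq hae hgc (hgc.sup continuousOn_const) (by
    rw [interior_Ici, closure_Ioi]) ht
  have h2 : 0 ≤ g t := by
    rw [this]
    exact le_max_right _ _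
  simp only [hg] at h2
  linarith

variable {κ : ℝ} {hκ : 0 < κ} {e x : ℝ → ℝ}

theorem sq_le (h : (balanced κ hκ).IsSolution e x) {t : ℝ} (ht : 0 ≤ t) :
    x t ^ 2 ≤ κ * (e t * x t) := by
  have h1 : 1 / κ * x t ^ 2 ≤ e t * x t := h.sector_le ht
  calc x t ^ 2 = κ * (1 / κ * x t ^ 2) := by field_simp
    _ ≤ _ := mul_le_mul_of_nonneg_left h1 hκ.le

theorem input_mul_nonneg (h : (balanced κ hκ).IsSolution e x) {t : ℝ} (ht : 0 ≤ t) :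
    0 ≤ e t * x t :=
  (mul_nonneg_iff_of_pos_left hκ).1 ((sq_nonneg _).trans (h.sq_le ht))

theorem abs_le (h : (balanced κ hκ).IsSolution e x) {t : ℝ} (ht : 0 ≤ t) :
    |x t| ≤ κ * |e t| := by
  have h1 := h.sq_le ht
  have h2 : |x t| * |x t| ≤ κ * |e t| * |x t| := by
    calc |x t| * |x t| = x t ^ 2 := by rw [abs_mul_abs_self, sq]
      _ ≤ κ * (e t * x t) := h1
      _ ≤ κ * |e t * x t| := mul_le_mul_of_nonneg_left (le_abs_self _) hκ.le
      _ = κ * |e t| * |x t| := by rw [abs_mul, mul_assoc]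
  rcases (abs_nonneg (x t)).eq_or_lt with h0 | h0
  · rw [← h0]
    positivity
  · exact le_of_mul_le_mul_right h2 h0

/-- At almost every positive time the state moves at the integrator rate, or else it sits on the
boundary of the sector and moves with it. -/
theorem ae_modes (h : (balanced κ hκ).IsSolution e x) :
    ∀ᵐ t : ℝ, 0 ≤ t → ∃ e' x' : ℝ, HasDerivAt e e' t ∧ HasDerivAt x x' t ∧
      (x t = 0 → x' = 0) ∧
      (x' = κ * e t ∨ (x t = κ * e t ∧ x' = κ * e' ∧ e' * e t < e t ^ 2)) := by
  have h1 := (ae_restrict_iff' measurableSet_Ici).1 h.sector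
  have h2 := (ae_restrict_iff' measurableSet_Ici).1 h.integrator
  filter_upwards [h1, h2, h.input_ac.ae_differentiableAt, h.state_ac.ae_differentiableAt,
    ae_hasDerivAt_eq_zero_of_eq_zero x, ae_hasDerivAt_eq_zero_of_eq_zero (fun t => x t - κ * e t)]
    with t hs hi hde hdx hz hb ht
  refine ⟨deriv e t, deriv x t, (hde ht).hasDerivAt, (hdx ht).hasDerivAt,
    fun h0 => hz h0 _ (hdx ht).hasDerivAt, ?_⟩
  by_cases hm : (e t, x t, deriv e t) ∈ (balanced κ hκ).gainMode
  · right
    have hg1 : x t = κ * e t := hm.2.1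
    have hg2 : κ * e t ^ 2 > κ * deriv e t * e t := hm.2.2
    refine ⟨hg1, ?_, ?_⟩
    -- x - κ e vanishes at the times of gain mode, hence its derivative vanishes at almost all of
    -- them.
    · have := hb (by simp [hg1]) _ ((hdx ht).hasDerivAt.sub ((hde ht).hasDerivAt.const_mul κ))
      linarith
    · rw [mul_assoc] at hg2
      exact lt_of_mul_lt_mul_left hg2 hκ.le
  · left
    exact (hi ht ⟨hs ht, hm⟩).deriv

/-- In integrator mode |x| grows at rate |e|. In gain mode x = e, and the strict inequality that
defines the mode says that |x| grows more slowly. Thus the rate is never exceeded and is attained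
off the barrier. -/
theorem isReflected {h1 : (0 : ℝ) < 1} (h : (balanced 1 h1).IsSolution e x) {a b : ℝ}
    (ha : 0 ≤ a) : IsReflected e (fun t => |x t|) a b := by
  have hsub : Set.Icc a b ⊆ Set.Ici 0 := fun t ht => ha.trans ht.1
  have hec : ContinuousOn e (Set.Icc a b) := h.input_ac.continuousOn.mono hsub
  have hxc : ContinuousOn (fun t => |x t|) (Set.Icc a b) := (h.state_ac.continuousOn.mono hsub).abs
  have hle : ∀ t, 0 ≤ t → |x t| ≤ |e t| := fun t ht => by simpa using h.abs_le ht
  have habs : ∀ᵐ t : ℝ, 0 ≤ t → ∀ f', HasDerivAt (fun r => |x r|) f' t →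
      f' ≤ |e t| ∧ (|x t| < |e t| → f' = |e t|) := by
    filter_upwards [h.ae_modes, ae_hasDerivAt_eq_zero_of_eq_zero fun r => |x r|] with t hm hz ht f' hf'
    obtain ⟨e', x', -, hx', hx0, hor⟩ := hm ht
    rcases eq_or_ne (x t) 0 with h0 | h0
    · have hf0 : f' = 0 := hz (by simp [h0]) f' hf'
      refine ⟨by rw [hf0]; exact abs_nonneg _, fun hlt => ?_⟩
      rcases hor with h2 | h2
      · rw [hx0 h0, one_mul] at h2
        rw [hf0, ← h2, abs_zero]
      · rw [h2.1] at hlt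
        simp at hlt
    · have hex := h.input_mul_nonneg ht
      rcases lt_or_gt_of_ne h0 with hneg | hpos
      · have hf : f' = -x' := hf'.unique (by
          simpa [Function.comp_def] using (hasDerivAt_abs_neg hneg).comp t hx')
        have he0 : e t ≤ 0 := by nlinarith
        rw [abs_of_nonpos he0, abs_of_neg hneg]
        rcases hor with h2 | ⟨h2, h3, h4⟩
        · constructor <;> intros <;> linarith
        · have : -e' < -e t := by nlinarith
          constructor <;> intros <;> linarith
      · have hf : f' = x' := hf'.unique (by
          simpa [Function.comp_def] using (hasDerivAt_abs_pos hpos).comp t hx')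
        have he0 : 0 ≤ e t := by nlinarith
        rw [abs_of_nonneg he0, abs_of_pos hpos]
        rcases hor with h2 | ⟨h2, h3, h4⟩
        · constructor <;> intros <;> linarith
        · have : e' < e t := by nlinarith
          constructor <;> intros <;> linarith
  refine ⟨hec, hxc, fun t _ => abs_nonneg _, fun t ht => hle t (hsub ht), ?_, ?_⟩
  · intro s t hs hst ht
    have hac := (h.state_ac.on (ha.trans hs) hst).abs
    have := hac.sub_le_integral hst (hec.mono (Set.Icc_subset_Icc hs ht)).abs (by
      filter_upwards [habs] with r hr hrI f' hf'
      exact (hr (ha.trans (hs.trans hrI.1.le)) f' hf').1)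
    linarith
  · intro t ht
    have key : ∀ s, a ≤ s → s ≤ t → (∀ r ∈ Set.Ioc s t, |x r| < |e r|) →
        |x s| + (∫ r in s..t, |e r|) ≤ |x t| := by
      intro s hs hst hlt
      have hac := (h.state_ac.on (ha.trans hs) hst).abs.neg
      have := hac.sub_le_integral hst (hec.mono (Set.Icc_subset_Icc hs ht.2)).abs.neg (by
        filter_upwards [habs] with r hr hrI f' hf'
        have hd : HasDerivAt (fun r => |x r|) (-f') r := by
          simpa using hf'.neg
        have := (hr (ha.trans (hs.trans hrI.1.le)) _ hd).2 (hlt r ⟨hrI.1, hrI.2.le⟩)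
        simp only [Pi.neg_apply]
        linarith)
      simp only [Pi.neg_apply, intervalIntegral.integral_neg] at this
      linarith
    have hsubt : Set.Icc a t ⊆ Set.Icc a b := Set.Icc_subset_Icc_right ht.2
    -- The contact times up to t; after the last of them, or from a on if there is none, |x| moves
    -- at the full rate |e|.
    set K : Set ℝ := {r ∈ Set.Icc a t | |e r| ≤ |x r|} with hK
    have hKc : IsCompact K := by
      refine isCompact_Icc.of_isClosed_subset ?_ (Set.sep_subset _ _)
      exact isClosed_Icc.isClosed_le (hec.mono hsubt).abs (hxc.mono hsubt)
    rcases K.eq_empty_or_nonempty with hemp | hne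
    · left
      refine key a le_rfl ht.1 fun r hr => ?_
      by_contra hcon
      have : r ∈ K := ⟨⟨hr.1.le, hr.2⟩, not_lt.1 hcon⟩
      rw [hemp] at this
      exact this
    · right
      obtain ⟨s, hsK, hmax⟩ := hKc.exists_isGreatest hne
      refine ⟨s, hsK.1, ?_⟩
      have := key s hsK.1.1 hsK.1.2 fun r hr => by
        by_contra hcon
        have : r ∈ K := ⟨⟨hsK.1.1.trans hr.1.le, hr.2⟩, not_lt.1 hcon⟩
        exact absurd (hmax this) (not_le.2 hr.1)
      linarith [hsK.2]

end HIGS.IsSolution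

/-! ## Construction of trajectories -/

/-- The number with modulus `p` and the sign of `a`. -/
def withSign (a p : ℝ) : ℝ := if 0 ≤ a then p else -p

theorem abs_withSign {a p : ℝ} (hp : 0 ≤ p) : |withSign a p| = p := by
  unfold withSign
  split_ifs
  · exact abs_of_nonneg hp
  · rw [abs_neg, abs_of_nonneg hp]

theorem mul_withSign (a p : ℝ) : a * withSign a p = |a| * p := by
  unfold withSign
  split_ifs with h
  · rw [abs_of_nonneg h]
  · rw [abs_of_neg (not_le.1 h)]
    ring

/-- For opposite signs p + q ≤ |a| + |b| = |a - b|. Attaching the sign of the input to the modulus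
of the state therefore costs no continuity. -/
theorem abs_withSign_sub_le {a b p q : ℝ} (hp : 0 ≤ p) (hpa : p ≤ |a|) (hq : 0 ≤ q)
    (hqb : q ≤ |b|) : |withSign a p - withSign b q| ≤ max |a - b| |p - q| := by
  unfold withSign
  split_ifs with ha hb hb
  · exact le_max_right _ _
  · refine le_max_of_le_left ?_
    rw [not_le] at hb
    rw [abs_of_nonneg ha] at hpa
    rw [abs_of_neg hb] at hqb
    rw [abs_of_nonneg (by linarith), abs_of_nonneg (by linarith)]
    linarith
  · refine le_max_of_le_left ?_
    rw [not_le] at ha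
    rw [abs_of_nonneg hb] at hqb
    rw [abs_of_neg ha] at hpa
    rw [abs_of_nonpos (by linarith), abs_of_nonpos (by linarith)]
    linarith
  · refine le_max_of_le_right ?_
    rw [show -p - -q = -(p - q) by ring, abs_neg]

/-- The output on `[0, ∞)` of the hybrid integrator-gain system with `ω = k = 1`, with input `e`
and initial state `w`, extended by a constant to negative times. -/
def higsOutput (e : ℝ → ℝ) (w t : ℝ) : ℝ :=
  withSign (e (max t 0)) (reflectedState e |w| (max t 0))

/-- Lipschitz continuity on bounded intervals of nonnegative times. -/
def IsLocallyLipschitzOnNonneg (f : ℝ → ℝ) : Prop :=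
  ∀ T : ℝ, 0 < T → ∃ L : ℝ, ∀ s t, 0 ≤ s → s ≤ t → t ≤ T → |f t - f s| ≤ L * (t - s)

theorem IsLocallyLipschitzOnNonneg.isLocallyAC {f : ℝ → ℝ} (hf : IsLocallyLipschitzOnNonneg f) :
    IsLocallyAC f := by
  intro T hT
  obtain ⟨L, hL⟩ := hf T hT
  refine LipschitzOnWith.absolutelyContinuousOnInterval (K := (max L 0).toNNReal) ?_
  rw [Set.uIcc_of_le hT.le]
  have key : ∀ s t, 0 ≤ s → s ≤ t → t ≤ T → dist (f t) (f s) ≤ max L 0 * dist t s := by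
    intro s t hs hst ht
    rw [Real.dist_eq, Real.dist_eq, abs_of_nonneg (sub_nonneg.2 hst)]
    exact (hL s t hs hst ht).trans
      (mul_le_mul_of_nonneg_right (le_max_left _ _) (sub_nonneg.2 hst))
  refine LipschitzOnWith.of_dist_le_mul fun s hs t ht => ?_
  rw [Real.coe_toNNReal _ (le_max_right _ _)]
  rcases le_total s t with h | h
  · rw [dist_comm, dist_comm s t]
    exact key s t hs.1 h ht.2
  · exact key t s ht.1 h hs.2

section higsOutput

variable {e : ℝ → ℝ} {w : ℝ}

theorem higsOutput_of_nonneg {t : ℝ} (ht : 0 ≤ t) :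
    higsOutput e w t = withSign (e t) (reflectedState e |w| t) := by
  rw [higsOutput, max_eq_left ht]

theorem isReflected_abs_higsOutput (he : Continuous e) (hw : |w| ≤ |e 0|) (T : ℝ) :
    IsReflected e (reflectedState e |w|) 0 T :=
  isReflected_reflectedState he (abs_nonneg w) hw T

theorem abs_higsOutput (he : Continuous e) (hw : |w| ≤ |e 0|) {t : ℝ} (ht : 0 ≤ t) :
    |higsOutput e w t| = reflectedState e |w| t := by
  rw [higsOutput_of_nonneg ht]
  exact abs_withSign ((isReflected_abs_higsOutput he hw t).nonneg t ⟨ht, le_rfl⟩)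

theorem abs_higsOutput_le (he : Continuous e) (hw : |w| ≤ |e 0|) {t : ℝ} (ht : 0 ≤ t) :
    |higsOutput e w t| ≤ |e t| := by
  rw [abs_higsOutput he hw ht]
  exact (isReflected_abs_higsOutput he hw t).le_abs t ⟨ht, le_rfl⟩

theorem mul_higsOutput (e : ℝ → ℝ) (w : ℝ) {t : ℝ} (ht : 0 ≤ t) :
    e t * higsOutput e w t = |e t| * reflectedState e |w| t := by
  rw [higsOutput_of_nonneg ht, mul_withSign]

theorem higsOutput_zero (hw : |w| ≤ |e 0|) (hs : 0 ≤ e 0 * w) : higsOutput e w 0 = w := by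
  rw [higsOutput_of_nonneg le_rfl, reflectedState_zero hw, withSign]
  split_ifs with h
  · rcases h.eq_or_lt with h0 | h0
    · rw [← h0, abs_zero] at hw
      have : w = 0 := abs_nonpos_iff.1 hw
      simp [this]
    · exact abs_of_nonneg (by by_contra hc; push Not at hc; nlinarith)
  · push Not at h
    rw [abs_of_nonpos (by by_contra hc; push Not at hc; nlinarith), neg_neg]

theorem abs_higsOutput_sub_le (he : Continuous e) (hw : |w| ≤ |e 0|) {s t : ℝ} (hs : 0 ≤ s)
    (ht : 0 ≤ t) : |higsOutput e w t - higsOutput e w s| ≤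
      max |e t - e s| |reflectedState e |w| t - reflectedState e |w| s| := by
  have h := isReflected_abs_higsOutput he hw
  rw [higsOutput_of_nonneg hs, higsOutput_of_nonneg ht]
  exact abs_withSign_sub_le ((h t).nonneg t ⟨ht, le_rfl⟩) ((h t).le_abs t ⟨ht, le_rfl⟩)
    ((h s).nonneg s ⟨hs, le_rfl⟩) ((h s).le_abs s ⟨hs, le_rfl⟩)

theorem continuous_higsOutput (he : Continuous e) (hw : |w| ≤ |e 0|) :
    Continuous (higsOutput e w) := by
  have hr : Continuous fun t : ℝ => reflectedState e |w| (max t 0) :=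
    continuous_reflectedState (X := ℝ) (e := fun _ => e) (w := fun _ => |w|)
      (t := fun t : ℝ => max t 0) (he.comp continuous_snd) continuous_const
      (continuous_id.max continuous_const)
  have hm : Continuous fun t : ℝ => e (max t 0) := he.comp (continuous_id.max continuous_const)
  have hmax : ∀ t, higsOutput e w t = higsOutput e w (max t 0) := fun t => by
    rw [higsOutput, higsOutput, max_eq_left (le_max_right t 0)]
  rw [continuous_iff_continuousAt]
  intro s
  rw [ContinuousAt, tendsto_iff_dist_tendsto_zero]
  have hz : Tendsto (fun t => max |e (max t 0) - e (max s 0)|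
      |reflectedState e |w| (max t 0) - reflectedState e |w| (max s 0)|) (𝓝 s) (𝓝 0) := by
    have : Continuous (fun t => max |e (max t 0) - e (max s 0)|
      |reflectedState e |w| (max t 0) - reflectedState e |w| (max s 0)|) := by fun_prop
    simpa using this.tendsto s
  refine squeeze_zero (fun _ => dist_nonneg) (fun t => ?_) hz
  rw [Real.dist_eq, hmax t, hmax s]
  exact abs_higsOutput_sub_le he hw (le_max_right _ _) (le_max_right _ _)

theorem isLocallyLipschitzOnNonneg_higsOutput (he : Continuous e) (hw : |w| ≤ |e 0|)
    (hL : IsLocallyLipschitzOnNonneg e) : IsLocallyLipschitzOnNonneg (higsOutput e w) := by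
  intro T hT
  obtain ⟨L, hL⟩ := hL T hT
  obtain ⟨B, hB⟩ := (isCompact_Icc (a := (0 : ℝ)) (b := T)).exists_bound_of_continuousOn
    he.continuousOn
  refine ⟨max L B, fun s t hs hst ht => ?_⟩
  have hts : 0 ≤ t - s := sub_nonneg.2 hst
  have h1 : ∀ q r, 0 ≤ q → q ≤ r → r ≤ T → |e r - e q| ≤ max L B * (r - q) :=
    fun q r hq hqr hr => (hL q r hq hqr hr).trans
      (mul_le_mul_of_nonneg_right (le_max_left _ _) (sub_nonneg.2 hqr))
  refine (abs_higsOutput_sub_le he hw hs (hs.trans hst)).trans (max_le (h1 s t hs hst ht) ?_)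
  exact (isReflected_abs_higsOutput he hw T).abs_sub_le
    (fun r hr => (hB r hr).trans (le_max_right _ _))
    (fun q hq r hr hqr => h1 q r hq.1 hqr hr.2) hs hst ht

theorem hasDerivAt_nonneg_of_eventually_nonneg {h : ℝ → ℝ} {h' t : ℝ} (hd : HasDerivAt h h' t)
    (h0 : h t = 0) (hev : ∀ᶠ r in 𝓝[>] t, 0 ≤ h r) : 0 ≤ h' := by
  have h1 : Tendsto (slope h t) (𝓝[>] t) (𝓝 h') :=
    (hasDerivAt_iff_tendsto_slope.1 hd).mono_left (nhdsWithin_mono _ fun r hr => ne_of_gt hr)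
  refine ge_of_tendsto h1 ?_
  filter_upwards [hev, self_mem_nhdsWithin] with r hr hrt
  rw [slope_def_field, h0, sub_zero]
  exact div_nonneg hr (sub_nonneg.2 (le_of_lt hrt))

/-- Along `higsOutput` the modulus of the state never exceeds the integrator rate, and attains it
away from the barrier. -/
theorem higsOutput_rate (he : Continuous e) (hw : |w| ≤ |e 0|) {t x' : ℝ} (ht : 0 ≤ t)
    (hx : HasDerivAt (higsOutput e w) x' t) (h0 : e t ≠ 0) :
    x' * e t ≤ e t ^ 2 ∧ (higsOutput e w t ≠ e t → x' = e t) := by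
  set x := higsOutput e w with hxdef
  have hR := isReflected_abs_higsOutput he hw
  have hxc : Continuous x := continuous_higsOutput he hw
  have hξ : ∀ r, 0 ≤ r → reflectedState e |w| r = |x r| := fun r hr => (abs_higsOutput he hw hr).symm
  set σ : ℝ := withSign (e t) 1 with hσ
  have hσe : σ * e t = |e t| := by rw [mul_comm, mul_withSign, mul_one]
  have hσσ : σ * σ = 1 := by
    rw [hσ, withSign]
    split_ifs <;> norm_num
  have hsgn : ∀ᶠ r in 𝓝[>] t, σ * x r = |x r| := by
    have hev : ∀ᶠ r in 𝓝[>] t, 0 < σ * e r := by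
      apply nhdsWithin_le_nhds
      have hc : ContinuousAt (fun r => σ * e r) t := by fun_prop
      exact hc.eventually (lt_mem_nhds (by simpa only [hσe] using abs_pos.2 h0))
    filter_upwards [hev, self_mem_nhdsWithin] with r hr hrt
    have hr0 : 0 ≤ r := ht.trans (le_of_lt hrt)
    have h1 : 0 ≤ e r * x r := by
      rw [mul_higsOutput e w hr0, hξ r hr0]
      positivity
    have h2 : 0 ≤ σ * x r := by
      have : (σ * e r) * (σ * x r) = e r * x r := by
        calc _ = (σ * σ) * (e r * x r) := by ring
          _ = _ := by rw [hσσ, one_mul]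
      rw [← this] at h1
      by_contra hc
      push Not at hc
      nlinarith
    rw [← abs_of_nonneg h2, abs_mul]
    have : |σ| = 1 := by
      rw [hσ, abs_withSign zero_le_one]
    rw [this, one_mul]
  have hsgn0 : σ * x t = |x t| := by
    have h1 : e t * x t = |e t| * |x t| := by
      rw [mul_higsOutput e w ht, hξ t ht]
    have h2 : |e t| * (σ * x t) = |e t| * |x t| := by
      rw [← h1, ← hσe]
      calc _ = (σ * σ) * (e t * x t) := by ring
        _ = _ := by rw [hσσ, one_mul]
    exact mul_left_cancel₀ (abs_ne_zero.2 h0) h2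
  -- The gap between free growth at rate |e| and the actual modulus. It is 0 at t, nonnegative just
  -- after t, and identically 0 just after t if the barrier is not touched, so its derivative yields
  -- both claims.
  have hd : HasDerivAt (fun r => |x t| + (∫ q in t..r, |e q|) - σ * x r) (|e t| - σ * x') t := by
    have h1 := intervalIntegral.integral_hasDerivAt_right (he.abs.intervalIntegrable t t)
      he.abs.aestronglyMeasurable.stronglyMeasurableAtFilter he.abs.continuousAt
    exact (h1.const_add _).sub (hx.const_mul σ)
  have hz : |x t| + (∫ q in t..t, |e q|) - σ * x t = 0 := by simp [hsgn0]
  constructor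
  · have := hasDerivAt_nonneg_of_eventually_nonneg hd hz (by
      filter_upwards [hsgn, self_mem_nhdsWithin] with r hr hrt
      have hrt' : t ≤ r := le_of_lt hrt
      have := (hR r).upper t r ht hrt' le_rfl
      rw [hξ t ht, hξ r (ht.trans hrt')] at this
      rw [hr]
      linarith)
    have h2 : σ * x' * |e t| ≤ |e t| * |e t| :=
      mul_le_mul_of_nonneg_right (by linarith) (abs_nonneg _)
    rw [abs_mul_abs_self] at h2
    calc x' * e t = σ * x' * |e t| := by
          rw [← hσe]
          calc _ = (σ * σ) * (x' * e t) := by rw [hσσ, one_mul]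
            _ = _ := by ring
      _ ≤ _ := by rw [sq]; exact h2
  · intro hne
    have hlt : |x t| < |e t| := by
      refine lt_of_le_of_ne (abs_higsOutput_le he hw ht) fun h => hne ?_
      have h1 : σ * x t = σ * e t := by rw [hsgn0, hσe, h]
      calc x t = σ * σ * x t := by rw [hσσ, one_mul]
        _ = σ * (σ * e t) := by rw [mul_assoc, h1]
        _ = e t := by rw [← mul_assoc, hσσ, one_mul]
    have hev : ∀ᶠ r in 𝓝[>] t, |x t| + (∫ q in t..r, |e q|) - σ * x r = 0 := by
      have hop : ∀ᶠ r in 𝓝 t, |x r| < |e r| :=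
        (hxc.abs.continuousAt).eventually_lt he.abs.continuousAt hlt
      obtain ⟨δ, hδ, hball⟩ := Metric.eventually_nhds_iff.1 hop
      have hIoo : Set.Ioo t (t + δ) ∈ 𝓝[>] t := Ioo_mem_nhdsGT (by linarith)
      filter_upwards [hsgn, hIoo] with r hr hrI
      have := (hR r).eq_add_integral ht hrI.1.le le_rfl fun q hq => by
        have hq0 : 0 ≤ q := ht.trans hq.1
        rw [hξ q hq0]
        refine hball ?_
        rw [Real.dist_eq, abs_of_nonneg (sub_nonneg.2 hq.1)]
        linarith [hq.2, hrI.2]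
      rw [hξ t ht, hξ r (ht.trans hrI.1.le)] at this
      rw [hr]
      linarith
    have h1 := hasDerivAt_nonneg_of_eventually_nonneg hd hz (hev.mono fun r hr => hr.ge)
    have h2 := hasDerivAt_nonneg_of_eventually_nonneg hd.neg (by simp [hsgn0])
      (hev.mono fun r hr => by simp only [Pi.neg_apply, hr, neg_zero, le_refl])
    have h3 : σ * x' = σ * e t := by rw [hσe]; linarith
    calc x' = σ * (σ * x') := by rw [← mul_assoc, hσσ, one_mul]
      _ = e t := by rw [h3, ← mul_assoc, hσσ, one_mul]

/-- A balanced system with gain κ is κ times the unit one, so a single construction serves both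
stages. -/
theorem isSolution_higsOutput (he : Continuous e) (hL : IsLocallyLipschitzOnNonneg e)
    (hw : |w| ≤ |e 0|) {κ : ℝ} (hκ : 0 < κ) :
    (HIGS.balanced κ hκ).IsSolution e fun t => κ * higsOutput e w t := by
  set x := higsOutput e w with hx
  have hxac : IsLocallyAC x := (isLocallyLipschitzOnNonneg_higsOutput he hw hL).isLocallyAC
  have hsec : ∀ t, 0 ≤ t → (e t, κ * x t, deriv e t) ∈ (HIGS.balanced κ hκ).sector := by
    intro t ht
    change 1 / κ * (κ * x t) ^ 2 ≤ e t * (κ * x t)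
    have h1 : x t ^ 2 ≤ e t * x t := by
      rw [← sq_abs, hx, abs_higsOutput he hw ht, mul_higsOutput e w ht, sq]
      have hR := isReflected_abs_higsOutput he hw t
      exact mul_le_mul_of_nonneg_right (hR.le_abs t ⟨ht, le_rfl⟩) (hR.nonneg t ⟨ht, le_rfl⟩)
    calc 1 / κ * (κ * x t) ^ 2 = κ * x t ^ 2 := by field_simp
      _ ≤ κ * (e t * x t) := mul_le_mul_of_nonneg_left h1 hκ.le
      _ = _ := by ring
  refine ⟨hL.isLocallyAC, fun T hT => (hxac T hT).const_mul κ, ?_, ?_, ?_⟩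
  · exact (ae_restrict_iff' measurableSet_Ici).2 (ae_of_all _ hsec)
  · rw [ae_restrict_iff' measurableSet_Ici]
    filter_upwards [hxac.ae_differentiableAt, hL.isLocallyAC.ae_differentiableAt,
      ae_hasDerivAt_eq_zero_of_eq_zero x, ae_hasDerivAt_eq_zero_of_eq_zero (fun t => x t - e t)]
      with t hdx hde hz hb ht hm
    have hxd := (hdx ht).hasDerivAt
    have hed := (hde ht).hasDerivAt
    suffices h : deriv x t = e t by
      have := hxd.const_mul κ
      rw [h] at this
      exact this
    rcases eq_or_ne (e t) 0 with h0 | h0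
    · rw [h0]
      refine hz ?_ _ hxd
      have := abs_higsOutput_le he hw ht
      rw [h0, abs_zero] at this
      exact abs_nonpos_iff.1 this
    · obtain ⟨h1, h2⟩ := higsOutput_rate he hw ht hxd h0
      by_cases hxe : x t = e t
      · have h3 : deriv x t - deriv e t = 0 := hb (by simp [hxe]) _ (hxd.sub hed)
        -- On the boundary of the sector but outside gain mode e' e ≥ e². Since x' = e' there and x'
        -- e ≤ e², only x' = e is left, which is the integrator equation.
        have h4 : ¬ κ * e t ^ 2 > κ * deriv e t * e t := fun hgt =>
          hm.2 ⟨hm.1, by change κ * x t = κ * e t; rw [hxe], hgt⟩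
        rw [not_lt, mul_assoc] at h4
        have h5 := le_of_mul_le_mul_left h4 hκ
        have h6 : deriv x t * e t = e t * e t := by
          rw [show deriv x t = deriv e t by linarith] at h1 ⊢
          linarith [sq (e t)]
        exact mul_right_cancel₀ h0 h6
      · exact h2 hxe
  · exact ae_of_all _ fun t hm => hm.2.1

end higsOutput

/-! ## Existence of closed-loop trajectories -/

theorem integral_exp_mul_le {l : ℝ} (hl : 0 < l) (s t : ℝ) :
    ∫ r in s..t, Real.exp (l * r) ≤ Real.exp (l * t) / l := by
  have hd : ∀ r ∈ Set.uIcc s t, HasDerivAt (fun r => Real.exp (l * r) / l) (Real.exp (l * r)) r := by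
    intro r _
    have := (((hasDerivAt_id r).const_mul l).exp).div_const l
    simpa [hl.ne'] using this
  rw [intervalIntegral.integral_eq_sub_of_hasDerivAt hd
    ((by fun_prop : Continuous fun r => Real.exp (l * r)).intervalIntegrable _ _)]
  linarith [div_nonneg (Real.exp_pos (l * s)).le hl.le]

/-- In the exponentially weighted norm the input error plus its integral is at most (1 + 1/l) M exp
(l t), whence the factor 2 for l ≥ 1. The constant does not depend on the length of the time
interval. -/
theorem abs_higsOutput_sub_higsOutput_le {e e' : ℝ → ℝ} (he : Continuous e) (he' : Continuous e')
    {w : ℝ} (hw : |w| ≤ |e 0|) (hw' : |w| ≤ |e' 0|) {l M : ℝ} (hl : 1 ≤ l) (hM : 0 ≤ M)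
    (h : ∀ r, 0 ≤ r → |e r - e' r| ≤ M * Real.exp (l * r)) {t : ℝ} (ht : 0 ≤ t) :
    |higsOutput e w t - higsOutput e' w t| ≤ 2 * M * Real.exp (l * t) := by
  have hR := isReflected_abs_higsOutput he hw t
  have hR' := isReflected_abs_higsOutput he' hw' t
  have htI : t ∈ Set.Icc 0 t := ⟨ht, le_rfl⟩
  have hl0 : 0 < l := by linarith
  have hM' : M * Real.exp (l * t) ≤ 2 * M * Real.exp (l * t) := by
    nlinarith [Real.exp_pos (l * t), mul_nonneg hM (Real.exp_pos (l * t)).le]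
  have hQ : ∀ r ∈ Set.Icc 0 t, M * Real.exp (l * r) + (∫ q in r..t, M * Real.exp (l * q)) ≤
      2 * M * Real.exp (l * t) := by
    intro r hr
    rw [intervalIntegral.integral_const_mul]
    have h1 : Real.exp (l * r) ≤ Real.exp (l * t) :=
      Real.exp_le_exp.2 (mul_le_mul_of_nonneg_left hr.2 hl0.le)
    have h2 : ∫ q in r..t, Real.exp (l * q) ≤ Real.exp (l * t) :=
      (integral_exp_mul_le hl0 r t).trans (div_le_self (Real.exp_pos _).le hl)
    nlinarith
  have hDc : Continuous fun r => M * Real.exp (l * r) := by fun_prop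
  have hD0 : ∀ r, 0 ≤ M * Real.exp (l * r) := fun r => mul_nonneg hM (Real.exp_pos _).le
  have hi : reflectedState e |w| 0 = reflectedState e' |w| 0 := by
    rw [reflectedState_zero hw, reflectedState_zero hw']
  have h1 := hR.le_add hR' hi.ge hDc hD0 htI (fun r hr => by
    have := abs_sub_abs_le_abs_sub (e' r) (e r)
    rw [abs_sub_comm] at this
    linarith [h r hr.1]) hQ
  have h2 := hR'.le_add hR hi.le hDc hD0 htI (fun r hr => by
    have := abs_sub_abs_le_abs_sub (e r) (e' r)
    linarith [h r hr.1]) hQ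
  rw [higsOutput_of_nonneg ht, higsOutput_of_nonneg ht]
  refine (abs_withSign_sub_le (hR.nonneg t htI) (hR.le_abs t htI) (hR'.nonneg t htI)
    (hR'.le_abs t htI)).trans (max_le ((h t ht).trans hM') ?_)
  rw [abs_le]
  constructor <;> linarith

section Picard

variable {E : Type*} [NormedAddCommGroup E] [NormedSpace ℝ E] [CompleteSpace E]

open BoundedContinuousFunction in
-- Picard iteration in the space of bounded continuous functions, with the weighted derivative h =
-- exp (-l t) x' as unknown. For large l this contracts on the whole half-line at once, so no
-- continuation argument is needed.
theorem exists_cascade_trajectory (A : E →L[ℝ] E) (b : E) (c : E →L[ℝ] ℝ) {κ : ℝ} (hκ : 0 ≤ κ)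
    (x₀ : E) {w₁ w₂ : ℝ} (hw₁ : |w₁| ≤ |c x₀|) (hs₁ : 0 ≤ c x₀ * w₁) (hw₂ : |w₂| ≤ |w₁|) :
    ∃ x : ℝ → E, x 0 = x₀ ∧ Continuous x ∧ IsLocallyLipschitzOnNonneg (fun t => c (x t)) ∧
      ∀ t, 0 ≤ t → HasDerivAt x
        (A (x t) + (κ * higsOutput (higsOutput (fun t => c (x t)) w₁) w₂ t) • b) t := by
  -- The factor 4 is 2 · 2: each hybrid stage at most doubles a weighted error. The choice of l
  -- below makes K / l ≤ 1/2.
  set K : ℝ := ‖A‖ + 4 * κ * ‖b‖ * ‖c‖ with hK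
  have hK0 : 0 ≤ K := by positivity
  set l : ℝ := 2 * K + 1 with hl
  have hl1 : 1 ≤ l := by linarith
  have hl0 : 0 < l := by linarith
  let X : (ℝ →ᵇ E) → ℝ → E := fun h t => x₀ + ∫ s in (0 : ℝ)..t, Real.exp (l * s) • h s
  have hgc : ∀ h : ℝ →ᵇ E, Continuous fun s => Real.exp (l * s) • h s := fun h =>
    (by fun_prop : Continuous fun s => Real.exp (l * s)).smul h.continuous
  have hXd : ∀ (h : ℝ →ᵇ E) t, HasDerivAt (X h) (Real.exp (l * t) • h t) t := by
    intro h t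
    have := intervalIntegral.integral_hasDerivAt_right ((hgc h).intervalIntegrable 0 t)
      (hgc h).aestronglyMeasurable.stronglyMeasurableAtFilter (hgc h).continuousAt
    exact this.const_add _
  have hXc : ∀ h, Continuous (X h) := fun h =>
    continuous_iff_continuousAt.2 fun t => (hXd h t).continuousAt
  have hX0 : ∀ h, X h 0 = x₀ := fun h => by simp [X]
  have hXsub : ∀ (h h' : ℝ →ᵇ E) t, 0 ≤ t →
      ‖X h t - X h' t‖ ≤ ‖h - h'‖ / l * Real.exp (l * t) := by
    intro h h' t ht
    have h1 : X h t - X h' t = ∫ s in (0 : ℝ)..t, Real.exp (l * s) • (h - h') s := by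
      simp only [X, add_sub_add_left_eq_sub]
      rw [← intervalIntegral.integral_sub ((hgc h).intervalIntegrable 0 t)
        ((hgc h').intervalIntegrable 0 t)]
      simp [smul_sub]
    rw [h1]
    refine (intervalIntegral.norm_integral_le_integral_norm ht).trans ?_
    have h2 : ∫ s in (0 : ℝ)..t, ‖Real.exp (l * s) • (h - h') s‖ ≤
        ∫ s in (0 : ℝ)..t, ‖h - h'‖ * Real.exp (l * s) := by
      refine intervalIntegral.integral_mono_on ht ((hgc (h - h')).norm.intervalIntegrable 0 t)
        ((by fun_prop : Continuous fun s => ‖h - h'‖ * Real.exp (l * s)).intervalIntegrable 0 t)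
        fun s _ => ?_
      rw [norm_smul, Real.norm_of_nonneg (Real.exp_pos _).le, mul_comm]
      exact mul_le_mul_of_nonneg_right ((h - h').norm_coe_le_norm s) (Real.exp_pos _).le
    refine h2.trans ?_
    rw [intervalIntegral.integral_const_mul, div_mul_eq_mul_div, mul_div_assoc]
    exact mul_le_mul_of_nonneg_left (integral_exp_mul_le hl0 0 t) (norm_nonneg _)
  let Y : (ℝ →ᵇ E) → ℝ → ℝ := fun h t => c (X h t)
  let V : (ℝ →ᵇ E) → ℝ → ℝ := fun h => higsOutput (higsOutput (Y h) w₁) w₂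
  have hYc : ∀ h, Continuous (Y h) := fun h => c.continuous.comp (hXc h)
  have hY0 : ∀ h, |w₁| ≤ |Y h 0| := fun h => by simpa only [Y, hX0] using hw₁
  have hUc : ∀ h, Continuous (higsOutput (Y h) w₁) := fun h =>
    continuous_higsOutput (hYc h) (hY0 h)
  have hU0 : ∀ h, |w₂| ≤ |higsOutput (Y h) w₁ 0| := fun h => by
    rw [higsOutput_zero (hY0 h) (by simpa only [Y, hX0] using hs₁)]
    exact hw₂
  have hVc : ∀ h, Continuous (V h) := fun h => continuous_higsOutput (hUc h) (hU0 h)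
  have hVsub : ∀ (h h' : ℝ →ᵇ E) t, 0 ≤ t →
      |V h t - V h' t| ≤ 4 * (‖c‖ * (‖h - h'‖ / l)) * Real.exp (l * t) := by
    intro h h' t ht
    have hM : 0 ≤ ‖c‖ * (‖h - h'‖ / l) := by positivity
    have h1 : ∀ r, 0 ≤ r → |Y h r - Y h' r| ≤ ‖c‖ * (‖h - h'‖ / l) * Real.exp (l * r) := by
      intro r hr
      simp only [Y]
      rw [← map_sub, ← Real.norm_eq_abs, mul_assoc]
      exact (c.le_opNorm _).trans (mul_le_mul_of_nonneg_left (hXsub h h' r hr) (norm_nonneg _))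
    have h2 : ∀ r, 0 ≤ r → |higsOutput (Y h) w₁ r - higsOutput (Y h') w₁ r| ≤
        2 * (‖c‖ * (‖h - h'‖ / l)) * Real.exp (l * r) := fun r hr =>
      abs_higsOutput_sub_higsOutput_le (hYc h) (hYc h') (hY0 h) (hY0 h') hl1 hM h1 hr
    have h3 := abs_higsOutput_sub_higsOutput_le (hUc h) (hUc h') (hU0 h) (hU0 h') hl1
      (by positivity) h2 ht
    refine h3.trans (le_of_eq ?_)
    ring
  have hVle : ∀ h t, 0 ≤ t → |V h t| ≤ ‖c‖ * ‖X h t‖ := fun h t ht =>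
    (abs_higsOutput_le (hUc h) (hU0 h) ht).trans
      ((abs_higsOutput_le (hYc h) (hY0 h) ht).trans (c.le_opNorm _))
  -- The weighted right-hand side, frozen at its value at 0 for negative times so that it is bounded
  -- on the whole line.
  let G : (ℝ →ᵇ E) → ℝ → E := fun h t =>
    Real.exp (-(l * max t 0)) • (A (X h (max t 0)) + (κ * V h (max t 0)) • b)
  have hm : Continuous fun t : ℝ => max t 0 := continuous_id.max continuous_const
  have hGc : ∀ h, Continuous (G h) := fun h => by
    refine Continuous.smul (by fun_prop) (Continuous.add ?_ ?_)
    · exact A.continuous.comp ((hXc h).comp hm)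
    · exact (continuous_const.mul ((hVc h).comp hm)).smul continuous_const
  have hGle : ∀ h t, ‖G h t‖ ≤ K * (‖x₀‖ + ‖h‖ / l) := by
    intro h t
    set s := max t 0 with hs
    have hs0 : 0 ≤ s := le_max_right _ _
    have h1 : ‖X h s‖ ≤ (‖x₀‖ + ‖h‖ / l) * Real.exp (l * s) := by
      have h2 := hXsub h 0 s hs0
      have h3 : X 0 s = x₀ := by simp [X]
      rw [h3, sub_zero] at h2
      have h4 : ‖X h s‖ ≤ ‖x₀‖ + ‖X h s - x₀‖ := by
        have := norm_add_le x₀ (X h s - x₀)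
        simpa using this
      have h5 : 1 ≤ Real.exp (l * s) := Real.one_le_exp (by positivity)
      nlinarith [norm_nonneg x₀]
    have h6 : ‖A (X h s) + (κ * V h s) • b‖ ≤ K * ‖X h s‖ := by
      refine (norm_add_le _ _).trans ?_
      rw [norm_smul, norm_mul, Real.norm_of_nonneg hκ, Real.norm_eq_abs]
      have h7 := A.le_opNorm (X h s)
      have h8 : κ * |V h s| * ‖b‖ ≤ κ * (‖c‖ * ‖X h s‖) * ‖b‖ := by
        gcongr
        exact hVle h s hs0
      have h9 : 0 ≤ κ * (‖c‖ * ‖X h s‖) * ‖b‖ := by positivity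
      rw [hK]
      nlinarith
    simp only [G]
    rw [← hs, norm_smul, Real.norm_of_nonneg (Real.exp_pos _).le]
    calc Real.exp (-(l * s)) * ‖A (X h s) + (κ * V h s) • b‖
        ≤ Real.exp (-(l * s)) * (K * ((‖x₀‖ + ‖h‖ / l) * Real.exp (l * s))) := by
          refine mul_le_mul_of_nonneg_left (h6.trans ?_) (Real.exp_pos _).le
          exact mul_le_mul_of_nonneg_left h1 hK0
      _ = (Real.exp (-(l * s)) * Real.exp (l * s)) * (K * (‖x₀‖ + ‖h‖ / l)) := by ring
      _ = _ := by rw [← Real.exp_add]; simp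
  let Φ : (ℝ →ᵇ E) → (ℝ →ᵇ E) := fun h => ofNormedAddCommGroup (G h) (hGc h) _ (hGle h)
  have hΦ : ∀ h t, Φ h t = G h t := fun _ _ => rfl
  have hlip : LipschitzWith (1 / 2) Φ := by
    refine LipschitzWith.of_dist_le_mul fun h h' => ?_
    rw [BoundedContinuousFunction.dist_le (by positivity)]
    intro t
    set s := max t 0 with hs
    have hs0 : 0 ≤ s := le_max_right _ _
    rw [hΦ, hΦ, dist_eq_norm, dist_eq_norm]
    have h1 : G h t - G h' t =
        Real.exp (-(l * s)) • (A (X h s - X h' s) + (κ * (V h s - V h' s)) • b) := by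
      simp only [G]
      rw [← hs, ← smul_sub, map_sub, mul_sub, sub_smul]
      congr 1
      abel
    have h2 : ‖A (X h s - X h' s) + (κ * (V h s - V h' s)) • b‖ ≤
        K * (‖h - h'‖ / l * Real.exp (l * s)) := by
      refine (norm_add_le _ _).trans ?_
      rw [norm_smul, norm_mul, Real.norm_of_nonneg hκ, Real.norm_eq_abs]
      have h3 : ‖A (X h s - X h' s)‖ ≤ ‖A‖ * (‖h - h'‖ / l * Real.exp (l * s)) :=
        (A.le_opNorm _).trans (mul_le_mul_of_nonneg_left (hXsub h h' s hs0) (norm_nonneg _))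
      have h4 : κ * |V h s - V h' s| * ‖b‖ ≤
          κ * (4 * (‖c‖ * (‖h - h'‖ / l)) * Real.exp (l * s)) * ‖b‖ := by
        gcongr
        exact hVsub h h' s hs0
      refine (add_le_add h3 h4).trans (le_of_eq ?_)
      rw [hK]
      ring
    rw [h1, norm_smul, Real.norm_of_nonneg (Real.exp_pos _).le]
    calc Real.exp (-(l * s)) * ‖A (X h s - X h' s) + (κ * (V h s - V h' s)) • b‖
        ≤ Real.exp (-(l * s)) * (K * (‖h - h'‖ / l * Real.exp (l * s))) :=
          mul_le_mul_of_nonneg_left h2 (Real.exp_pos _).le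
      _ = (Real.exp (-(l * s)) * Real.exp (l * s)) * (K / l * ‖h - h'‖) := by ring
      _ = K / l * ‖h - h'‖ := by rw [← Real.exp_add]; simp
      _ ≤ _ := by
        refine mul_le_mul_of_nonneg_right ?_ (norm_nonneg _)
        rw [div_le_iff₀ hl0]
        simp only [NNReal.coe_div, NNReal.coe_one, NNReal.coe_ofNat]
        linarith
  have hcontr : ContractingWith (1 / 2) Φ :=
    ⟨by rw [← NNReal.coe_lt_coe]; norm_num, hlip⟩
  set h := hcontr.fixedPoint with hh
  have hfix : Φ h = h := hcontr.fixedPoint_isFixedPt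
  refine ⟨X h, hX0 h, hXc h, ?_, ?_⟩
  · intro T hT
    obtain ⟨B, hB⟩ := (isCompact_Icc (a := (0 : ℝ)) (b := T)).exists_bound_of_continuousOn
      (hgc h).continuousOn
    refine ⟨‖c‖ * B, fun s t hs hst ht => ?_⟩
    rw [← map_sub, ← Real.norm_eq_abs, mul_assoc]
    refine (c.le_opNorm _).trans (mul_le_mul_of_nonneg_left ?_ (norm_nonneg _))
    have h1 : X h t - X h s = ∫ r in s..t, Real.exp (l * r) • h r := by
      simp only [X, add_sub_add_left_eq_sub]
      exact intervalIntegral.integral_interval_sub_left ((hgc h).intervalIntegrable _ _)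
        ((hgc h).intervalIntegrable _ _)
    rw [h1]
    have := intervalIntegral.norm_integral_le_of_norm_le_const (a := s) (b := t)
      (f := fun r => Real.exp (l * r) • h r) (C := B) fun r hr => by
        rw [Set.uIoc_of_le hst] at hr
        exact hB r ⟨hs.trans hr.1.le, hr.2.trans ht⟩
    rwa [abs_of_nonneg (sub_nonneg.2 hst)] at this
  · intro t ht
    have h1 : Real.exp (l * t) • h t =
        A (X h t) + (κ * V h t) • b := by
      have h2 : h t = G h t := by
        rw [← hΦ, hfix]
      rw [h2]
      simp only [G]
      rw [max_eq_left ht, smul_smul, ← Real.exp_add, add_neg_cancel, Real.exp_zero, one_smul]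
    rw [← h1]
    exact hXd h t

end Picard

/-! ## Complexification and the resolvent -/

section Complexification

variable {n : ℕ}

/-- A real vector as a complex vector. -/
def complexVec : (Fin n → ℝ) →ₗ[ℝ] (Fin n → ℂ) where
  toFun x i := (x i : ℂ)
  map_add' x y := by ext; simp
  map_smul' r x := by ext; simp

/-- A real matrix as a complex matrix. -/
def complexMat (A : Matrix (Fin n) (Fin n) ℝ) : Matrix (Fin n) (Fin n) ℂ :=
  A.map Complex.ofReal

theorem complexMat_pow (A : Matrix (Fin n) (Fin n) ℝ) (k : ℕ) :
    complexMat (A ^ k) = complexMat A ^ k :=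
  Matrix.map_pow (f := Complex.ofRealHom) A k

theorem complexMat_mulVec (A : Matrix (Fin n) (Fin n) ℝ) (x : Fin n → ℝ) :
    complexMat A *ᵥ complexVec x = complexVec (A *ᵥ x) := by
  ext i
  simp [complexMat, complexVec, mulVec, dotProduct]

theorem complexVec_dotProduct (c x : Fin n → ℝ) :
    complexVec c ⬝ᵥ complexVec x = ((c ⬝ᵥ x : ℝ) : ℂ) := by
  simp [complexVec, dotProduct]

theorem eq_zero_of_observable {A : Matrix (Fin n) (Fin n) ℝ} {c : Fin n → ℝ}
    (hobs : IsObservable A c) {v : Fin n → ℂ}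
    (h : ∀ i : ℕ, complexVec c ⬝ᵥ (complexMat A ^ i *ᵥ v) = 0) : v = 0 := by
  have hre : (fun i => (v i).re) = 0 := hobs _ fun i => by
    have := congrArg Complex.re (h i)
    rw [← complexMat_pow] at this
    simpa [complexVec, complexMat, dotProduct, mulVec] using this
  have him : (fun i => (v i).im) = 0 := hobs _ fun i => by
    have := congrArg Complex.im (h i)
    rw [← complexMat_pow] at this
    simpa [complexVec, complexMat, dotProduct, mulVec] using this
  ext i
  exact Complex.ext (congrFun hre i) (congrFun him i)

theorem eq_zero_of_controllable {A : Matrix (Fin n) (Fin n) ℝ} {b : Fin n → ℝ}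
    (hcon : IsControllable A b) {M : Matrix (Fin n) (Fin n) ℂ}
    (h : ∀ i : ℕ, M *ᵥ (complexMat A ^ i *ᵥ complexVec b) = 0) : M = 0 := by
  let f : (Fin n → ℝ) →ₗ[ℝ] (Fin n → ℂ) := (M.mulVecLin.restrictScalars ℝ) ∘ₗ complexVec
  have hf : f = 0 := by
    refine LinearMap.ext_on hcon ?_
    rintro _ ⟨i, rfl⟩
    have := h i
    rw [← complexMat_pow, complexMat_mulVec] at this
    simpa [f] using this
  ext i j
  have h1 : f (Pi.single j 1) i = 0 := by rw [hf]; rfl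
  have h2 : complexVec (Pi.single j (1 : ℝ)) = Pi.single j (1 : ℂ) := by
    ext k
    by_cases hk : k = j
    · subst hk
      simp [complexVec]
    · simp [complexVec, hk]
  simpa [f, h2] using h1

/-! ### The transfer function as a rational function, and its residues. -/

variable (A : Matrix (Fin n) (Fin n) ℝ) (b c : Fin n → ℝ)

theorem transferFunction_eq (s : ℂ) : transferFunction A b c s =
    complexVec c ⬝ᵥ ((s • (1 : Matrix (Fin n) (Fin n) ℂ) - complexMat A)⁻¹ *ᵥ complexVec b) :=
  rfl

open Polynomial in
theorem transferFunction_eq_div (s : ℂ) : transferFunction A b c s =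
    (∑ i, C (c i : ℂ) * ∑ j, adjugate (charmatrix (complexMat A)) i j * C (b j : ℂ)).eval s /
      (complexMat A).charpoly.eval s := by
  have h1 : (charmatrix (complexMat A)).map (eval s) = s • 1 - complexMat A := by
    ext i j
    by_cases hij : i = j
    · subst hij
      simp [charmatrix_apply_eq]
    · simp [charmatrix_apply_ne _ _ _ hij, Matrix.one_apply_ne hij]
  have h2 : ∀ i j, (adjugate (charmatrix (complexMat A)) i j).eval s =
      adjugate (s • 1 - complexMat A) i j := by
    intro i j
    have := RingHom.map_adjugate (evalRingHom s) (charmatrix (complexMat A))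
    rw [RingHom.mapMatrix_apply, RingHom.mapMatrix_apply, coe_evalRingHom, h1] at this
    rw [← this]
    rfl
  have h3 : (complexMat A).charpoly.eval s = (s • 1 - complexMat A).det := by
    rw [eval_charpoly, scalar_apply, smul_one_eq_diagonal]
  rw [transferFunction_eq, h3, Matrix.inv_def, Ring.inverse_eq_inv']
  simp only [eval_finsetSum, eval_mul, eval_C, h2, smul_mulVec, dotProduct_smul, smul_eq_mul]
  rw [div_eq_inv_mul]
  rfl

theorem meromorphicAt_transferFunction (s : ℂ) : MeromorphicAt (transferFunction A b c) s := by
  have h : ∀ p : Polynomial ℂ, MeromorphicAt (fun z => p.eval z) s := fun p =>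
    (p.differentiable.analyticAt s).meromorphicAt
  have := (h (∑ i, Polynomial.C (c i : ℂ) *
    ∑ j, adjugate (charmatrix (complexMat A)) i j * Polynomial.C (b j : ℂ))).div
      (h (complexMat A).charpoly)
  refine this.congr (Eventually.of_forall fun z => ?_)
  exact (transferFunction_eq_div A b c z).symm

theorem tendsto_sub_mul_of_not_isPole {l : ℂ} (h : ¬ IsPole (transferFunction A b c) l) :
    Tendsto (fun s => (s - l) * transferFunction A b c s) (𝓝[≠] l) (𝓝 0) := by
  obtain ⟨g, hg⟩ := tendsto_nhds_of_meromorphicOrderAt_nonneg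
    (meromorphicAt_transferFunction A b c l) (not_lt.1 h)
  have h1 : Tendsto (fun s : ℂ => s - l) (𝓝[≠] l) (𝓝 0) := by
    have : Continuous fun s : ℂ => s - l := by fun_prop
    simpa using (this.tendsto l).mono_left nhdsWithin_le_nhds
  simpa using h1.mul hg

/-- Carries the residue condition from the positive to the negative imaginary axis. -/
theorem transferFunction_conj (s : ℂ) :
    transferFunction A b c (starRingEnd ℂ s) = starRingEnd ℂ (transferFunction A b c s) := by
  have hv : ∀ x : Fin n → ℝ, star (complexVec x) = complexVec x := fun x => by
    ext i
    simp [complexVec]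
  have hM : (starRingEnd ℂ s • (1 : Matrix (Fin n) (Fin n) ℂ) - complexMat A)ᵀ =
      (s • (1 : Matrix (Fin n) (Fin n) ℂ) - complexMat A)ᴴ := by
    ext i j
    simp [complexMat, Matrix.one_apply]
    split_ifs <;> simp_all
  rw [transferFunction_eq, transferFunction_eq, starRingEnd_apply (_ ⬝ᵥ _),
    ← star_dotProduct_star, star_mulVec, hv, hv, conjTranspose_nonsing_inv, ← hM, ← transpose_nonsing_inv,
    vecMul_transpose, dotProduct_comm]

theorem eventually_isUnit_det (l : ℂ) : ∀ᶠ s in 𝓝[≠] l,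
    IsUnit (s • (1 : Matrix (Fin n) (Fin n) ℂ) - complexMat A).det := by
  have hne : (complexMat A).charpoly ≠ 0 := (charpoly_monic _).ne_zero
  have h := (((complexMat A).charpoly.roots.toFinset : Set ℂ) \ {l}).toFinite.isClosed.isOpen_compl
  have hmem : (((complexMat A).charpoly.roots.toFinset : Set ℂ) \ {l})ᶜ ∈ 𝓝 l :=
    h.mem_nhds (by simp)
  filter_upwards [nhdsWithin_le_nhds hmem, self_mem_nhdsWithin] with s hs hsl
  rw [isUnit_iff_ne_zero]
  intro h0
  refine hs ⟨?_, hsl⟩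
  have h3 : (complexMat A).charpoly.eval s = (s • 1 - complexMat A).det := by
    rw [eval_charpoly, scalar_apply, smul_one_eq_diagonal]
  simp only [Finset.mem_coe, Multiset.mem_toFinset]
  rw [Polynomial.mem_roots hne, Polynomial.IsRoot.def, h3, h0]

open Polynomial in
/-- Up to a polynomial, the transfer function with output row `c q(A)` is `q G`. -/
theorem exists_polynomial_transferFunction (q : ℂ[X]) : ∃ p : ℂ[X], ∀ s : ℂ,
    IsUnit (s • (1 : Matrix (Fin n) (Fin n) ℂ) - complexMat A).det →
    complexVec c ⬝ᵥ (aeval (complexMat A) q *ᵥ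
      ((s • (1 : Matrix (Fin n) (Fin n) ℂ) - complexMat A)⁻¹ *ᵥ complexVec b)) =
      q.eval s * transferFunction A b c s + p.eval s := by
  induction q using Polynomial.induction_on with
  | C a =>
    refine ⟨0, fun s _ => ?_⟩
    simp [transferFunction_eq, Algebra.algebraMap_eq_smul_one, smul_mulVec]
  | add p q hp hq =>
    obtain ⟨p', hp⟩ := hp
    obtain ⟨q', hq⟩ := hq
    refine ⟨p' + q', fun s hs => ?_⟩
    rw [map_add, add_mulVec, dotProduct_add, hp s hs, hq s hs, eval_add, eval_add]
    ring
  | monomial k a ih =>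
    obtain ⟨p, hp⟩ := ih
    set M := aeval (complexMat A) (C a * X ^ k) with hM
    -- One more factor A is traded for s through A (s - A)⁻¹ = s (s - A)⁻¹ - 1; the -1 produces the
    -- constant in the new polynomial part.
    refine ⟨X * p - C (complexVec c ⬝ᵥ (M *ᵥ complexVec b)), fun s hs => ?_⟩
    have h1 : complexMat A * (s • (1 : Matrix (Fin n) (Fin n) ℂ) - complexMat A)⁻¹ =
        s • (s • (1 : Matrix (Fin n) (Fin n) ℂ) - complexMat A)⁻¹ - 1 := by
      have h2 := mul_nonsing_inv _ hs
      rw [sub_mul, smul_mul_assoc, one_mul] at h2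
      exact eq_sub_of_add_eq (by rw [add_comm]; exact (sub_eq_iff_eq_add.1 h2).symm)
    have h3 : aeval (complexMat A) (C a * X ^ (k + 1)) = M * complexMat A := by
      rw [pow_succ, ← mul_assoc, map_mul, aeval_X]
    rw [h3, ← mulVec_mulVec, mulVec_mulVec _ (complexMat A), h1, sub_mulVec, one_mulVec, mulVec_sub,
      dotProduct_sub, smul_mulVec, mulVec_smul, dotProduct_smul, hp s hs]
    simp only [eval_mul, eval_C, eval_pow, eval_X, eval_sub, smul_eq_mul]
    ring

open Polynomial in
/-- If `(A - l) q(A) = 0`, the residue of `q G` at `l` is `c q(A) b`. -/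
theorem tendsto_residue {l : ℂ} {q : ℂ[X]} (hq : aeval (complexMat A) ((X - C l) * q) = 0) :
    Tendsto (fun s => (s - l) * (q.eval s * transferFunction A b c s)) (𝓝[≠] l)
      (𝓝 (complexVec c ⬝ᵥ (aeval (complexMat A) q *ᵥ complexVec b))) := by
  obtain ⟨p, hp⟩ := exists_polynomial_transferFunction A b c q
  set M := aeval (complexMat A) q with hM
  have hMA : M * complexMat A = l • M := by
    rw [mul_comm, map_mul, map_sub, aeval_X, aeval_C, mul_sub, ← hM, sub_eq_zero,
      Algebra.algebraMap_eq_smul_one, mul_smul_comm, mul_one] at hq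
    exact hq
  have h1 : Tendsto (fun s : ℂ => complexVec c ⬝ᵥ (M *ᵥ complexVec b) - (s - l) * p.eval s)
      (𝓝[≠] l) (𝓝 (complexVec c ⬝ᵥ (M *ᵥ complexVec b))) := by
    have : Continuous fun s : ℂ => complexVec c ⬝ᵥ (M *ᵥ complexVec b) - (s - l) * p.eval s := by
      have := p.continuous
      fun_prop
    simpa using (this.tendsto l).mono_left nhdsWithin_le_nhds
  refine h1.congr' ?_
  filter_upwards [eventually_isUnit_det A l] with s hs
  -- Since M A = l M, multiplying M by the resolvent is division by s - l.
  have h2 : M = (s - l) • (M * (s • (1 : Matrix (Fin n) (Fin n) ℂ) - complexMat A)⁻¹) := by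
    have h3 : M * (s • (1 : Matrix (Fin n) (Fin n) ℂ) - complexMat A) = (s - l) • M := by
      rw [mul_sub, hMA, mul_smul_comm, mul_one, sub_smul]
    rw [← smul_mul_assoc, ← h3, mul_assoc, mul_nonsing_inv _ hs, mul_one]
  have h4 : complexVec c ⬝ᵥ (M *ᵥ complexVec b) =
      (s - l) * (q.eval s * transferFunction A b c s + p.eval s) := by
    rw [← hp s hs]
    conv_lhs => rw [h2]
    rw [smul_mulVec, dotProduct_smul, smul_eq_mul, mulVec_mulVec]
  rw [h4]
  ring

open Polynomial in
-- A q(A) = q(A) A = l q(A), so c Aⁱ q(A) Aʲ b is a multiple of c q(A) b and vanishes for all i and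
-- j. Controllability and observability then annihilate q(A).
theorem aeval_eq_zero_of_minimal {A : Matrix (Fin n) (Fin n) ℝ} {b c : Fin n → ℝ}
    (hmin : IsMinimalRealization A b c) {l : ℂ} {q : ℂ[X]}
    (hq : aeval (complexMat A) ((X - C l) * q) = 0)
    (h : complexVec c ⬝ᵥ (aeval (complexMat A) q *ᵥ complexVec b) = 0) :
    aeval (complexMat A) q = 0 := by
  set M := aeval (complexMat A) q with hM
  have hAM : complexMat A * M = l • M := by
    rw [map_mul, map_sub, aeval_X, aeval_C, sub_mul, ← hM, sub_eq_zero,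
      Algebra.algebraMap_eq_smul_one, smul_mul_assoc, one_mul] at hq
    exact hq
  have hMA : M * complexMat A = l • M := by
    rw [← hAM, hM]
    exact ((Polynomial.aeval_X (R := ℂ) (complexMat A)) ▸
      (Commute.all q X).map (aeval (complexMat A)) :)
  have hl : ∀ i : ℕ, complexMat A ^ i * M = l ^ i • M := by
    intro i
    induction i with
    | zero => simp
    | succ i ih => rw [pow_succ', mul_assoc, ih, mul_smul_comm, hAM, smul_smul, pow_succ]
  have hr : ∀ i : ℕ, M * complexMat A ^ i = l ^ i • M := by
    intro i
    induction i with
    | zero => simp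
    | succ i ih => rw [pow_succ, ← mul_assoc, ih, smul_mul_assoc, hMA, smul_smul, pow_succ]
  refine eq_zero_of_controllable hmin.1 fun j => eq_zero_of_observable hmin.2 fun i => ?_
  rw [mulVec_mulVec, hl, smul_mulVec, mulVec_mulVec, hr, smul_mulVec,
    dotProduct_smul, dotProduct_smul, h, smul_zero, smul_zero]

open Polynomial in
/-- A root of the minimal polynomial at which `(s - l) G(s)` converges is simple, and the limit is
nonzero. -/
theorem minpoly_root_simple {A : Matrix (Fin n) (Fin n) ℝ} {b c : Fin n → ℝ}
    (hmin : IsMinimalRealization A b c) {l k : ℂ} {q : ℂ[X]}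
    (hq : minpoly ℂ (complexMat A) = (X - C l) * q)
    (hk : Tendsto (fun s => (s - l) * transferFunction A b c s) (𝓝[≠] l) (𝓝 k)) :
    complexVec c ⬝ᵥ (aeval (complexMat A) q *ᵥ complexVec b) = q.eval l * k ∧
      q.eval l ≠ 0 ∧ k ≠ 0 := by
  have hq0 : aeval (complexMat A) ((X - C l) * q) = 0 := by
    rw [← hq]
    exact minpoly.aeval _ _
  have h1 := tendsto_residue A b c hq0
  have h2 : Tendsto (fun s => (s - l) * (q.eval s * transferFunction A b c s)) (𝓝[≠] l)
      (𝓝 (q.eval l * k)) := by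
    have h3 := ((q.continuous.tendsto l).mono_left nhdsWithin_le_nhds).mul hk
    refine h3.congr fun s => ?_
    ring
  have h4 := tendsto_nhds_unique h1 h2
  -- The degree of q is below that of the minimal polynomial.
  have hne : aeval (complexMat A) q ≠ 0 := by
    intro h0
    have hint : IsIntegral ℂ (complexMat A) := Matrix.isIntegral _
    have hm0 := minpoly.ne_zero hint
    have hqne : q ≠ 0 := by
      rintro rfl
      rw [mul_zero] at hq
      exact hm0 hq
    have hd := degree_le_of_dvd (minpoly.dvd ℂ _ h0) hqne
    rw [hq, degree_mul, degree_X_sub_C, degree_eq_natDegree hqne] at hd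
    norm_cast at hd
    omega
  have h5 : q.eval l * k ≠ 0 := fun h0 =>
    hne (aeval_eq_zero_of_minimal hmin hq0 (h4.trans h0))
  exact ⟨h4, left_ne_zero_of_mul h5, right_ne_zero_of_mul h5⟩

open Polynomial in
/-- Every root of the minimal polynomial lies in the open left half-plane, or is a simple nonzero
root on the imaginary axis whose residue is positive. -/
theorem minpoly_root_cases {A : Matrix (Fin n) (Fin n) ℝ} {b c : Fin n → ℝ}
    (hmin : IsMinimalRealization A b c) (hNI : IsNegativeImaginary (transferFunction A b c))
    {l : ℂ} (hl : (minpoly ℂ (complexMat A)).IsRoot l) :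
    l.re < 0 ∨ (l.re = 0 ∧ l ≠ 0 ∧ ∃ K : ℝ, 0 < K ∧ ∃ q : ℂ[X],
      minpoly ℂ (complexMat A) = (X - C l) * q ∧ q.eval l ≠ 0 ∧
      l * (complexVec c ⬝ᵥ (aeval (complexMat A) q *ᵥ complexVec b)) = q.eval l * K) := by
  obtain ⟨q, hq⟩ := dvd_iff_isRoot.2 hl
  -- Without a pole (s - l) G(s) tends to 0, while minimality makes this limit nonzero.
  have hpole : ¬ ¬ IsPole (transferFunction A b c) l := fun hnp =>
    (minpoly_root_simple hmin hq (tendsto_sub_mul_of_not_isPole A b c hnp)).2.2 rfl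
  rw [not_not] at hpole
  have hl0 : l ≠ 0 := by
    rintro rfl
    exact hNI.not_isPole_zero hpole
  rcases lt_trichotomy l.re 0 with hre | hre | hre
  · exact Or.inl hre
  swap
  · exact absurd hpole (hNI.not_isPole_of_re_pos l hre)
  right
  have hupper : ∀ ω : ℝ, 0 < ω → ∃ K : ℝ, 0 ≤ K ∧
      Tendsto (fun s : ℂ => (s - Complex.I * ω) * (s * transferFunction A b c s))
        (𝓝[≠] (Complex.I * ω)) (𝓝 (K : ℂ)) := by
    intro ω hω
    by_cases hp : IsPole (transferFunction A b c) (Complex.I * ω)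
    · exact hNI.residue ω hω hp
    · refine ⟨0, le_rfl, ?_⟩
      have h1 := tendsto_sub_mul_of_not_isPole A b c hp
      have h2 : Tendsto (fun s : ℂ => s) (𝓝[≠] (Complex.I * ω)) (𝓝 (Complex.I * ω)) :=
        tendsto_id.mono_left nhdsWithin_le_nhds
      have h3 := h2.mul h1
      rw [mul_zero] at h3
      refine h3.congr fun s => ?_
      ring
  have hlI : l = Complex.I * (l.im : ℂ) := by
    apply Complex.ext <;> simp [hre]
  have him : l.im ≠ 0 := fun h0 => hl0 (Complex.ext hre h0)
  have hK : ∃ K : ℝ, 0 ≤ K ∧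
      Tendsto (fun s : ℂ => (s - l) * (s * transferFunction A b c s)) (𝓝[≠] l) (𝓝 (K : ℂ)) := by
    rcases lt_or_gt_of_ne him with hneg | hpos
    · obtain ⟨K, hK0, hK⟩ := hupper (-l.im) (by linarith)
      refine ⟨K, hK0, ?_⟩
      have hconj : starRingEnd ℂ l = Complex.I * ((-l.im : ℝ) : ℂ) := by
        apply Complex.ext <;> simp [hre]
      rw [← hconj] at hK
      have hmap : Tendsto (starRingEnd ℂ) (𝓝[≠] l) (𝓝[≠] (starRingEnd ℂ l)) := by
        refine tendsto_nhdsWithin_iff.2 ⟨?_, ?_⟩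
        · exact (Complex.continuous_conj.tendsto l).mono_left nhdsWithin_le_nhds
        · filter_upwards [self_mem_nhdsWithin] with s hs h
          exact hs ((starRingEnd ℂ).injective h)
      have h2 := (Complex.continuous_conj.tendsto (K : ℂ)).comp (hK.comp hmap)
      rw [Complex.conj_ofReal] at h2
      refine h2.congr fun s => ?_
      simp only [Function.comp_apply, transferFunction_conj, map_mul, map_sub, Complex.conj_conj]
    · obtain ⟨K, hK0, hK⟩ := hupper l.im hpos
      rw [← hlI] at hK
      exact ⟨K, hK0, hK⟩
  obtain ⟨K, hK0, hK⟩ := hK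
  have hk : Tendsto (fun s => (s - l) * transferFunction A b c s) (𝓝[≠] l) (𝓝 (l⁻¹ * K)) := by
    have hi : Tendsto (fun s : ℂ => s⁻¹) (𝓝[≠] l) (𝓝 l⁻¹) :=
      ((continuousAt_inv₀ hl0).tendsto).mono_left nhdsWithin_le_nhds
    refine (hi.mul hK).congr' ?_
    have hev : ∀ᶠ s in 𝓝[≠] l, s ≠ 0 := nhdsWithin_le_nhds (isOpen_ne.mem_nhds hl0)
    filter_upwards [hev] with s hs
    field_simp
  obtain ⟨h1, h2, h3⟩ := minpoly_root_simple hmin hq hk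
  refine ⟨hre, hl0, K, lt_of_le_of_ne hK0 ?_, q, hq, h2, ?_⟩
  · rintro rfl
    simp at h3
  · rw [h1]
    field_simp

end Complexification

/-! ## A storage function for the plant -/

/-- The real part of the Hermitian form `conj (f x) * f z`. -/
def reForm {E : Type*} [AddCommGroup E] [Module ℝ E] (f : E →ₗ[ℝ] ℂ) : LinearMap.BilinForm ℝ E :=
  LinearMap.mk₂ ℝ (fun x z => (f x).re * (f z).re + (f x).im * (f z).im)
    (fun x y z => by simp only [map_add, Complex.add_re, Complex.add_im]; ring)
    (fun r x z => by
      simp only [map_smul, Complex.real_smul, Complex.re_ofReal_mul, Complex.im_ofReal_mul,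
        smul_eq_mul]
      ring)
    (fun x y z => by simp only [map_add, Complex.add_re, Complex.add_im]; ring)
    (fun r x z => by
      simp only [map_smul, Complex.real_smul, Complex.re_ofReal_mul, Complex.im_ofReal_mul,
        smul_eq_mul]
      ring)

theorem reForm_apply {E : Type*} [AddCommGroup E] [Module ℝ E] (f : E →ₗ[ℝ] ℂ) (x z : E) :
    reForm f x z = (f x).re * (f z).re + (f x).im * (f z).im := rfl

theorem reForm_self {E : Type*} [AddCommGroup E] [Module ℝ E] (f : E →ₗ[ℝ] ℂ) (x : E) :
    reForm f x x = Complex.normSq (f x) := rfl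

section Storage

variable {n : ℕ}

/-- The functional `x ↦ (S x)ᵢ` on real vectors. -/
def rowFunctional (S : Matrix (Fin n) (Fin n) ℂ) (i : Fin n) : (Fin n → ℝ) →ₗ[ℝ] ℂ :=
  LinearMap.proj i ∘ₗ S.mulVecLin.restrictScalars ℝ ∘ₗ complexVec

theorem rowFunctional_apply (S : Matrix (Fin n) (Fin n) ℂ) (i : Fin n) (x : Fin n → ℝ) :
    rowFunctional S i x = (S *ᵥ complexVec x) i := rfl

open Polynomial in
/-- If `∏ (A - λ) S = 0` over numbers `λ` in the open left half-plane, then `S x` decays along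
`x' = A x`, as witnessed by a positive semidefinite form. -/
theorem exists_lyapunovForm (A : Matrix (Fin n) (Fin n) ℝ) (L : List ℂ) (hL : ∀ l ∈ L, l.re < 0) :
    ∀ S : Matrix (Fin n) (Fin n) ℂ, Commute S (complexMat A) →
      aeval (complexMat A) (L.map fun l => X - C l).prod * S = 0 →
      ∃ B : LinearMap.BilinForm ℝ (Fin n → ℝ), (∀ x z, B x z = B z x) ∧ (∀ x, 0 ≤ B x x) ∧
        (∀ x, 2 * B x (A *ᵥ x) ≤ -∑ i, Complex.normSq ((S *ᵥ complexVec x) i)) ∧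
        (∀ x, S *ᵥ complexVec x = 0 → ∀ z, B x z = 0) ∧
        (∀ x, B x x = 0 → S *ᵥ complexVec x = 0) := by
  induction L with
  | nil =>
    intro S _ hS
    have hS0 : S = 0 := by simpa using hS
    refine ⟨0, by simp, by simp, by simp [hS0], by simp, by simp [hS0]⟩
  | cons l L ih =>
    intro S hcomm hS
    set a : ℝ := -l.re with ha
    have ha0 : 0 < a := by
      have := hL l (by simp)
      linarith
    -- One root is peeled off: along x' = A x the vector S x obeys (S x)' = l S x + S' x, a stable
    -- equation driven by S' x, which the induction hypothesis controls.
    set S' : Matrix (Fin n) (Fin n) ℂ := (complexMat A - algebraMap ℂ _ l) * S with hS'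
    have hcomm' : Commute S' (complexMat A) := by
      refine Commute.mul_left ?_ hcomm
      exact (Commute.refl _).sub_left (Algebra.commutes l _)
    obtain ⟨B', hsym, hnn, hdec, hker, -⟩ := ih (fun k hk => hL k (by simp [hk])) S' hcomm' (by
      rw [hS', ← mul_assoc]
      rw [List.map_cons, List.prod_cons, mul_comm, map_mul, map_sub, aeval_X, aeval_C] at hS
      exact hS)
    have hSA : ∀ x, S *ᵥ complexVec (A *ᵥ x) = l • (S *ᵥ complexVec x) + S' *ᵥ complexVec x := by
      intro x
      rw [← complexMat_mulVec, mulVec_mulVec, hcomm.eq, hS', sub_mul, sub_mulVec,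
        Algebra.algebraMap_eq_smul_one, smul_mul_assoc, one_mul, smul_mulVec]
      abel
    -- By Young's inequality |S x|² has derivative at most -a |S x|² + a⁻¹ |S' x|². The summand a⁻¹
    -- B' cancels the last term, and the outer a⁻¹ normalizes the decay.
    let B : LinearMap.BilinForm ℝ (Fin n → ℝ) :=
      a⁻¹ • (∑ i, reForm (rowFunctional S i) + a⁻¹ • B')
    have hB : ∀ x z, B x z = a⁻¹ * (∑ i, reForm (rowFunctional S i) x z + a⁻¹ * B' x z) := by
      intro x z
      simp [B, LinearMap.sum_apply, mul_add]
    have hsum : ∀ x, 0 ≤ ∑ i, reForm (rowFunctional S i) x x := fun x =>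
      Finset.sum_nonneg fun i _ => by
        rw [reForm_self]
        exact Complex.normSq_nonneg _
    refine ⟨B, ?_, ?_, ?_, ?_, ?_⟩
    · intro x z
      rw [hB, hB, hsym x z]
      congr 2
      refine Finset.sum_congr rfl fun i _ => ?_
      rw [reForm_apply, reForm_apply]
      ring
    · intro x
      rw [hB]
      have := hsum x
      have := hnn x
      positivity
    · intro x
      have hterm : ∀ i, 2 * reForm (rowFunctional S i) x (A *ᵥ x) ≤
          -a * Complex.normSq ((S *ᵥ complexVec x) i) +
            a⁻¹ * Complex.normSq ((S' *ᵥ complexVec x) i) := by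
        intro i
        rw [reForm_apply, rowFunctional_apply, rowFunctional_apply, hSA]
        simp only [Pi.add_apply, Pi.smul_apply, smul_eq_mul]
        set p := (S *ᵥ complexVec x) i
        set q := (S' *ᵥ complexVec x) i
        rw [Complex.normSq_apply, Complex.normSq_apply]
        simp only [Complex.add_re, Complex.add_im, Complex.mul_re, Complex.mul_im]
        have hlre : l.re = -a := by simp [ha]
        rw [hlre]
        have h1 : ∀ u v : ℝ, 2 * (u * v) ≤ a * (u * u) + a⁻¹ * (v * v) := by
          intro u v
          have h2 : a * (u * u) + a⁻¹ * (v * v) - 2 * (u * v) = a⁻¹ * (a * u - v) ^ 2 := by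
            field_simp
            ring
          have h3 : 0 ≤ a⁻¹ * (a * u - v) ^ 2 := by positivity
          linarith
        have h4 := h1 p.re q.re
        have h5 := h1 p.im q.im
        nlinarith
      have h1 : 2 * ∑ i, reForm (rowFunctional S i) x (A *ᵥ x) ≤
          -a * ∑ i, Complex.normSq ((S *ᵥ complexVec x) i) +
            a⁻¹ * ∑ i, Complex.normSq ((S' *ᵥ complexVec x) i) := by
        rw [Finset.mul_sum, Finset.mul_sum, Finset.mul_sum, ← Finset.sum_add_distrib]
        exact Finset.sum_le_sum fun i _ => hterm i
      have h2 := hdec x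
      have hai : 0 < a⁻¹ := inv_pos.2 ha0
      rw [hB]
      set s := ∑ i, Complex.normSq ((S *ᵥ complexVec x) i)
      set s' := ∑ i, Complex.normSq ((S' *ᵥ complexVec x) i)
      calc 2 * (a⁻¹ * (∑ i, reForm (rowFunctional S i) x (A *ᵥ x) + a⁻¹ * B' x (A *ᵥ x)))
          = a⁻¹ * (2 * (∑ i, reForm (rowFunctional S i) x (A *ᵥ x)) +
              a⁻¹ * (2 * B' x (A *ᵥ x))) := by ring
        _ ≤ a⁻¹ * ((-a * s + a⁻¹ * s') + a⁻¹ * (-s')) := by gcongr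
        _ = -(a⁻¹ * a) * s := by ring
        _ = -s := by rw [inv_mul_cancel₀ ha0.ne']; ring
    · intro x hx z
      have h1 : S' *ᵥ complexVec x = 0 := by rw [hS', ← mulVec_mulVec, hx, mulVec_zero]
      rw [hB, hker x h1 z]
      simp [reForm_apply, rowFunctional_apply, hx]
    · intro x hx
      rw [hB] at hx
      have h1 := hsum x
      have h2 := hnn x
      have hai : 0 < a⁻¹ := inv_pos.2 ha0
      have h3 : ∑ i, reForm (rowFunctional S i) x x + a⁻¹ * B' x x = 0 := by
        rcases mul_eq_zero.1 hx with h | h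
        · exact absurd h hai.ne'
        · exact h
      have h4 : ∑ i, reForm (rowFunctional S i) x x = 0 := by
        have := mul_nonneg hai.le h2
        linarith
      rw [Finset.sum_eq_zero_iff_of_nonneg fun i _ => by
        rw [reForm_self]; exact Complex.normSq_nonneg _] at h4
      ext i
      have := h4 i (Finset.mem_univ i)
      rw [reForm_self, Complex.normSq_eq_zero] at this
      exact this

open Polynomial in
/-- A positive definite storage function for a minimal negative imaginary plant: it is
nonincreasing along `x' = A x`, strictly so outside `ker N`, and on `ker N` the plant is lossless
with respect to the supply rate `u y'`. -/
theorem exists_storage {A : Matrix (Fin n) (Fin n) ℝ} {b c : Fin n → ℝ}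
    (hmin : IsMinimalRealization A b c) (hNI : IsNegativeImaginary (transferFunction A b c)) :
    ∃ (P : LinearMap.BilinForm ℝ (Fin n → ℝ)) (N : (Fin n → ℝ) →ₗ[ℝ] (Fin n → ℂ)),
      (∀ x z, P x z = P z x) ∧ (∀ x, x ≠ 0 → 0 < P x x) ∧
      (∀ x, 2 * P x (A *ᵥ x) ≤ -‖N x‖ ^ 2) ∧ (∀ x, N x = 0 → P x (A *ᵥ x) = 0) ∧
      (∀ x, N x = 0 → P b x = c ⬝ᵥ (A *ᵥ x)) ∧ (∀ x, A *ᵥ x = 0 → x = 0) := by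
  set m := minpoly ℂ (complexMat A) with hm
  have hint : IsIntegral ℂ (complexMat A) := Matrix.isIntegral _
  have hmonic : m.Monic := minpoly.monic hint
  have hm0 : m ≠ 0 := hmonic.ne_zero
  have hcases := fun {l : ℂ} (hl : m.IsRoot l) => minpoly_root_cases hmin hNI hl
  classical
  set Λ : Finset ℂ := m.roots.toFinset.filter fun l => l.re = 0 with hΛ
  have hΛmem : ∀ {l}, l ∈ Λ → m.IsRoot l ∧ l.re = 0 := by
    intro l hl
    rw [hΛ, Finset.mem_filter, Multiset.mem_toFinset, mem_roots hm0] at hl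
    exact hl
  -- The membership condition sits inside the existential so that K and q become total functions;
  -- off Λ they are 0.
  have hdata : ∀ l : ℂ, ∃ (K : ℝ) (q : ℂ[X]), l ∈ Λ → l ≠ 0 ∧ 0 < K ∧ m = (X - C l) * q ∧
      q.eval l ≠ 0 ∧
      l * (complexVec c ⬝ᵥ (aeval (complexMat A) q *ᵥ complexVec b)) = q.eval l * K := by
    intro l
    by_cases hl : l ∈ Λ
    · obtain ⟨hr, hre⟩ := hΛmem hl
      rcases hcases hr with h | ⟨-, h0, K, hK, q, hq, hq', h⟩
      · exact absurd hre h.ne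
      · exact ⟨K, q, fun _ => ⟨h0, hK, hq, hq', h⟩⟩
    · exact ⟨0, 0, fun h => absurd h hl⟩
  choose K q hKq using hdata
  set χ : ℂ[X] := ∏ l ∈ Λ, (X - C l) with hχ
  set R : Multiset ℂ := m.roots.filter fun l => ¬ l.re = 0 with hR
  have hRneg : ∀ l ∈ R.toList, l.re < 0 := by
    intro l hl
    rw [Multiset.mem_toList, hR, Multiset.mem_filter, mem_roots hm0] at hl
    rcases hcases hl.1 with h | h
    · exact h
    · exact absurd h.1 hl.2
  -- The imaginary roots are simple, so passing to a finite set loses no multiplicity.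
  have hΛval : m.roots.filter (fun l => l.re = 0) = Λ.val := by
    have hnd : (m.roots.filter fun l => l.re = 0).Nodup := by
      rw [Multiset.nodup_iff_count_le_one]
      intro l
      by_cases hl : l.re = 0
      · rw [Multiset.count_filter_of_pos (p := fun l : ℂ => l.re = 0) hl, count_roots]
        by_cases hr : m.IsRoot l
        · have hlΛ : l ∈ Λ := by
            rw [hΛ, Finset.mem_filter, Multiset.mem_toFinset, mem_roots hm0]
            exact ⟨hr, hl⟩
          obtain ⟨-, -, h1, h2, -⟩ := hKq l hlΛ
          have h3 : (X - C l) * q l ≠ 0 := h1 ▸ hm0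
          rw [h1, rootMultiplicity_mul h3, rootMultiplicity_X_sub_C_self,
            rootMultiplicity_eq_zero h2]
        · rw [rootMultiplicity_eq_zero hr]
          exact zero_le_one
      · rw [Multiset.count_filter_of_neg (p := fun l : ℂ => l.re = 0) hl]
        exact zero_le_one
    rw [hΛ, ← Multiset.toFinset_filter, Multiset.toFinset_val, hnd.dedup]
  have hfactor : m = (R.toList.map fun l => X - C l).prod * χ := by
    have h1 : m = (m.roots.map fun l => X - C l).prod :=
      ((IsAlgClosed.splits m).eq_prod_roots_of_monic hmonic)
    have h2 : (m.roots.map fun l => X - C l).prod =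
        ((m.roots.filter fun l => l.re = 0).map fun l => X - C l).prod *
          (R.map fun l => X - C l).prod := by
      rw [← Multiset.prod_add, ← Multiset.map_add, Multiset.filter_add_not]
    rw [h1, h2, hΛval, mul_comm, ← Multiset.prod_toList, hχ]
    congr 1
    rw [Multiset.prod_toList, ← Multiset.prod_coe, ← Multiset.map_coe, Multiset.coe_toList]
  set S := aeval (complexMat A) χ with hS
  have hcomm : ∀ p : ℂ[X], Commute (aeval (complexMat A) p) (complexMat A) := fun p => by
    have := (Commute.all p X).map (aeval (complexMat A))
    rwa [aeval_X] at this
  obtain ⟨B, hBsym, hBnn, hBdec, hBker, hBzero⟩ := exists_lyapunovForm A R.toList hRneg S (hcomm χ)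
    (by rw [hS, ← map_mul, ← hfactor]; exact minpoly.aeval _ _)
  let N : (Fin n → ℝ) →ₗ[ℝ] (Fin n → ℂ) := S.mulVecLin.restrictScalars ℝ ∘ₗ complexVec
  have hN : ∀ x, N x = S *ᵥ complexVec x := fun _ => rfl
  -- For l in Λ, c q(A) with q = m / (X - l) is a left eigenvector for l; the normalization by q(l)
  -- makes these functionals add up to c on ker χ(A).
  let ℓ : ℂ → (Fin n → ℝ) →ₗ[ℝ] ℂ := fun l =>
    ((q l).eval l)⁻¹ • ((dotProductBilin ℂ ℂ (complexVec c)).restrictScalars ℝ ∘ₗ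
      (aeval (complexMat A) (q l)).mulVecLin.restrictScalars ℝ ∘ₗ complexVec)
  have hℓ : ∀ l x, ℓ l x = ((q l).eval l)⁻¹ *
      (complexVec c ⬝ᵥ (aeval (complexMat A) (q l) *ᵥ complexVec x)) := fun _ _ => rfl
  have hℓA : ∀ l ∈ Λ, ∀ x, ℓ l (A *ᵥ x) = l * ℓ l x := by
    intro l hl x
    obtain ⟨-, -, h1, -, -⟩ := hKq l hl
    have h2 : aeval (complexMat A) (q l) * complexMat A = l • aeval (complexMat A) (q l) := by
      have h3 : aeval (complexMat A) ((X - C l) * q l) = 0 := h1 ▸ minpoly.aeval _ _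
      rw [map_mul, map_sub, aeval_X, aeval_C, sub_mul, sub_eq_zero,
        Algebra.algebraMap_eq_smul_one, smul_mul_assoc, one_mul] at h3
      rw [← h3, (hcomm (q l)).eq]
    rw [hℓ, hℓ, ← complexMat_mulVec, mulVec_mulVec, h2, smul_mulVec, dotProduct_smul, smul_eq_mul]
    ring
  have hℓb : ∀ l ∈ Λ, ℓ l b = K l / l := by
    intro l hl
    obtain ⟨h0, -, -, h2, h3⟩ := hKq l hl
    rw [hℓ, eq_div_iff h0, mul_assoc, mul_comm _ l, h3, ← mul_assoc, inv_mul_cancel₀ h2, one_mul]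
  have hℓsum : ∀ x, N x = 0 → ∑ l ∈ Λ, ℓ l x = ((c ⬝ᵥ x : ℝ) : ℂ) := by
    intro x hx
    -- Lagrange interpolation: at each root in Λ exactly one summand is nonzero and equals 1, so χ
    -- divides p and p(A) vanishes on ker χ(A).
    set p : ℂ[X] := (∑ l ∈ Λ, C ((q l).eval l)⁻¹ * q l) - 1 with hp
    have hdvd : χ ∣ p := by
      refine Finset.prod_dvd_of_coprime (fun k _ l _ hkl => ?_) fun k hk => ?_
      · exact isCoprime_X_sub_C_of_isUnit_sub (sub_ne_zero.2 hkl).isUnit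
      · rw [dvd_iff_isRoot, IsRoot.def, hp, eval_sub, eval_finsetSum, eval_one,
          Finset.sum_eq_single k]
        · rw [eval_mul, eval_C, inv_mul_cancel₀ (hKq k hk).2.2.2.1, sub_self]
        · intro l hl hlk
          have h1 : m.eval k = 0 := (hΛmem hk).1
          rw [(hKq l hl).2.2.1, eval_mul, eval_sub, eval_X, eval_C] at h1
          rcases mul_eq_zero.1 h1 with h2 | h2
          · exact absurd (sub_eq_zero.1 h2).symm hlk
          · rw [eval_mul, h2, mul_zero]
        · exact fun h => absurd hk h
    obtain ⟨r, hr⟩ := hdvd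
    have h1 : aeval (complexMat A) p *ᵥ complexVec x = 0 := by
      rw [hr, mul_comm, map_mul, ← mulVec_mulVec, ← hS, ← hN, hx, mulVec_zero]
    rw [hp, map_sub, map_one, sub_mulVec, one_mulVec, sub_eq_zero, map_sum, sum_mulVec] at h1
    rw [← complexVec_dotProduct, ← h1, dotProduct_sum]
    refine Finset.sum_congr rfl fun l _ => ?_
    rw [hℓ, map_mul, aeval_C, Algebra.algebraMap_eq_smul_one, smul_mul_assoc, one_mul, smul_mulVec,
      dotProduct_smul, smul_eq_mul]
  have hNA : ∀ x, N x = 0 → N (A *ᵥ x) = 0 := by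
    intro x hx
    rw [hN, ← complexMat_mulVec, mulVec_mulVec, (hcomm χ).eq, ← mulVec_mulVec, ← hN, hx,
      mulVec_zero]
  -- The weight |l|²/K is forced by ℓ(b) = K/l: it turns conj (ℓ b) ℓ(x) into l ℓ(x), whose sum over
  -- Λ is c A x when N x = 0.
  let P : LinearMap.BilinForm ℝ (Fin n → ℝ) :=
    ∑ l ∈ Λ, (Complex.normSq l / K l) • reForm (ℓ l) + B
  have hP : ∀ x z, P x z = ∑ l ∈ Λ, (Complex.normSq l / K l) * reForm (ℓ l) x z + B x z := by
    intro x z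
    simp [P, LinearMap.sum_apply]
  have hw : ∀ l ∈ Λ, 0 < Complex.normSq l / K l := fun l hl =>
    div_pos (Complex.normSq_pos.2 (hKq l hl).1) (hKq l hl).2.1
  have hterm : ∀ x, ∀ l ∈ Λ, 0 ≤ (Complex.normSq l / K l) * reForm (ℓ l) x x := fun x l hl =>
    mul_nonneg (hw l hl).le (by rw [reForm_self]; exact Complex.normSq_nonneg _)
  have hskew : ∀ x, ∑ l ∈ Λ, (Complex.normSq l / K l) * reForm (ℓ l) x (A *ᵥ x) = 0 := by
    intro x
    refine Finset.sum_eq_zero fun l hl => ?_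
    rw [reForm_apply, hℓA l hl, Complex.mul_re, Complex.mul_im, (hΛmem hl).2]
    ring
  refine ⟨P, N, ?_, ?_, ?_, ?_, ?_, ?_⟩
  · intro x z
    rw [hP, hP, hBsym x z]
    congr 1
    refine Finset.sum_congr rfl fun l _ => ?_
    rw [reForm_apply, reForm_apply]
    ring
  · intro x hx
    have hnn : 0 ≤ P x x := by
      rw [hP]
      exact add_nonneg (Finset.sum_nonneg (hterm x)) (hBnn x)
    refine lt_of_le_of_ne hnn fun h0 => hx ?_
    rw [hP] at h0
    have h1 := Finset.sum_nonneg (hterm x)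
    have h2 := hBnn x
    have hNx : N x = 0 := hBzero x (by linarith)
    have h3 : ∑ l ∈ Λ, (Complex.normSq l / K l) * reForm (ℓ l) x x = 0 := by linarith
    rw [Finset.sum_eq_zero_iff_of_nonneg (hterm x)] at h3
    have h4 : ∀ l ∈ Λ, ℓ l x = 0 := by
      intro l hl
      rcases mul_eq_zero.1 (h3 l hl) with h | h
      · exact absurd h (hw l hl).ne'
      · rwa [reForm_self, Complex.normSq_eq_zero] at h
    -- The common kernel of N and the eigenfunctionals is invariant under A, and c vanishes on it,
    -- so observability applies.
    have h5 : ∀ i : ℕ, N ((A ^ i) *ᵥ x) = 0 ∧ ∀ l ∈ Λ, ℓ l ((A ^ i) *ᵥ x) = 0 := by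
      intro i
      induction i with
      | zero => simpa using ⟨hNx, h4⟩
      | succ i ih =>
        rw [pow_succ', ← mulVec_mulVec]
        refine ⟨hNA _ ih.1, fun l hl => ?_⟩
        rw [hℓA l hl, ih.2 l hl, mul_zero]
    refine hmin.2 x fun i => ?_
    have h6 := hℓsum _ (h5 i).1
    rw [Finset.sum_eq_zero (h5 i).2] at h6
    exact_mod_cast h6.symm
  · intro x
    rw [hP, hskew, zero_add]
    refine (hBdec x).trans (neg_le_neg ?_)
    have h0 : 0 ≤ ∑ i, Complex.normSq ((S *ᵥ complexVec x) i) :=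
      Finset.sum_nonneg fun i _ => Complex.normSq_nonneg _
    have h1 : ‖N x‖ ≤ √(∑ i, Complex.normSq ((S *ᵥ complexVec x) i)) := by
      rw [pi_norm_le_iff_of_nonneg (Real.sqrt_nonneg _)]
      intro i
      refine Real.le_sqrt_of_sq_le ?_
      rw [← Complex.normSq_eq_norm_sq]
      exact Finset.single_le_sum (f := fun i => Complex.normSq ((S *ᵥ complexVec x) i))
        (fun i _ => Complex.normSq_nonneg _) (Finset.mem_univ i)
    calc ‖N x‖ ^ 2 ≤ (√(∑ i, Complex.normSq ((S *ᵥ complexVec x) i))) ^ 2 := by gcongr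
      _ = _ := Real.sq_sqrt h0
  · intro x hx
    rw [hP, hskew, hBker x hx, add_zero]
  · intro x hx
    rw [hP, hBsym, hBker x hx, add_zero]
    have h1 := congrArg Complex.re (hℓsum _ (hNA x hx))
    rw [Complex.ofReal_re] at h1
    rw [← h1, Complex.re_sum]
    refine Finset.sum_congr rfl fun l hl => ?_
    obtain ⟨h0, hK, -, -, -⟩ := hKq l hl
    have hre := (hΛmem hl).2
    have him : l.im ≠ 0 := fun h => h0 (Complex.ext hre h)
    rw [reForm_apply, hℓb l hl, hℓA l hl, Complex.mul_re, Complex.div_re, Complex.div_im,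
      Complex.normSq_apply, hre]
    simp only [Complex.ofReal_re, Complex.ofReal_im]
    field_simp
    ring
  · intro x hx
    by_contra hne
    have h0 : ¬ m.IsRoot 0 := fun hr => by
      rcases hcases hr with h | ⟨-, h, -⟩
      · simp at h
      · exact h rfl
    apply h0
    have h1 : complexMat A *ᵥ complexVec x = 0 := by rw [complexMat_mulVec, hx, map_zero]
    -- On ker A the matrix p(A) acts as p(0). For p = m a nonzero kernel vector would make 0 a root.
    have h2 : ∀ p : ℂ[X], aeval (complexMat A) p *ᵥ complexVec x = p.eval 0 • complexVec x := by
      intro p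
      obtain ⟨r, hr⟩ := dvd_iff_isRoot.2 (show (p - C (p.eval 0)).IsRoot 0 by simp)
      have hp : p = r * X + C (p.eval 0) := by
        rw [C_0, sub_zero] at hr
        rw [mul_comm r, ← hr]
        ring
      conv_lhs => rw [hp]
      rw [map_add, map_mul, aeval_X, aeval_C, add_mulVec, ← mulVec_mulVec, h1, mulVec_zero, zero_add,
        Algebra.algebraMap_eq_smul_one, smul_mulVec, one_mulVec]
    have h3 := h2 m
    rw [minpoly.aeval, zero_mulVec] at h3
    rcases smul_eq_zero.1 h3.symm with h | h
    · exact h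
    · refine absurd ?_ hne
      ext i
      have := congrFun h i
      simpa [complexVec] using this

end Storage

/-! ## The linear flow -/

section LinearFlow

variable {E F : Type*} [NormedAddCommGroup E] [NormedSpace ℝ E]
  [NormedAddCommGroup F] [NormedSpace ℝ F]

/-- The solution at time `t` of `x' = A x` with initial value `x`. -/
def linearFlow (A : E →L[ℝ] E) (t : ℝ) (x : E) : E := NormedSpace.exp (t • A) x

theorem linearFlow_zero (A : E →L[ℝ] E) (x : E) : linearFlow A 0 x = x := by
  simp [linearFlow]

theorem linearFlow_smul (A : E →L[ℝ] E) (t r : ℝ) (x : E) :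
    linearFlow A t (r • x) = r • linearFlow A t x := map_smul _ _ _

variable [FiniteDimensional ℝ E]

theorem hasDerivAt_linearFlow (A : E →L[ℝ] E) (t : ℝ) (x : E) :
    HasDerivAt (fun t => linearFlow A t x) (A (linearFlow A t x)) t := by
  have : CompleteSpace E := FiniteDimensional.complete ℝ E
  have h := hasDerivAt_exp_smul_const' (𝕂 := ℝ) A t
  exact h.clm_apply (hasDerivAt_const t x) |>.congr_deriv (by simp [linearFlow])

theorem linearFlow_add (A : E →L[ℝ] E) (s t : ℝ) (x : E) :
    linearFlow A (s + t) x = linearFlow A t (linearFlow A s x) := by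
  have : CompleteSpace E := FiniteDimensional.complete ℝ E
  let _ := NormedAlgebra.restrictScalars ℚ ℝ (E →L[ℝ] E)
  have hc : Commute (t • A) (s • A) := ((Commute.refl A).smul_left t).smul_right s
  rw [linearFlow, linearFlow, linearFlow, add_comm, add_smul, NormedSpace.exp_add_of_commute hc]
  rfl

theorem linearFlow_eq_zero {A : E →L[ℝ] E} {t : ℝ} {x : E} (h : linearFlow A t x = 0) : x = 0 := by
  have h1 := linearFlow_add A t (-t) x
  rw [h, add_neg_cancel, linearFlow_zero] at h1
  rw [h1]
  exact map_zero _

theorem continuous_linearFlow (A : E →L[ℝ] E) :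
    Continuous fun p : ℝ × E => linearFlow A p.1 p.2 := by
  have : CompleteSpace E := FiniteDimensional.complete ℝ E
  have h : Continuous fun t : ℝ => NormedSpace.exp (t • A) :=
    continuous_iff_continuousAt.2 fun t => (hasDerivAt_exp_smul_const' (𝕂 := ℝ) A t).continuousAt
  exact (h.comp continuous_fst).clm_apply continuous_snd

theorem continuous_linearFlow_time (A : E →L[ℝ] E) (x : E) :
    Continuous fun t => linearFlow A t x :=
  (continuous_linearFlow A).comp (by fun_prop : Continuous fun t : ℝ => (t, x))

/-- An observable output that vanishes on an interval comes from the zero state. -/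
theorem eq_zero_of_output_eq_zero {A : E →L[ℝ] E} {c : E →L[ℝ] ℝ}
    (hobs : ∀ x, (∀ i : ℕ, c ((A ^ i) x) = 0) → x = 0) {s t : ℝ} (hst : s < t) {x : E}
    (h : ∀ r ∈ Set.Ioo s t, c (linearFlow A r x) = 0) : x = 0 := by
  have key : ∀ i : ℕ, ∀ r ∈ Set.Ioo s t, c ((A ^ i) (linearFlow A r x)) = 0 := by
    intro i
    induction i with
    | zero => simpa using h
    | succ i ih =>
      intro r hr
      have hd : HasDerivAt (fun r => c ((A ^ i) (linearFlow A r x)))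
          (c ((A ^ i) (A (linearFlow A r x)))) r :=
        (c.comp (A ^ i)).hasFDerivAt.comp_hasDerivAt r (hasDerivAt_linearFlow A r x)
      have h0 : HasDerivAt (fun r => c ((A ^ i) (linearFlow A r x))) 0 r :=
        (hasDerivAt_const r (0 : ℝ)).congr_of_eventuallyEq
          (by filter_upwards [isOpen_Ioo.mem_nhds hr] with q hq using ih q hq)
      rw [pow_succ]
      exact hd.unique h0
  obtain ⟨r, hr⟩ := Set.nonempty_Ioo.2 hst
  exact linearFlow_eq_zero (hobs _ fun i => key i r hr)

/-- Positive continuous homogeneous functions dominate a power of the norm. -/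
theorem exists_pos_mul_norm_pow_le {f : E → ℝ} {k : ℕ} (hf : Continuous f)
    (hhom : ∀ r : ℝ, 0 < r → ∀ x, f (r • x) = r ^ k * f x) (h0 : 0 ≤ f 0)
    (hk : k ≠ 0) (hpos : ∀ x, x ≠ 0 → 0 < f x) : ∃ m : ℝ, 0 < m ∧ ∀ x, m * ‖x‖ ^ k ≤ f x := by
  obtain ⟨m, hm, h⟩ := (isCompact_sphere (0 : E) 1).exists_forall_le' hf.continuousOn (a := 0)
    fun x hx => hpos x (by rintro rfl; simp at hx)
  refine ⟨m, hm, fun x => ?_⟩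
  rcases eq_or_ne x 0 with rfl | hx
  · simpa [hk] using h0
  · have hn : 0 < ‖x‖ := norm_pos_iff.2 hx
    have h1 := h (‖x‖⁻¹ • x) (by simp [norm_smul, hn.ne'])
    have h2 := hhom ‖x‖ hn (‖x‖⁻¹ • x)
    rw [smul_smul, mul_inv_cancel₀ hn.ne', one_smul] at h2
    rw [h2, mul_comm]
    exact mul_le_mul_of_nonneg_left h1 (by positivity)

/-- Along the lossless modes, the output of the linear flow vanishes within a uniform time. -/
theorem exists_time_output_zero {A : E →L[ℝ] E} {c : E →L[ℝ] ℝ} {P : E →L[ℝ] E →L[ℝ] ℝ}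
    {N : E →L[ℝ] F} (hsym : ∀ x z, P x z = P z x) (hpos : ∀ x, x ≠ 0 → 0 < P x x)
    (hloss : ∀ x, N x = 0 → P x (A x) = 0) (hinj : ∀ x, A x = 0 → x = 0)
    (hobs : ∀ x, (∀ i : ℕ, c ((A ^ i) x) = 0) → x = 0) :
    ∃ T : ℝ, 0 < T ∧ ∀ x, (∀ t ∈ Set.Icc 0 T, N (linearFlow A t x) = 0) →
      ∃ s ∈ Set.Ioo 0 T, c (linearFlow A s x) = 0 := by
  have : CompleteSpace E := FiniteDimensional.complete ℝ E
  obtain ⟨p, hp, hpP⟩ := exists_pos_mul_norm_pow_le (f := fun x => P x x) (k := 2)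
    (P.continuous.clm_apply continuous_id) (fun r _ x => by simp; ring) (by simp) two_ne_zero hpos
  set Q : ℝ := ‖P‖ + 1 with hQ
  have hQ0 : 0 < Q := by positivity
  have hQP : ∀ x, P x x ≤ Q * ‖x‖ ^ 2 := fun x => by
    have h1 := P.le_opNorm₂ x x
    rw [Real.norm_eq_abs] at h1
    nlinarith [le_abs_self (P x x), sq_nonneg ‖x‖]
  -- A left inverse of A makes the output a derivative, y = (d φ)'. While y keeps its sign, the
  -- integral of |y| is thus bounded by the increments of d φ.
  obtain ⟨B, hB⟩ : ∃ B : E →ₗ[ℝ] E, B ∘ₗ (A : E →ₗ[ℝ] E) = LinearMap.id :=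
    LinearMap.exists_leftInverse_of_injective _ (LinearMap.ker_eq_bot'.2 hinj)
  have hBA : ∀ x, B (A x) = x := fun x => LinearMap.congr_fun hB x
  set d : E →L[ℝ] ℝ := c.comp (LinearMap.toContinuousLinearMap B) with hd
  have hdA : ∀ x, d (A x) = c x := fun x => by simp [hd, hBA]
  have hyc : Continuous fun p : ℝ × E => |c (linearFlow A p.1 p.2)| :=
    (c.continuous.comp (continuous_linearFlow A)).abs
  have hyt : ∀ x, Continuous fun t => c (linearFlow A t x) := fun x =>
    c.continuous.comp (continuous_linearFlow_time A x)
  -- By observability each unit of time contributes at least g times the norm of the current state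
  -- to the integral of |y|.
  obtain ⟨g, hg, hgE⟩ := exists_pos_mul_norm_pow_le (k := 1)
    (f := fun x => ∫ s in (0 : ℝ)..1, |c (linearFlow A s x)|)
    (intervalIntegral.continuous_parametric_intervalIntegral_of_continuous'
      (f := fun x s => |c (linearFlow A s x)|)
      (hyc.comp (by fun_prop : Continuous fun q : E × ℝ => (q.2, q.1))) 0 1)
    (fun r hr x => by
      simp only [linearFlow_smul, map_smul, smul_eq_mul, abs_mul, abs_of_pos hr, pow_one]
      rw [intervalIntegral.integral_const_mul])
    (intervalIntegral.integral_nonneg zero_le_one fun _ _ => abs_nonneg _) one_ne_zero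
    (fun x hx => by
      have h1 : ∃ s ∈ Set.Icc (0 : ℝ) 1, 0 < |c (linearFlow A s x)| := by
        by_contra hcon
        push Not at hcon
        refine hx (eq_zero_of_output_eq_zero hobs zero_lt_one fun r hr => ?_)
        exact abs_nonpos_iff.1 (hcon r ⟨hr.1.le, hr.2.le⟩)
      exact intervalIntegral.integral_pos zero_lt_one (hyt x).abs.continuousOn
        (fun _ _ => abs_nonneg _) h1)
  -- With ρ² = p / Q, m unit intervals contribute at least m g ρ ‖x‖, and the sign bound allows at
  -- most 2 ‖d‖ ρ⁻¹ ‖x‖. The window is one unit longer so that its length is clearly positive.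
  obtain ⟨m, hm⟩ := exists_nat_gt (2 * ‖d‖ * Q / (g * p))
  refine ⟨m + 1, by positivity, fun x hN => ?_⟩
  by_contra! hne
  set T : ℝ := m + 1 with hT
  have hT0 : 0 < T := by positivity
  set φ : ℝ → E := fun t => linearFlow A t x with hφ
  have hφd : ∀ t, HasDerivAt φ (A (φ t)) t := fun t => hasDerivAt_linearFlow A t x
  have hcons : ∀ t ∈ Set.Icc 0 T, P (φ t) (φ t) = P x x := by
    have hd' : ∀ t, HasDerivAt (fun t => P (φ t) (φ t)) (2 * P (φ t) (A (φ t))) t := by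
      intro t
      have h1 := (P.hasFDerivAt.comp_hasDerivAt t (hφd t)).clm_apply (hφd t)
      refine h1.congr_deriv ?_
      rw [hsym (A (φ t)) (φ t), Function.comp_apply]
      ring
    intro t ht
    have h1 := constant_of_has_deriv_right_zero (f := fun t => P (φ t) (φ t)) (a := 0) (b := T)
      (fun t _ => (hd' t).continuousAt.continuousWithinAt) (fun t ht => by
        have := (hd' t).hasDerivWithinAt (s := Set.Ici t)
        rwa [hloss _ (hN t ⟨ht.1, ht.2.le⟩), mul_zero] at this) t ht
    rw [h1, hφ]
    simp only [linearFlow_zero]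
  have hup : ∀ t ∈ Set.Icc 0 T, p * ‖φ t‖ ^ 2 ≤ Q * ‖x‖ ^ 2 := fun t ht =>
    (hpP (φ t)).trans ((hcons t ht).le.trans (hQP x))
  have hlo : ∀ t ∈ Set.Icc 0 T, p * ‖x‖ ^ 2 ≤ Q * ‖φ t‖ ^ 2 := fun t ht =>
    (hpP x).trans ((hcons t ht).ge.trans (hQP (φ t)))
  have hx0 : x ≠ 0 := by
    rintro rfl
    exact hne (T / 2) ⟨by positivity, by linarith⟩ (by simp [linearFlow])
  set y : ℝ → ℝ := fun t => c (φ t) with hy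
  have hycont : Continuous y := hyt x
  set ρ : ℝ := √(p / Q) with hρ
  have hρ0 : 0 < ρ := Real.sqrt_pos.2 (by positivity)
  have hρ2 : ρ ^ 2 = p / Q := Real.sq_sqrt (by positivity)
  have hup' : ∀ t ∈ Set.Icc 0 T, ρ * ‖φ t‖ ≤ ‖x‖ := fun t ht => by
    refine abs_le_of_sq_le_sq' ?_ (norm_nonneg x) |>.2
    rw [mul_pow, hρ2, div_mul_eq_mul_div, div_le_iff₀ hQ0]
    linarith [hup t ht]
  have hlo' : ∀ t ∈ Set.Icc 0 T, ρ * ‖x‖ ≤ ‖φ t‖ := fun t ht => by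
    refine abs_le_of_sq_le_sq' ?_ (norm_nonneg _) |>.2
    rw [mul_pow, hρ2, div_mul_eq_mul_div, div_le_iff₀ hQ0]
    linarith [hlo t ht]
  have hsign : ∃ σ : ℝ, |σ| = 1 ∧ ∀ t ∈ Set.Icc 0 T, |y t| = σ * y t := by
    have hoc : (y '' Set.Ioo 0 T).OrdConnected :=
      (isPreconnected_Ioo.image y hycont.continuousOn).ordConnected
    have hmid : T / 2 ∈ Set.Ioo 0 T := ⟨by positivity, by linarith⟩
    have hzero : (0 : ℝ) ∉ y '' Set.Ioo 0 T := by
      rintro ⟨t, ht, h⟩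
      exact hne t ht h
    have hclosed : ∀ σ : ℝ, (∀ t ∈ Set.Ioo 0 T, 0 ≤ σ * y t) → ∀ t ∈ Set.Icc 0 T, 0 ≤ σ * y t := by
      intro σ h t ht
      rw [← closure_Ioo hT0.ne] at ht
      exact closure_minimal h
        (isClosed_le continuous_const (continuous_const.mul hycont)) ht
    rcases lt_or_gt_of_ne (hne _ hmid) with hneg | hposi
    · refine ⟨-1, by simp, fun t ht => ?_⟩
      have := hclosed (-1) (fun t ht => by
        by_contra hcon
        push Not at hcon
        exact hzero (hoc.out ⟨_, hmid, rfl⟩ ⟨t, ht, rfl⟩ ⟨hneg.le, by linarith⟩)) t ht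
      rw [abs_of_nonpos (by linarith)]
      ring
    · refine ⟨1, by simp, fun t ht => ?_⟩
      have := hclosed 1 (fun t ht => by
        by_contra hcon
        push Not at hcon
        exact hzero (hoc.out ⟨t, ht, rfl⟩ ⟨_, hmid, rfl⟩ ⟨by linarith, hposi.le⟩)) t ht
      rw [abs_of_nonneg (by linarith), one_mul]
  obtain ⟨σ, hσ, hσy⟩ := hsign
  have hmT : (m : ℝ) ≤ T := by linarith
  have hint1 : ∫ t in (0 : ℝ)..m, |y t| = σ * (d (φ m) - d (φ 0)) := by
    have h1 : ∫ t in (0 : ℝ)..m, |y t| = ∫ t in (0 : ℝ)..m, σ * y t := by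
      refine intervalIntegral.integral_congr fun t ht => ?_
      rw [Set.uIcc_of_le (by positivity)] at ht
      exact hσy t ⟨ht.1, ht.2.trans hmT⟩
    rw [h1, intervalIntegral.integral_const_mul]
    congr 1
    refine intervalIntegral.integral_eq_sub_of_hasDerivAt (f := fun t => d (φ t)) (fun t _ => ?_)
      (hycont.intervalIntegrable _ _)
    have := d.hasFDerivAt.comp_hasDerivAt t (hφd t)
    rwa [hdA] at this
  have hint2 : ∫ t in (0 : ℝ)..m, |y t| ≤ 2 * ‖d‖ * (ρ⁻¹ * ‖x‖) := by
    have hbd : ∀ t ∈ Set.Icc 0 T, |d (φ t)| ≤ ‖d‖ * (ρ⁻¹ * ‖x‖) := fun t ht => by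
      refine (d.le_opNorm _).trans (mul_le_mul_of_nonneg_left ?_ (norm_nonneg _))
      rw [inv_mul_eq_div, le_div_iff₀ hρ0, mul_comm]
      exact hup' t ht
    rw [hint1]
    calc σ * (d (φ m) - d (φ 0)) ≤ |σ * (d (φ m) - d (φ 0))| := le_abs_self _
      _ = |d (φ m) - d (φ 0)| := by rw [abs_mul, hσ, one_mul]
      _ ≤ |d (φ m)| + |d (φ 0)| := abs_sub _ _
      _ ≤ _ := by linarith [hbd m ⟨by positivity, hmT⟩, hbd 0 ⟨le_rfl, hT0.le⟩]
  have hint3 : (m : ℝ) * (g * (ρ * ‖x‖)) ≤ ∫ t in (0 : ℝ)..m, |y t| := by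
    have h1 := intervalIntegral.sum_integral_adjacent_intervals (f := fun t => |y t|)
      (μ := volume) (a := fun k : ℕ => (k : ℝ)) (n := m)
      fun k _ => hycont.abs.intervalIntegrable _ _
    rw [Nat.cast_zero] at h1
    rw [← h1, ← nsmul_eq_mul]
    have h2 : ∀ k ∈ Finset.range m,
        g * (ρ * ‖x‖) ≤ ∫ t in ((k : ℕ) : ℝ)..((k + 1 : ℕ) : ℝ), |y t| := by
      intro k hk
      have hkm : ((k : ℕ) : ℝ) ≤ m := by exact_mod_cast (Finset.mem_range.1 hk).le
      have h3 := hgE (φ k)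
      rw [pow_one] at h3
      have h4 : ∫ s in (0 : ℝ)..1, |c (linearFlow A s (φ k))| =
          ∫ t in ((k : ℕ) : ℝ)..((k + 1 : ℕ) : ℝ), |y t| := by
        have h5 := intervalIntegral.integral_comp_add_left (a := 0) (b := 1)
          (fun t => |y t|) (k : ℝ)
        rw [add_zero] at h5
        push_cast
        rw [← h5]
        refine intervalIntegral.integral_congr fun s _ => ?_
        simp only [hy, hφ, linearFlow_add]
      rw [← h4]
      exact (mul_le_mul_of_nonneg_left
        (hlo' k ⟨by positivity, hkm.trans hmT⟩) hg.le).trans h3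
    have h6 := Finset.card_nsmul_le_sum (Finset.range m) _ _ h2
    rwa [Finset.card_range] at h6
  have hxn : 0 < ‖x‖ := norm_pos_iff.2 hx0
  have h1 : (m : ℝ) * (g * ρ) ≤ 2 * ‖d‖ * ρ⁻¹ := by
    refine le_of_mul_le_mul_right ?_ hxn
    calc (m : ℝ) * (g * ρ) * ‖x‖ = m * (g * (ρ * ‖x‖)) := by ring
      _ ≤ 2 * ‖d‖ * (ρ⁻¹ * ‖x‖) := hint3.trans hint2
      _ = _ := by ring
  have h2 : (m : ℝ) * (g * (p / Q)) ≤ 2 * ‖d‖ := by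
    calc (m : ℝ) * (g * (p / Q)) = (m * (g * ρ)) * ρ := by rw [← hρ2]; ring
      _ ≤ 2 * ‖d‖ * ρ⁻¹ * ρ := mul_le_mul_of_nonneg_right h1 hρ0.le
      _ = 2 * ‖d‖ := by rw [mul_assoc, inv_mul_cancel₀ hρ0.ne', mul_one]
  rw [div_lt_iff₀ (by positivity)] at hm
  have h3 : (m : ℝ) * (g * (p / Q)) * Q = m * (g * p) := by field_simp
  nlinarith

/-- The dissipation of the lossless flow driving a reflected integrator is bounded below by the
square of the initial state, uniformly over a time window. -/
theorem exists_dissipation_lower_bound {A : E →L[ℝ] E} {c : E →L[ℝ] ℝ} {P : E →L[ℝ] E →L[ℝ] ℝ}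
    {N : E →L[ℝ] F} (hsym : ∀ x z, P x z = P z x) (hpos : ∀ x, x ≠ 0 → 0 < P x x)
    (hloss : ∀ x, N x = 0 → P x (A x) = 0) (hinj : ∀ x, A x = 0 → x = 0)
    (hobs : ∀ x, (∀ i : ℕ, c ((A ^ i) x) = 0) → x = 0) :
    ∃ T : ℝ, 0 < T ∧ ∃ d : ℝ, 0 < d ∧ ∀ (x : E) (ξ : ℝ → ℝ),
      IsReflected (fun t => c (linearFlow A t x)) ξ 0 T →
      d * ‖x‖ ^ 2 ≤
        ∫ t in (0 : ℝ)..T, (‖N (linearFlow A t x)‖ ^ 2 + (|c (linearFlow A t x)| - ξ t) * ξ t) := by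
  obtain ⟨T, hT, hzero⟩ := exists_time_output_zero hsym hpos hloss hinj hobs
  have hyt : ∀ x, Continuous fun t => c (linearFlow A t x) := fun x =>
    c.continuous.comp (continuous_linearFlow_time A x)
  let D : E → (ℝ → ℝ) → ℝ := fun x ξ =>
    ∫ t in (0 : ℝ)..T, (‖N (linearFlow A t x)‖ ^ 2 + (|c (linearFlow A t x)| - ξ t) * ξ t)
  have hD : ∀ x ξ, D x ξ = ∫ t in (0 : ℝ)..T,
    (‖N (linearFlow A t x)‖ ^ 2 + (|c (linearFlow A t x)| - ξ t) * ξ t) := fun _ _ => rfl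
  have hpositive : ∀ x ξ, x ≠ 0 → IsReflected (fun t => c (linearFlow A t x)) ξ 0 T →
      0 < D x ξ := by
    intro x ξ hx hξ
    have hNc : ContinuousOn (fun t => ‖N (linearFlow A t x)‖ ^ 2) (Set.Icc 0 T) :=
      ((N.continuous.comp (continuous_linearFlow_time A x)).norm.pow 2).continuousOn
    have hprod : ∀ t ∈ Set.Icc 0 T, 0 ≤ (|c (linearFlow A t x)| - ξ t) * ξ t := fun t ht =>
      mul_nonneg (sub_nonneg.2 (hξ.le_abs t ht)) (hξ.nonneg t ht)
    refine intervalIntegral.integral_pos hT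
      (hNc.add (((hyt x).abs.continuousOn.sub hξ.continuousOn_state).mul hξ.continuousOn_state))
      (fun t ht => add_nonneg (sq_nonneg _) (hprod t ⟨ht.1.le, ht.2⟩)) ?_
    by_contra! hcon
    have hboth : ∀ t ∈ Set.Icc 0 T, N (linearFlow A t x) = 0 ∧
        (|c (linearFlow A t x)| - ξ t) * ξ t = 0 := by
      intro t ht
      have h1 := hcon t ht
      have h2 := hprod t ht
      have h3 := sq_nonneg ‖N (linearFlow A t x)‖
      refine ⟨?_, by linarith⟩
      exact norm_eq_zero.1 (pow_eq_zero_iff two_ne_zero |>.1 (by linarith))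
    obtain ⟨s, hs, hys⟩ := hzero x fun t ht => (hboth t ht).1
    have habs : ∀ t, 0 < t → t ≤ T → ξ t = |c (linearFlow A t x)| := fun t h1 h2 =>
      hξ.eq_abs_of_mul_eq_zero (fun t ht => (hboth t ht).2) h1 h2
    -- From the zero s on, |y| = ξ and reflection gives |y| ≤ Y with Y' = |y|. Grönwall then makes
    -- Y, hence y, vanish.
    set Y : ℝ → ℝ := fun t => ∫ r in s..t, |c (linearFlow A r x)| with hY
    have hYd : ∀ t, HasDerivAt Y |c (linearFlow A t x)| t := fun t =>
      intervalIntegral.integral_hasDerivAt_right ((hyt x).abs.intervalIntegrable s t)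
        (hyt x).abs.aestronglyMeasurable.stronglyMeasurableAtFilter (hyt x).abs.continuousAt
    have hyY : ∀ t ∈ Set.Icc s T, |c (linearFlow A t x)| ≤ Y t := by
      intro t ht
      have := hξ.upper s t hs.1.le ht.1 ht.2
      rwa [habs t (hs.1.trans_le ht.1) ht.2, habs s hs.1 hs.2.le, hys, abs_zero, zero_add] at this
    have hYzero : ∀ t ∈ Set.Icc s T, ‖Y t‖ ≤ 0 := by
      intro t ht
      have := norm_le_gronwallBound_of_norm_deriv_right_le (f := Y)
        (f' := fun t => |c (linearFlow A t x)|) (δ := 0) (K := 1) (ε := 0) (a := s) (b := T)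
        (fun t _ => (hYd t).continuousAt.continuousWithinAt)
        (fun t _ => (hYd t).hasDerivWithinAt) (by simp [hY])
        (fun t ht => by
          have h1 := hyY t ⟨ht.1, ht.2.le⟩
          rw [Real.norm_eq_abs, Real.norm_eq_abs, abs_abs, one_mul, add_zero]
          exact h1.trans (le_abs_self _)) t ht
      rwa [gronwallBound_ε0_δ0] at this
    refine hx (eq_zero_of_output_eq_zero hobs hs.2 fun r hr => ?_)
    have hrI : r ∈ Set.Icc s T := ⟨hr.1.le, hr.2.le⟩
    have h1 := hyY r hrI
    have h2 := hYzero r hrI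
    rw [Real.norm_eq_abs] at h2
    exact abs_nonpos_iff.1 (h1.trans ((le_abs_self _).trans h2))
  have hcont : Continuous fun q : E × ℝ =>
      D q.1 (reflectedState (fun t => c (linearFlow A t q.1)) q.2) := by
    have hflow : Continuous fun q : (E × ℝ) × ℝ => linearFlow A q.2 q.1.1 :=
      (continuous_linearFlow A).comp (by fun_prop : Continuous fun q : (E × ℝ) × ℝ => (q.2, q.1.1))
    have hrefl : Continuous fun q : (E × ℝ) × ℝ =>
        reflectedState (fun t => c (linearFlow A t q.1.1)) q.1.2 q.2 :=
      continuous_reflectedState (X := (E × ℝ) × ℝ) (e := fun q t => c (linearFlow A t q.1.1))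
        (w := fun q => q.1.2) (t := fun q => q.2)
        (c.continuous.comp ((continuous_linearFlow A).comp
          (by fun_prop : Continuous fun q : ((E × ℝ) × ℝ) × ℝ => (q.2, q.1.1.1))))
        (by fun_prop) (by fun_prop)
    refine intervalIntegral.continuous_parametric_intervalIntegral_of_continuous'
      (f := fun (q : E × ℝ) t => ‖N (linearFlow A t q.1)‖ ^ 2 +
        (|c (linearFlow A t q.1)| - reflectedState (fun t => c (linearFlow A t q.1)) q.2 t) *
          reflectedState (fun t => c (linearFlow A t q.1)) q.2 t) ?_ 0 T
    exact ((N.continuous.comp hflow).norm.pow 2).add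
      (((c.continuous.comp hflow).abs.sub hrefl).mul hrefl)
  -- Homogeneity reduces to unit initial states; with the admissible initial values of the reflected
  -- state these form a compact set.
  set K : Set (E × ℝ) := (Metric.sphere 0 1 ×ˢ Set.Icc 0 ‖c‖) ∩ {q | q.2 ≤ |c q.1|} with hK
  have hKc : IsCompact K :=
    ((isCompact_sphere 0 1).prod isCompact_Icc).inter_right
      (isClosed_le continuous_snd (c.continuous.comp continuous_fst).abs)
  obtain ⟨d, hd, hdK⟩ := hKc.exists_forall_le' hcont.continuousOn (a := 0) fun q hq => by
    refine hpositive _ _ ?_ (isReflected_reflectedState (hyt q.1) hq.1.2.1 ?_ T)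
    · intro h
      have := hq.1.1
      simp [h] at this
    · rw [linearFlow_zero]
      exact hq.2
  refine ⟨T, hT, d, hd, fun x ξ hξ => ?_⟩
  rw [← hD]
  have h0T : (0 : ℝ) ∈ Set.Icc 0 T := ⟨le_rfl, hT.le⟩
  rcases eq_or_ne x 0 with rfl | hx
  · have hx0 : ∀ t, linearFlow A t (0 : E) = 0 := fun t => map_zero _
    have h1 : ∀ t ∈ Set.Icc 0 T, 0 ≤ ‖N (linearFlow A t (0 : E))‖ ^ 2 +
        (|c (linearFlow A t (0 : E))| - ξ t) * ξ t := fun t ht =>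
      add_nonneg (sq_nonneg _) (mul_nonneg (sub_nonneg.2 (hξ.le_abs t ht)) (hξ.nonneg t ht))
    simpa using intervalIntegral.integral_nonneg hT.le h1
  · have hn : 0 < ‖x‖ := norm_pos_iff.2 hx
    set u : E := ‖x‖⁻¹ • x with hu
    have hun : ‖u‖ = 1 := by simp [hu, norm_smul, hn.ne']
    have hflow : ∀ t, linearFlow A t u = ‖x‖⁻¹ • linearFlow A t x := fun t =>
      linearFlow_smul A t _ x
    have hη : IsReflected (fun t => c (linearFlow A t u)) (fun t => ‖x‖⁻¹ * ξ t) 0 T := by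
      have := hξ.smul (inv_nonneg.2 hn.le)
      simpa only [hflow, map_smul, smul_eq_mul] using this
    set w : ℝ := ‖x‖⁻¹ * ξ 0 with hw
    have hw0 : 0 ≤ w := hη.nonneg 0 h0T
    have hwc : w ≤ |c u| := by
      have := hη.le_abs 0 h0T
      rwa [linearFlow_zero] at this
    have hqK : (u, w) ∈ K := by
      refine ⟨⟨by simp [hun], hw0, hwc.trans ?_⟩, hwc⟩
      have := c.le_opNorm u
      rwa [hun, mul_one] at this
    have h1 := hdK _ hqK
    have hR := isReflected_reflectedState (hyt u) hw0 (by rwa [linearFlow_zero]) T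
    have h2 : D u (reflectedState (fun t => c (linearFlow A t u)) w) =
        D u (fun t => ‖x‖⁻¹ * ξ t) := by
      refine intervalIntegral.integral_congr fun t ht => ?_
      rw [Set.uIcc_of_le hT.le] at ht
      have := hR.eq_of_initial hη (reflectedState_zero (by rwa [linearFlow_zero])) ht
      simp only [this]
    have h3 : D u (fun t => ‖x‖⁻¹ * ξ t) = (‖x‖⁻¹) ^ 2 * D x ξ := by
      rw [hD, hD, ← intervalIntegral.integral_const_mul]
      refine intervalIntegral.integral_congr fun t _ => ?_
      simp only [hflow, map_smul, norm_smul, smul_eq_mul, abs_mul, norm_inv, norm_norm, abs_inv,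
        abs_norm]
      ring
    have h4 : d ≤ (‖x‖⁻¹) ^ 2 * D x ξ := by
      rw [← h3, ← h2]
      exact h1
    calc d * ‖x‖ ^ 2 ≤ (‖x‖⁻¹) ^ 2 * D x ξ * ‖x‖ ^ 2 :=
          mul_le_mul_of_nonneg_right h4 (sq_nonneg _)
      _ = D x ξ := by field_simp

end LinearFlow

/-! ## Small-gain perturbation of the linear flow -/

section Perturbation

variable {E F : Type*} [NormedAddCommGroup E] [NormedSpace ℝ E]
  [NormedAddCommGroup F] [NormedSpace ℝ F]

/-- Grönwall. The summand 1 in the rate keeps it at least 1, so that the next estimate may divide by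
it. -/
theorem norm_le_of_small_input {A : E →L[ℝ] E} {b : E} {β κ T : ℝ} (hβ : 0 ≤ β) (hκ : κ ≤ 1)
    {x : ℝ → E} {u : ℝ → ℝ} (hxc : ContinuousOn x (Set.Icc 0 T))
    (hx : ∀ t ∈ Set.Ico 0 T, HasDerivWithinAt x (A (x t) + u t • b) (Set.Ici t) t)
    (hu : ∀ t ∈ Set.Ico 0 T, |u t| ≤ κ * (β * ‖x t‖)) {t : ℝ} (ht : t ∈ Set.Icc 0 T) :
    ‖x t‖ ≤ Real.exp ((‖A‖ + β * ‖b‖ + 1) * T) * ‖x 0‖ := by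
  have h := norm_le_gronwallBound_of_norm_deriv_right_le hxc hx le_rfl
    (K := ‖A‖ + β * ‖b‖ + 1) (ε := 0) (fun t ht => by
      refine (norm_add_le _ _).trans ?_
      rw [norm_smul, Real.norm_eq_abs, add_zero]
      have h1 := A.le_opNorm (x t)
      have h2 : |u t| ≤ β * ‖x t‖ := (hu t ht).trans
        (mul_le_of_le_one_left (by positivity) hκ)
      have h3 : |u t| * ‖b‖ ≤ β * ‖x t‖ * ‖b‖ := by gcongr
      nlinarith [norm_nonneg (x t)]) t ht
  rw [gronwallBound_ε0, sub_zero, mul_comm] at h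
  refine h.trans ?_
  gcongr
  exact ht.2

variable [FiniteDimensional ℝ E]

/-- The deviation from the free flow starts at 0 and is driven by u b alone, hence is of order κ
over a fixed window. -/
theorem norm_sub_linearFlow_le {A : E →L[ℝ] E} {b : E} {β κ T : ℝ} (hβ : 0 ≤ β) (hκ0 : 0 ≤ κ)
    (hκ : κ ≤ 1) {x : ℝ → E} {u : ℝ → ℝ} (hxc : ContinuousOn x (Set.Icc 0 T))
    (hx : ∀ t ∈ Set.Ico 0 T, HasDerivWithinAt x (A (x t) + u t • b) (Set.Ici t) t)
    (hu : ∀ t ∈ Set.Ico 0 T, |u t| ≤ κ * (β * ‖x t‖)) {t : ℝ} (ht : t ∈ Set.Icc 0 T) :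
    ‖x t - linearFlow A t (x 0)‖ ≤
      κ * (β * ‖b‖ * Real.exp ((‖A‖ + β * ‖b‖ + 1) * T) ^ 2 * ‖x 0‖) := by
  set K : ℝ := ‖A‖ + β * ‖b‖ + 1 with hK
  have hK1 : 1 ≤ K := by
    have : 0 ≤ β * ‖b‖ := by positivity
    linarith [norm_nonneg A]
  have h := norm_le_gronwallBound_of_norm_deriv_right_le
    (f := fun t => x t - linearFlow A t (x 0))
    (f' := fun t => A (x t) + u t • b - A (linearFlow A t (x 0))) (δ := 0) (K := K)
    (ε := κ * (β * (Real.exp (K * T) * ‖x 0‖)) * ‖b‖) (a := 0) (b := T)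
    (hxc.sub (continuous_linearFlow_time A (x 0)).continuousOn)
    (fun t ht => (hx t ht).sub (hasDerivAt_linearFlow A t (x 0)).hasDerivWithinAt)
    (by simp [linearFlow_zero]) (fun t ht => by
      have h1 : A (x t) + u t • b - A (linearFlow A t (x 0)) =
          A (x t - linearFlow A t (x 0)) + u t • b := by
        rw [map_sub]
        abel
      rw [h1]
      refine (norm_add_le _ _).trans ?_
      rw [norm_smul, Real.norm_eq_abs]
      have h2 := A.le_opNorm (x t - linearFlow A t (x 0))
      have h3 : ‖A‖ * ‖x t - linearFlow A t (x 0)‖ ≤ K * ‖x t - linearFlow A t (x 0)‖ := by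
        refine mul_le_mul_of_nonneg_right ?_ (norm_nonneg _)
        have : 0 ≤ β * ‖b‖ := by positivity
        linarith
      have h4 : |u t| ≤ κ * (β * (Real.exp (K * T) * ‖x 0‖)) := by
        refine (hu t ht).trans ?_
        gcongr
        exact norm_le_of_small_input hβ hκ hxc hx hu ⟨ht.1, ht.2.le⟩
      exact add_le_add (h2.trans h3) (mul_le_mul_of_nonneg_right h4 (norm_nonneg b))) t ht
  have hT : 0 ≤ T := ht.1.trans ht.2
  rw [sub_zero, gronwallBound_of_K_ne_0 (by linarith)] at h
  simp only [zero_mul, zero_add] at h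
  refine h.trans ?_
  set ε := κ * (β * (Real.exp (K * T) * ‖x 0‖)) * ‖b‖ with hε
  have hε0 : 0 ≤ ε := by positivity
  have h5 : Real.exp (K * t) - 1 ≤ Real.exp (K * T) := by
    have : Real.exp (K * t) ≤ Real.exp (K * T) :=
      Real.exp_le_exp.2 (mul_le_mul_of_nonneg_left ht.2 (by linarith))
    linarith
  calc ε / K * (Real.exp (K * t) - 1) ≤ ε / K * Real.exp (K * T) :=
        mul_le_mul_of_nonneg_left h5 (by positivity)
    _ ≤ ε * Real.exp (K * T) :=
        mul_le_mul_of_nonneg_right (div_le_self hε0 hK1) (Real.exp_pos _).le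
    _ = _ := by rw [hε]; ring

/-- The lower bound on the dissipation persists for small inputs. -/
theorem exists_dissipation_lower_bound_of_small_input {A : E →L[ℝ] E} (b : E) {c : E →L[ℝ] ℝ}
    {P : E →L[ℝ] E →L[ℝ] ℝ} {N : E →L[ℝ] F} (hsym : ∀ x z, P x z = P z x)
    (hpos : ∀ x, x ≠ 0 → 0 < P x x) (hloss : ∀ x, N x = 0 → P x (A x) = 0)
    (hinj : ∀ x, A x = 0 → x = 0) (hobs : ∀ x, (∀ i : ℕ, c ((A ^ i) x) = 0) → x = 0) :
    ∃ T d M R : ℝ, 0 < T ∧ 0 < d ∧ 0 < M ∧ 0 ≤ R ∧ ∀ κ : ℝ, 0 ≤ κ → κ ≤ 1 →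
      ∀ (x : ℝ → E) (u ξ : ℝ → ℝ), ContinuousOn x (Set.Icc 0 T) →
        (∀ t ∈ Set.Ico 0 T, HasDerivWithinAt x (A (x t) + u t • b) (Set.Ici t) t) →
        (∀ t ∈ Set.Ico 0 T, |u t| ≤ κ * (‖c‖ * ‖x t‖)) →
        IsReflected (fun t => c (x t)) ξ 0 T →
        (∀ t ∈ Set.Icc 0 T, ‖x t‖ ≤ M * ‖x 0‖) ∧
        (d - κ * R) * ‖x 0‖ ^ 2 ≤
          ∫ t in (0 : ℝ)..T, (‖N (x t)‖ ^ 2 + (|c (x t)| - ξ t) * ξ t) := by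
  obtain ⟨T, hT, d, hd, hlow⟩ := exists_dissipation_lower_bound hsym hpos hloss hinj hobs
  set M : ℝ := Real.exp ((‖A‖ + ‖c‖ * ‖b‖ + 1) * T) with hM
  have hM0 : 0 < M := Real.exp_pos _
  set m : ℝ := ‖c‖ * ‖b‖ * M ^ 2 with hm
  have hm0 : 0 ≤ m := by positivity
  -- A pointwise error constant. The first term comes from the difference of the squares of N, the
  -- second from the reflected product, where 4 + 3 T = 1 + 3 (1 + T). Integration over the window
  -- gives T R.
  set R : ℝ := ‖N‖ ^ 2 * m * (2 * M) + (4 + 3 * T) * (‖c‖ ^ 2 * m * M) with hR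
  have hR0 : 0 ≤ R := by positivity
  refine ⟨T, d, M, T * R, hT, hd, hM0, by positivity, fun κ hκ0 hκ x u ξ hxc hx hu hξ => ?_⟩
  have hxM : ∀ t ∈ Set.Icc 0 T, ‖x t‖ ≤ M * ‖x 0‖ := fun t ht =>
    norm_le_of_small_input (norm_nonneg c) hκ hxc hx hu ht
  refine ⟨hxM, ?_⟩
  set φ : ℝ → E := fun t => linearFlow A t (x 0) with hφ
  have hφc : Continuous φ := continuous_linearFlow_time A (x 0)
  have hφ0 : φ 0 = x 0 := linearFlow_zero A (x 0)
  have hφM : ∀ t ∈ Set.Icc 0 T, ‖φ t‖ ≤ M * ‖x 0‖ := fun t ht => by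
    have := norm_le_of_small_input (A := A) (b := b) (x := φ) (u := fun _ => 0) (T := T)
      (norm_nonneg c) hκ hφc.continuousOn
      (fun t _ => by simpa using (hasDerivAt_linearFlow A t (x 0)).hasDerivWithinAt)
      (fun t _ => by simp only [abs_zero]; positivity) ht
    rwa [hφ0] at this
  have hdiff : ∀ t ∈ Set.Icc 0 T, ‖x t - φ t‖ ≤ κ * (m * ‖x 0‖) := fun t ht => by
    simpa only [hm, hM] using norm_sub_linearFlow_le (norm_nonneg c) hκ0 hκ hxc hx hu ht
  set δ : ℝ := ‖c‖ * (κ * (m * ‖x 0‖)) with hδ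
  have hδ0 : 0 ≤ δ := by positivity
  have hyδ : ∀ t ∈ Set.Icc 0 T, |c (x t) - c (φ t)| ≤ δ := fun t ht => by
    rw [← map_sub]
    exact (c.le_opNorm _).trans (mul_le_mul_of_nonneg_left (hdiff t ht) (norm_nonneg c))
  have h0T : (0 : ℝ) ∈ Set.Icc 0 T := ⟨le_rfl, hT.le⟩
  have hw0 := hξ.nonneg 0 h0T
  have hwc : ξ 0 ≤ |c (φ 0)| := by
    rw [hφ0]
    exact hξ.le_abs 0 h0T
  have hcφ : Continuous fun t => c (φ t) := c.continuous.comp hφc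
  -- The free-flow counterpart of ξ, started at the same value; comparison of reflected states
  -- passes on the output error δ with a factor 1 + T.
  set η : ℝ → ℝ := reflectedState (fun t => c (φ t)) (ξ 0) with hη
  have hηR : IsReflected (fun t => c (φ t)) η 0 T := isReflected_reflectedState hcφ hw0 hwc T
  have hη0 : η 0 = ξ 0 := reflectedState_zero hwc
  have hQ : ∀ t ∈ Set.Icc 0 T, ∀ r ∈ Set.Icc 0 t, δ + (∫ _ in r..t, δ) ≤ δ * (1 + T) := by
    intro t ht r hr
    rw [intervalIntegral.integral_const, smul_eq_mul]
    nlinarith [hr.1, ht.2]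
  have hξη : ∀ t ∈ Set.Icc 0 T, |η t - ξ t| ≤ δ * (1 + T) := by
    intro t ht
    have hsub : ∀ r ∈ Set.Icc 0 t, r ∈ Set.Icc 0 T := fun r hr => ⟨hr.1, hr.2.trans ht.2⟩
    have h1 := hξ.le_add hηR hη0.le (D := fun _ => δ) continuous_const (fun _ => hδ0) ht
      (fun r hr => by
        have := abs_sub_abs_le_abs_sub (c (φ r)) (c (x r))
        rw [abs_sub_comm] at this
        linarith [hyδ r (hsub r hr)]) (hQ t ht)
    have h2 := hηR.le_add hξ hη0.ge (D := fun _ => δ) continuous_const (fun _ => hδ0) ht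
      (fun r hr => by
        have := abs_sub_abs_le_abs_sub (c (x r)) (c (φ r))
        linarith [hyδ r (hsub r hr)]) (hQ t ht)
    rw [abs_le]
    constructor <;> linarith
  have hpt : ∀ t ∈ Set.Icc 0 T, ‖N (φ t)‖ ^ 2 + (|c (φ t)| - η t) * η t ≤
      (‖N (x t)‖ ^ 2 + (|c (x t)| - ξ t) * ξ t) + κ * R * ‖x 0‖ ^ 2 := by
    intro t ht
    set X := ‖x 0‖ with hX
    have hX0 : 0 ≤ X := norm_nonneg _
    have n1 : ‖N (φ t)‖ ≤ ‖N‖ * (M * X) :=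
      (N.le_opNorm _).trans (mul_le_mul_of_nonneg_left (hφM t ht) (norm_nonneg N))
    have n2 : ‖N (x t)‖ ≤ ‖N‖ * (M * X) :=
      (N.le_opNorm _).trans (mul_le_mul_of_nonneg_left (hxM t ht) (norm_nonneg N))
    have n3 : ‖N (φ t)‖ - ‖N (x t)‖ ≤ ‖N‖ * (κ * (m * X)) := by
      refine (norm_sub_norm_le _ _).trans ?_
      rw [← map_sub, ← norm_neg, ← map_neg, neg_sub]
      exact (N.le_opNorm _).trans (mul_le_mul_of_nonneg_left (hdiff t ht) (norm_nonneg N))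
    have hN : ‖N (φ t)‖ ^ 2 - ‖N (x t)‖ ^ 2 ≤ ‖N‖ * (κ * (m * X)) * (2 * (‖N‖ * (M * X))) := by
      calc ‖N (φ t)‖ ^ 2 - ‖N (x t)‖ ^ 2
          = (‖N (φ t)‖ - ‖N (x t)‖) * (‖N (φ t)‖ + ‖N (x t)‖) := by ring
        _ ≤ ‖N‖ * (κ * (m * X)) * (‖N (φ t)‖ + ‖N (x t)‖) :=
          mul_le_mul_of_nonneg_right n3 (by positivity)
        _ ≤ _ := by
          refine mul_le_mul_of_nonneg_left (by linarith) (by positivity)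
    have y1 : |c (φ t)| ≤ ‖c‖ * (M * X) :=
      (c.le_opNorm _).trans (mul_le_mul_of_nonneg_left (hφM t ht) (norm_nonneg c))
    have y2 : |c (x t)| ≤ ‖c‖ * (M * X) :=
      (c.le_opNorm _).trans (mul_le_mul_of_nonneg_left (hxM t ht) (norm_nonneg c))
    have y3 : |c (φ t)| - |c (x t)| ≤ δ := by
      have := abs_sub_abs_le_abs_sub (c (φ t)) (c (x t))
      rw [abs_sub_comm] at this
      exact this.trans (hyδ t ht)
    have e1 := hηR.le_abs t ht
    have e2 := hξ.le_abs t ht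
    have e3 := hηR.nonneg t ht
    have e4 := hξ.nonneg t ht
    have e5 := abs_le.1 (hξη t ht)
    set Z : ℝ := ‖c‖ * (M * X) with hZ
    have hZ0 : 0 ≤ Z := by positivity
    have hδT : 0 ≤ δ * (1 + T) := by positivity
    have hcross : (|c (φ t)| - η t) * η t - (|c (x t)| - ξ t) * ξ t ≤
        δ * Z + 3 * (δ * (1 + T) * Z) := by
      have a1 : (|c (φ t)| - |c (x t)|) * η t ≤ δ * Z :=
        (mul_le_mul_of_nonneg_right y3 e3).trans (mul_le_mul_of_nonneg_left (e1.trans y1) hδ0)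
      have a2 : |c (x t)| * (η t - ξ t) ≤ δ * (1 + T) * Z := by
        rw [mul_comm]
        exact (mul_le_mul_of_nonneg_right e5.2 (abs_nonneg _)).trans
          (mul_le_mul_of_nonneg_left y2 hδT)
      have a3 : (ξ t - η t) * (η t + ξ t) ≤ δ * (1 + T) * (2 * Z) :=
        (mul_le_mul_of_nonneg_right (by linarith) (by linarith)).trans
          (mul_le_mul_of_nonneg_left (by linarith) hδT)
      calc (|c (φ t)| - η t) * η t - (|c (x t)| - ξ t) * ξ t
          = (|c (φ t)| - |c (x t)|) * η t + |c (x t)| * (η t - ξ t) +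
              (ξ t - η t) * (η t + ξ t) := by ring
        _ ≤ δ * Z + δ * (1 + T) * Z + δ * (1 + T) * (2 * Z) := by linarith
        _ = _ := by ring
    have hfin : ‖N‖ * (κ * (m * X)) * (2 * (‖N‖ * (M * X))) + (δ * Z + 3 * (δ * (1 + T) * Z)) =
        κ * R * X ^ 2 := by
      rw [hR, hδ, hZ]
      ring
    linarith
  have hl := hlow (x 0) η hηR
  have hηc := hηR.continuousOn_state
  have hξc := hξ.continuousOn_state
  have hcx : ContinuousOn (fun t => c (x t)) (Set.Icc 0 T) := hξ.continuousOn_input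
  have hi1 : IntervalIntegrable (fun t => ‖N (φ t)‖ ^ 2 + (|c (φ t)| - η t) * η t) volume 0 T := by
    apply ContinuousOn.intervalIntegrable
    rw [Set.uIcc_of_le hT.le]
    exact ((N.continuous.comp hφc).norm.pow 2).continuousOn.add
      ((hcφ.abs.continuousOn.sub hηc).mul hηc)
  have hi2 : IntervalIntegrable (fun t => ‖N (x t)‖ ^ 2 + (|c (x t)| - ξ t) * ξ t) volume 0 T := by
    apply ContinuousOn.intervalIntegrable
    rw [Set.uIcc_of_le hT.le]
    exact ((N.continuous.comp_continuousOn hxc).norm.pow 2).add ((hcx.abs.sub hξc).mul hξc)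
  have hmono := intervalIntegral.integral_mono_on hT.le hi1
    (hi2.add (intervalIntegrable_const (c := κ * R * ‖x 0‖ ^ 2))) hpt
  rw [intervalIntegral.integral_add hi2 intervalIntegrable_const, intervalIntegral.integral_const,
    smul_eq_mul, sub_zero] at hmono
  have : (d - κ * (T * R)) * ‖x 0‖ ^ 2 = d * ‖x 0‖ ^ 2 - T * (κ * R * ‖x 0‖ ^ 2) := by ring
  rw [this]
  linarith

end Perturbation

/-! ## The Lyapunov function of the closed loop -/

section Lyapunov

variable {E F : Type*} [NormedAddCommGroup E] [NormedSpace ℝ E]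
  [NormedAddCommGroup F] [NormedSpace ℝ F] [FiniteDimensional ℝ F]

/-- The Lyapunov function of the closed loop, with second gain `κ`. -/
def cascadeEnergy (P : E →L[ℝ] E →L[ℝ] ℝ) (c : E →L[ℝ] ℝ) (κ : ℝ) (x : E) (v : ℝ) : ℝ :=
  P x x + (κ⁻¹ * (v * v) - 2 * (c x * v))

/-- The cascade of the two hybrid integrator-gain systems dissipates the supply rate `y v'` at
least at the rate `κ (|y| - |p|) |p|`. -/
theorem cascade_supply_ge {h1 : (0 : ℝ) < 1} {κ : ℝ} {hκ : 0 < κ} {y p v : ℝ → ℝ}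
    (hs1 : (HIGS.balanced 1 h1).IsSolution y p) (hs2 : (HIGS.balanced κ hκ).IsSolution p v) :
    ∀ᵐ t : ℝ, 0 ≤ t → ∃ y' v' : ℝ, HasDerivAt y y' t ∧ HasDerivAt v v' t ∧
      κ * ((|y t| - |p t|) * |p t|) ≤ (y t - κ⁻¹ * v t) * v' := by
  filter_upwards [hs1.ae_modes, hs2.ae_modes] with t hm1 hm2 ht
  obtain ⟨y', p', hy', hp', -, hor1⟩ := hm1 ht
  obtain ⟨p'', v', hp'', hv', -, hor2⟩ := hm2 ht
  have hpp : p'' = p' := hp''.unique hp'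
  subst hpp
  refine ⟨y', v', hy', hv', ?_⟩
  have hyp : y t * p t = |y t| * |p t| := by
    rw [← abs_mul, abs_of_nonneg (hs1.input_mul_nonneg ht)]
  have hpsq : p t * p t = |p t| * |p t| := (abs_mul_abs_self _).symm
  have hle : |p t| ≤ |y t| := by simpa using hs1.abs_le ht
  -- If `H₂` integrates, v' = κ p and |v| ≤ κ |p|. If it is in gain mode, v = κ p and the product is
  -- κ (y - p) p'. Then either p' = y, which gives κ (|y| - |p|) |y|, or p = y and both sides
  -- vanish.
  rcases hor2 with h2 | ⟨h2, h3, -⟩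
  · have hv : κ⁻¹ * v t * p t ≤ |p t| * |p t| := by
      have h4 : |κ⁻¹ * v t| ≤ |p t| := by
        rw [abs_mul, abs_of_pos (inv_pos.2 hκ), inv_mul_le_iff₀ hκ]
        exact hs2.abs_le ht
      calc κ⁻¹ * v t * p t ≤ |κ⁻¹ * v t * p t| := le_abs_self _
        _ = |κ⁻¹ * v t| * |p t| := abs_mul _ _
        _ ≤ _ := mul_le_mul_of_nonneg_right h4 (abs_nonneg _)
    have : κ * ((|y t| - |p t|) * |p t|) ≤ κ * ((y t - κ⁻¹ * v t) * p t) := by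
      refine mul_le_mul_of_nonneg_left ?_ hκ.le
      rw [sub_mul, sub_mul, hyp]
      linarith
    rw [h2]
    linarith
  · have hv : κ⁻¹ * v t = p t := by rw [h2, inv_mul_cancel_left₀ hκ.ne']
    rw [hv, h3]
    rcases hor1 with h4 | ⟨h4, -, -⟩
    · rw [one_mul] at h4
      rw [h4]
      have h5 : (|y t| - |p t|) * |p t| ≤ (|y t| - |p t|) * |y t| :=
        mul_le_mul_of_nonneg_left hle (by linarith)
      have h6 : (|y t| - |p t|) * |y t| = (y t - p t) * y t := by
        rw [sub_mul, sub_mul, abs_mul_abs_self, mul_comm (|p t|), ← hyp]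
        ring
      have := mul_le_mul_of_nonneg_left (h5.trans h6.le) hκ.le
      linarith
    · rw [one_mul] at h4
      rw [h4]
      simp

/-- The energy balance of the closed loop. -/
theorem exists_cascadeEnergy_sub_le {A : E →L[ℝ] E} (b : E) {c : E →L[ℝ] ℝ}
    {P : E →L[ℝ] E →L[ℝ] ℝ} {N : E →L[ℝ] F} (hsym : ∀ x z, P x z = P z x)
    (hdec : ∀ x, 2 * P x (A x) ≤ -‖N x‖ ^ 2) (hker : ∀ x, N x = 0 → P b x = c (A x)) :
    ∃ C : ℝ, 0 ≤ C ∧ ∀ (h1 : (0 : ℝ) < 1) (κ : ℝ) (hκ : 0 < κ), κ ≤ 1 / 4 →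
      ∀ (x : ℝ → E) (p v : ℝ → ℝ),
        (∀ t, 0 ≤ t → HasDerivWithinAt x (A (x t) + v t • b) (Set.Ici 0) t) →
        (HIGS.balanced 1 h1).IsSolution (fun t => c (x t)) p →
        (HIGS.balanced κ hκ).IsSolution p v →
        ∀ s t, 0 ≤ s → s ≤ t →
          cascadeEnergy P c κ (x t) (v t) - cascadeEnergy P c κ (x s) (v s) ≤
            ∫ r in s..t, (C * κ ^ 2 * ‖x r‖ ^ 2 -
              2 * κ * (‖N (x r)‖ ^ 2 + (|c (x r)| - |p r|) * |p r|)) := by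
  -- The mismatch functional vanishes on ker N, so it factors through N and is bounded by a multiple
  -- of ‖N x‖.
  obtain ⟨ψ, hψ⟩ : ∃ ψ : F →ₗ[ℝ] ℝ, ∀ x, ψ (N x) = P b x - c (A x) := by
    have hmem : ((P b - c.comp A : E →L[ℝ] ℝ) : E →ₗ[ℝ] ℝ) ∈
        (LinearMap.ker (N : E →ₗ[ℝ] F)).dualAnnihilator := by
      rw [Submodule.mem_dualAnnihilator]
      intro x hx
      have := hker x hx
      simp [this]
    rw [← LinearMap.range_dualMap_eq_dualAnnihilator_ker] at hmem
    obtain ⟨ψ, hψ⟩ := hmem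
    exact ⟨ψ, fun x => LinearMap.congr_fun hψ x⟩
  set q : ℝ := ‖LinearMap.toContinuousLinearMap ψ‖ with hq
  have hψle : ∀ x, |P b x - c (A x)| ≤ q * ‖N x‖ := fun x => by
    rw [← hψ]
    exact (LinearMap.toContinuousLinearMap ψ).le_opNorm (N x)
  have hq0 : 0 ≤ q := norm_nonneg _
  -- The first term is the Young remainder of the mismatch, the second bounds the term c b v² that
  -- y' contributes.
  refine ⟨2 * (‖c‖ * q) ^ 2 + 2 * |c b| * ‖c‖ ^ 2, by positivity,
    fun h1 κ hκ hκ4 x p v hx hs1 hs2 s t hs hst => ?_⟩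
  have hxd : ∀ r, 0 < r → HasDerivAt x (A (x r) + v r • b) r := fun r hr =>
    (hx r hr.le).hasDerivAt (Ici_mem_nhds hr)
  have hxc : ContinuousOn x (Set.Icc s t) := fun r hr =>
    (hx r (hs.trans hr.1)).continuousWithinAt.mono fun q hq => hs.trans hq.1
  have hsub : Set.Icc s t ⊆ Set.Ici 0 := fun r hr => hs.trans hr.1
  have hvc : ContinuousOn v (Set.Icc s t) := hs2.state_ac.continuousOn.mono hsub
  have hpc : ContinuousOn p (Set.Icc s t) := hs1.state_ac.continuousOn.mono hsub
  have hyc : ContinuousOn (fun r => c (x r)) (Set.Icc s t) := c.continuous.comp_continuousOn hxc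
  have hx'c : ContinuousOn (fun r => A (x r) + v r • b) (Set.Icc s t) :=
    (A.continuous.comp_continuousOn hxc).add (hvc.smul continuousOn_const)
  have hplant : ∫ r in s..t, 2 * P (x r) (A (x r) + v r • b) = P (x t) (x t) - P (x s) (x s) := by
    refine intervalIntegral.integral_eq_sub_of_hasDerivAt_of_le (f := fun r => P (x r) (x r)) hst
      ((P.continuous.comp_continuousOn hxc).clm_apply hxc) (fun r hr => ?_) ?_
    · have h := hxd r (hs.trans_lt hr.1)
      refine ((P.hasFDerivAt.comp_hasDerivAt r h).clm_apply h).congr_deriv ?_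
      rw [hsym (A (x r) + v r • b) (x r), Function.comp_apply]
      ring
    · apply ContinuousOn.intervalIntegrable
      rw [Set.uIcc_of_le hst]
      exact continuousOn_const.mul ((P.continuous.comp_continuousOn hxc).clm_apply hx'c)
  set g : ℝ → ℝ := fun r => -(2 * κ * ((|c (x r)| - |p r|) * |p r|)) -
    2 * (c (A (x r) + v r • b) * v r) with hg
  have hgc : ContinuousOn g (Set.Icc s t) :=
    (continuousOn_const.mul ((hyc.abs.sub hpc.abs).mul hpc.abs)).neg.sub
      (continuousOn_const.mul ((c.continuous.comp_continuousOn hx'c).mul hvc))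
  have hacv := hs2.state_ac.on hs hst
  have hacy := hs1.input_ac.on hs hst
  have hctrl := (((hacv.fun_mul hacv).const_mul κ⁻¹).fun_sub
    ((hacy.fun_mul hacv).const_mul 2)).sub_le_integral hst hgc (by
      filter_upwards [cascade_supply_ge hs1 hs2] with r hr hrI f' hf'
      have hr0 : 0 < r := hs.trans_lt hrI.1
      obtain ⟨y', v', hy', hv', hle⟩ := hr hr0.le
      have hy'' : y' = c (A (x r) + v r • b) :=
        hy'.unique (c.hasFDerivAt.comp_hasDerivAt r (hxd r hr0))
      have hd := ((hv'.fun_mul hv').const_mul κ⁻¹).fun_sub ((hy'.fun_mul hv').const_mul 2)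
      rw [hf'.unique hd]
      simp only [hg]
      rw [← hy'']
      linear_combination 2 * hle)
  have hi1 : IntervalIntegrable (fun r => 2 * P (x r) (A (x r) + v r • b)) volume s t := by
    apply ContinuousOn.intervalIntegrable
    rw [Set.uIcc_of_le hst]
    exact continuousOn_const.mul ((P.continuous.comp_continuousOn hxc).clm_apply hx'c)
  have hi2 : IntervalIntegrable g volume s t := by
    apply ContinuousOn.intervalIntegrable
    rwa [Set.uIcc_of_le hst]
  have hsum : cascadeEnergy P c κ (x t) (v t) - cascadeEnergy P c κ (x s) (v s) ≤
      ∫ r in s..t, (2 * P (x r) (A (x r) + v r • b) + g r) := by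
    rw [intervalIntegral.integral_add hi1 hi2, hplant]
    simp only [cascadeEnergy]
    linarith
  refine hsum.trans (intervalIntegral.integral_mono_on hst (hi1.add hi2) ?_ fun r hr => ?_)
  · apply ContinuousOn.intervalIntegrable
    rw [Set.uIcc_of_le hst]
    exact (continuousOn_const.mul (hxc.norm.pow 2)).sub (continuousOn_const.mul
      (((N.continuous.comp_continuousOn hxc).norm.pow 2).add
        ((hyc.abs.sub hpc.abs).mul hpc.abs)))
  · have hr0 : 0 ≤ r := hs.trans hr.1
    have hv : |v r| ≤ κ * (‖c‖ * ‖x r‖) := by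
      refine (hs2.abs_le hr0).trans (mul_le_mul_of_nonneg_left ?_ hκ.le)
      have := hs1.abs_le hr0
      rw [one_mul] at this
      exact this.trans (c.le_opNorm _)
    have hψr := hψle (x r)
    have hmain : 2 * v r * (P b (x r) - c (A (x r))) ≤
        ‖N (x r)‖ ^ 2 / 2 + 2 * κ ^ 2 * (‖c‖ * q) ^ 2 * ‖x r‖ ^ 2 := by
      have h2 : v r * (P b (x r) - c (A (x r))) ≤
          κ * (‖c‖ * ‖x r‖) * (q * ‖N (x r)‖) := by
        refine (le_abs_self _).trans ?_
        rw [abs_mul]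
        exact mul_le_mul hv hψr (abs_nonneg _) (by positivity)
      nlinarith [sq_nonneg (‖N (x r)‖ - 2 * (κ * (‖c‖ * q) * ‖x r‖))]
    have hfeed : -(2 * (c b * (v r * v r))) ≤ 2 * |c b| * ‖c‖ ^ 2 * κ ^ 2 * ‖x r‖ ^ 2 := by
      have h2 : v r * v r ≤ (κ * (‖c‖ * ‖x r‖)) ^ 2 := by
        rw [← abs_mul_abs_self, ← sq]
        gcongr
      have h3 : -(c b * (v r * v r)) ≤ |c b| * (v r * v r) := by
        rw [← neg_mul]
        exact mul_le_mul_of_nonneg_right (neg_le_abs _) (mul_self_nonneg _)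
      have h4 : |c b| * (v r * v r) ≤ |c b| * (κ * (‖c‖ * ‖x r‖)) ^ 2 :=
        mul_le_mul_of_nonneg_left h2 (abs_nonneg _)
      nlinarith
    -- Half of the plant dissipation was spent on the mismatch; for κ ≤ 1/4 the other half covers 2κ
    -- ‖N x‖².
    have hN : 2 * κ * ‖N (x r)‖ ^ 2 ≤ ‖N (x r)‖ ^ 2 / 2 := by
      nlinarith [sq_nonneg ‖N (x r)‖]
    have hd := hdec (x r)
    simp only [hg, map_add, map_smul, smul_eq_mul]
    rw [hsym (x r) b]
    linarith

end Lyapunov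

/-! ## Exponential decay of the closed loop -/

section Decay

variable {E F : Type*} [NormedAddCommGroup E] [NormedSpace ℝ E] [FiniteDimensional ℝ E]
  [NormedAddCommGroup F] [NormedSpace ℝ F] [FiniteDimensional ℝ F]

/-- For a small second gain the energy of the closed loop is positive definite and contracts over
time windows of a fixed length. -/
theorem exists_cascadeEnergy_contraction {A : E →L[ℝ] E} (b : E) {c : E →L[ℝ] ℝ}
    {P : E →L[ℝ] E →L[ℝ] ℝ} {N : E →L[ℝ] F} (hsym : ∀ x z, P x z = P z x)
    (hpos : ∀ x, x ≠ 0 → 0 < P x x) (hdec : ∀ x, 2 * P x (A x) ≤ -‖N x‖ ^ 2)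
    (hloss : ∀ x, N x = 0 → P x (A x) = 0) (hker : ∀ x, N x = 0 → P b x = c (A x))
    (hinj : ∀ x, A x = 0 → x = 0) (hobs : ∀ x, (∀ i : ℕ, c ((A ^ i) x) = 0) → x = 0) :
    ∃ (κ : ℝ) (hκ : 0 < κ) (T M m L ρ : ℝ), κ ≤ 1 ∧ 0 < T ∧ 0 < M ∧ 0 < m ∧ 0 < L ∧ 0 ≤ ρ ∧
      ρ < 1 ∧ ∀ (h1 : (0 : ℝ) < 1) (x : ℝ → E) (p v : ℝ → ℝ),
        (∀ t, 0 ≤ t → HasDerivWithinAt x (A (x t) + v t • b) (Set.Ici 0) t) →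
        (HIGS.balanced 1 h1).IsSolution (fun t => c (x t)) p →
        (HIGS.balanced κ hκ).IsSolution p v →
        ∀ t, 0 ≤ t → m * ‖x t‖ ^ 2 ≤ cascadeEnergy P c κ (x t) (v t) ∧
          cascadeEnergy P c κ (x t) (v t) ≤ L * ‖x t‖ ^ 2 ∧
          (∀ s ∈ Set.Icc 0 T, ‖x (t + s)‖ ≤ M * ‖x t‖) ∧
          cascadeEnergy P c κ (x (t + T)) (v (t + T)) ≤
            ρ * cascadeEnergy P c κ (x t) (v t) := by
  obtain ⟨T, d, M, R, hT, hd, hM, hR, hlow⟩ :=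
    exists_dissipation_lower_bound_of_small_input b hsym hpos hloss hinj hobs
  obtain ⟨C, hC, hbal⟩ := exists_cascadeEnergy_sub_le b hsym hdec hker
  obtain ⟨p₀, hp₀, hPlow⟩ := exists_pos_mul_norm_pow_le (f := fun x => P x x) (k := 2)
    (P.continuous.clm_apply continuous_id)
    (fun r _ x => by simp only [map_smul, _root_.smul_apply, smul_eq_mul]; ring)
    (by simp) two_ne_zero hpos
  set β : ℝ := ‖c‖ with hβ
  have hβ0 : 0 ≤ β := norm_nonneg c
  set S : ℝ := 2 * R + C * T * M ^ 2 with hS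
  have hS0 : 0 ≤ S := by positivity
  -- With κ = 1/D the three summands give κ ≤ 1/4 for the energy balance, 4 κ β² ≤ p₀ for positive
  -- definiteness, and κ S ≤ d so that the O(κ²) errors use up at most half of the dissipation 2 κ d
  -- ‖x‖².
  set D : ℝ := 4 + 4 * β ^ 2 / p₀ + S / d with hD
  have hD1 : 0 ≤ 4 * β ^ 2 / p₀ := by positivity
  have hD2 : 0 ≤ S / d := by positivity
  have hD0 : 0 < D := by positivity
  set κ : ℝ := D⁻¹ with hκdef
  have hκ : 0 < κ := inv_pos.2 hD0
  have hκD : κ * D = 1 := inv_mul_cancel₀ hD0.ne'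
  have hκ4 : κ ≤ 1 / 4 := by nlinarith
  have hκ1 : κ ≤ 1 := by linarith
  have hκp : κ * (4 * β ^ 2) ≤ p₀ := by
    have h : κ * (4 * β ^ 2 / p₀) ≤ 1 := by nlinarith
    rwa [← mul_div_assoc, div_le_one hp₀] at h
  have hκS : κ * S ≤ d := by
    have h : κ * (S / d) ≤ 1 := by nlinarith
    rwa [← mul_div_assoc, div_le_one hd] at h
  -- The summand d is not needed for the upper bound; it makes L positive and gives κ d ≤ L, so that
  -- the contraction factor is nonnegative.
  set L : ℝ := ‖P‖ + 3 * β ^ 2 + d with hL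
  have hL0 : 0 < L := by positivity
  have hκL : κ * d ≤ L := by
    have : 0 ≤ ‖P‖ + 3 * β ^ 2 := by positivity
    nlinarith
  refine ⟨κ, hκ, T, M, p₀ / 2, L, 1 - κ * d / L, hκ1, hT, hM, by positivity, hL0,
    sub_nonneg.2 ((div_le_one hL0).2 hκL), by
      have : 0 < κ * d / L := by positivity
      linarith, fun h1 x p v hx hs1 hs2 t ht => ?_⟩
  have hple : ∀ r, 0 ≤ r → |p r| ≤ β * ‖x r‖ := fun r hr => by
    have := hs1.abs_le hr
    rw [one_mul] at this
    exact this.trans (c.le_opNorm (x r))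
  have hvle : ∀ r, 0 ≤ r → |v r| ≤ κ * (β * ‖x r‖) := fun r hr =>
    (hs2.abs_le hr).trans (mul_le_mul_of_nonneg_left (hple r hr) hκ.le)
  have hyv : |c (x t) * v t| ≤ κ * β ^ 2 * ‖x t‖ ^ 2 := by
    rw [abs_mul]
    calc |c (x t)| * |v t| ≤ (β * ‖x t‖) * (κ * (β * ‖x t‖)) :=
          mul_le_mul (c.le_opNorm (x t)) (hvle t ht) (abs_nonneg _) (by positivity)
      _ = _ := by ring
  have hvv : κ⁻¹ * (v t * v t) ≤ κ * β ^ 2 * ‖x t‖ ^ 2 := by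
    rw [inv_mul_le_iff₀ hκ, ← abs_mul_abs_self]
    calc |v t| * |v t| ≤ κ * (β * ‖x t‖) * (κ * (β * ‖x t‖)) :=
          mul_le_mul (hvle t ht) (hvle t ht) (abs_nonneg _) (by positivity)
      _ = _ := by ring
  have hvv0 : 0 ≤ κ⁻¹ * (v t * v t) := mul_nonneg (inv_pos.2 hκ).le (mul_self_nonneg _)
  have hyv' := abs_le.1 hyv
  have hlower : p₀ / 2 * ‖x t‖ ^ 2 ≤ cascadeEnergy P c κ (x t) (v t) := by
    have e1 := hPlow (x t)
    have e2 := mul_le_mul_of_nonneg_right hκp (sq_nonneg ‖x t‖)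
    simp only [cascadeEnergy]
    linarith
  have hupper : cascadeEnergy P c κ (x t) (v t) ≤ L * ‖x t‖ ^ 2 := by
    have e1 : P (x t) (x t) ≤ ‖P‖ * ‖x t‖ ^ 2 := by
      rw [sq, ← mul_assoc]
      exact (le_abs_self _).trans (P.le_opNorm₂ (x t) (x t))
    have e2 : κ * (β ^ 2 * ‖x t‖ ^ 2) ≤ β ^ 2 * ‖x t‖ ^ 2 :=
      mul_le_of_le_one_left (by positivity) hκ1
    have e3 : 0 ≤ d * ‖x t‖ ^ 2 := by positivity
    simp only [cascadeEnergy, hL]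
    linarith
  have hmem : ∀ r ∈ Set.Icc 0 T, 0 ≤ t + r := fun r hr => add_nonneg ht hr.1
  have hxc0 : ContinuousOn x (Set.Ici 0) := fun r hr => (hx r hr).continuousWithinAt
  have hxc : ContinuousOn (fun r => x (t + r)) (Set.Icc 0 T) :=
    hxc0.comp (by fun_prop) fun r hr => hmem r hr
  have hξ : IsReflected (fun r => c (x (t + r))) (fun r => |p (t + r)|) 0 T := by
    have := (hs1.isReflected (b := t + T) ht).shift (c := t)
    rwa [sub_self, add_sub_cancel_left] at this
  obtain ⟨hxM, hint⟩ := hlow κ hκ.le hκ1 (fun r => x (t + r)) (fun r => v (t + r))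
    (fun r => |p (t + r)|) hxc (fun r hr => by
      have h := hx (t + r) (hmem r ⟨hr.1, hr.2.le⟩)
      have h2 : HasDerivWithinAt (fun q => t + q) 1 (Set.Ici r) r :=
        (hasDerivWithinAt_id r _).const_add t
      have := h.scomp r h2 (fun q hq => add_nonneg ht (hr.1.trans hq))
      rwa [one_smul] at this)
    (fun r hr => hvle _ (hmem r ⟨hr.1, hr.2.le⟩)) hξ
  simp only [add_zero] at hxM hint
  refine ⟨hlower, hupper, hxM, ?_⟩
  have hb := hbal h1 κ hκ hκ4 x p v hx hs1 hs2 t (t + T) ht (by linarith)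
  have hchange := intervalIntegral.integral_comp_add_left (a := 0) (b := T)
    (fun r => C * κ ^ 2 * ‖x r‖ ^ 2 -
      2 * κ * (‖N (x r)‖ ^ 2 + (|c (x r)| - |p r|) * |p r|)) t
  rw [add_zero] at hchange
  rw [← hchange] at hb
  have hi1 : IntervalIntegrable (fun r => C * κ ^ 2 * ‖x (t + r)‖ ^ 2) volume 0 T := by
    apply ContinuousOn.intervalIntegrable
    rw [Set.uIcc_of_le hT.le]
    exact continuousOn_const.mul (hxc.norm.pow 2)
  have hi2 : IntervalIntegrable (fun r => ‖N (x (t + r))‖ ^ 2 +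
      (|c (x (t + r))| - |p (t + r)|) * |p (t + r)|) volume 0 T := by
    apply ContinuousOn.intervalIntegrable
    rw [Set.uIcc_of_le hT.le]
    exact ((N.continuous.comp_continuousOn hxc).norm.pow 2).add
      ((hξ.continuousOn_input.abs.sub hξ.continuousOn_state).mul hξ.continuousOn_state)
  rw [intervalIntegral.integral_sub hi1 (hi2.const_mul _),
    intervalIntegral.integral_const_mul (2 * κ)] at hb
  have hfirst : ∫ r in (0 : ℝ)..T, C * κ ^ 2 * ‖x (t + r)‖ ^ 2 ≤
      T * (C * κ ^ 2 * (M * ‖x t‖) ^ 2) := by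
    refine (intervalIntegral.integral_mono_on hT.le hi1
      (intervalIntegrable_const (c := C * κ ^ 2 * (M * ‖x t‖) ^ 2)) fun r hr => ?_).trans_eq ?_
    · have := hxM r hr
      gcongr
    · rw [intervalIntegral.integral_const, sub_zero, smul_eq_mul]
  have hsecond := mul_le_mul_of_nonneg_left hint (by positivity : 0 ≤ 2 * κ)
  have hdrop : cascadeEnergy P c κ (x (t + T)) (v (t + T)) - cascadeEnergy P c κ (x t) (v t) ≤
      -(κ * d * ‖x t‖ ^ 2) := by
    have h3 := mul_le_mul_of_nonneg_left hκS (by positivity : 0 ≤ κ * ‖x t‖ ^ 2)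
    have h4 : T * (C * κ ^ 2 * (M * ‖x t‖) ^ 2) - 2 * κ * ((d - κ * R) * ‖x t‖ ^ 2) =
        κ * ‖x t‖ ^ 2 * (κ * S) - 2 * (κ * d * ‖x t‖ ^ 2) := by
      rw [hS]
      ring
    linarith
  have hgain : κ * d / L * cascadeEnergy P c κ (x t) (v t) ≤ κ * d * ‖x t‖ ^ 2 := by
    calc κ * d / L * cascadeEnergy P c κ (x t) (v t) ≤ κ * d / L * (L * ‖x t‖ ^ 2) :=
          mul_le_mul_of_nonneg_left hupper (by positivity)
      _ = _ := by field_simp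
  linarith

/-- For a small second gain the plant state decays geometrically. -/
theorem exists_cascade_decay {A : E →L[ℝ] E} (b : E) {c : E →L[ℝ] ℝ}
    {P : E →L[ℝ] E →L[ℝ] ℝ} {N : E →L[ℝ] F} (hsym : ∀ x z, P x z = P z x)
    (hpos : ∀ x, x ≠ 0 → 0 < P x x) (hdec : ∀ x, 2 * P x (A x) ≤ -‖N x‖ ^ 2)
    (hloss : ∀ x, N x = 0 → P x (A x) = 0) (hker : ∀ x, N x = 0 → P b x = c (A x))
    (hinj : ∀ x, A x = 0 → x = 0) (hobs : ∀ x, (∀ i : ℕ, c ((A ^ i) x) = 0) → x = 0) :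
    ∃ (κ : ℝ) (hκ : 0 < κ) (T K ρ : ℝ), κ ≤ 1 ∧ 0 < T ∧ 0 < K ∧ 0 ≤ ρ ∧ ρ < 1 ∧
      ∀ (h1 : (0 : ℝ) < 1) (x : ℝ → E) (p v : ℝ → ℝ),
        (∀ t, 0 ≤ t → HasDerivWithinAt x (A (x t) + v t • b) (Set.Ici 0) t) →
        (HIGS.balanced 1 h1).IsSolution (fun t => c (x t)) p →
        (HIGS.balanced κ hκ).IsSolution p v →
        ∀ t, 0 ≤ t → ‖x t‖ ^ 2 ≤ K * ρ ^ ⌊t / T⌋₊ * ‖x 0‖ ^ 2 := by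
  obtain ⟨κ, hκ, T, M, m, L, ρ, hκ1, hT, hM, hm, hL, hρ, hρ1, h⟩ :=
    exists_cascadeEnergy_contraction b hsym hpos hdec hloss hker hinj hobs
  refine ⟨κ, hκ, T, M ^ 2 * (L / m), ρ, hκ1, hT, by positivity, hρ, hρ1,
    fun h1 x p v hx hs1 hs2 t ht => ?_⟩
  replace h := h h1 x p v hx hs1 hs2
  have hkT : ∀ k : ℕ, 0 ≤ (k : ℝ) * T := fun k => by positivity
  have hE : ∀ k : ℕ, cascadeEnergy P c κ (x (k * T)) (v (k * T)) ≤
      ρ ^ k * cascadeEnergy P c κ (x 0) (v 0) := by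
    intro k
    induction k with
    | zero => simp
    | succ k ih =>
      have h2 := (h (k * T) (hkT k)).2.2.2
      rw [show ((k + 1 : ℕ) : ℝ) * T = k * T + T by push_cast; ring]
      calc _ ≤ _ := h2
        _ ≤ ρ * (ρ ^ k * cascadeEnergy P c κ (x 0) (v 0)) := mul_le_mul_of_nonneg_left ih hρ
        _ = _ := by ring
  -- The energy contracts over the k complete windows; the growth bound M covers the incomplete last
  -- one.
  set k := ⌊t / T⌋₊ with hk
  have hk1 : (k : ℝ) * T ≤ t := (le_div_iff₀ hT).1 (Nat.floor_le (by positivity))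
  have hk2 : t < (k + 1 : ℝ) * T := (div_lt_iff₀ hT).1 (Nat.lt_floor_add_one _)
  obtain ⟨hlow, -, hxM, -⟩ := h (k * T) (hkT k)
  have hxt := hxM (t - k * T) ⟨by linarith, by linarith⟩
  rw [add_sub_cancel] at hxt
  have hm' : m * ‖x (k * T)‖ ^ 2 ≤ ρ ^ k * (L * ‖x 0‖ ^ 2) :=
    (hlow.trans (hE k)).trans (mul_le_mul_of_nonneg_left (h 0 le_rfl).2.1 (by positivity))
  calc ‖x t‖ ^ 2 ≤ (M * ‖x (k * T)‖) ^ 2 := by gcongr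
    _ = M ^ 2 / m * (m * ‖x (k * T)‖ ^ 2) := by field_simp
    _ ≤ M ^ 2 / m * (ρ ^ k * (L * ‖x 0‖ ^ 2)) := mul_le_mul_of_nonneg_left hm' (by positivity)
    _ = _ := by field_simp

end Decay

/-! ### Asymptotic stability of the closed loop. -/

theorem isAsymptoticallyStable_cascade {n : ℕ} {A : Matrix (Fin n) (Fin n) ℝ} {b c : Fin n → ℝ}
    {κ : ℝ} (hκ : 0 < κ) (hκ1 : κ ≤ 1) {T K ρ : ℝ} (hT : 0 < T) (hK : 0 < K) (hρ : 0 ≤ ρ)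
    (hρ1 : ρ < 1) (h : ∀ z, IsCascadeSolution A b c (HIGS.balanced 1 one_pos) (HIGS.balanced κ hκ) z →
      ∀ t, 0 ≤ t → ‖(z t).1‖ ^ 2 ≤ K * ρ ^ ⌊t / T⌋₊ * ‖(z 0).1‖ ^ 2) :
    IsAsymptoticallyStable (cascadeStates c (HIGS.balanced 1 one_pos) (HIGS.balanced κ hκ))
      (IsCascadeSolution A b c (HIGS.balanced 1 one_pos) (HIGS.balanced κ hκ)) := by
  set A' : (Fin n → ℝ) →L[ℝ] (Fin n → ℝ) := LinearMap.toContinuousLinearMap A.mulVecLin with hA'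
  set c' : (Fin n → ℝ) →L[ℝ] ℝ :=
    LinearMap.toContinuousLinearMap (dotProductBilin ℝ ℝ c) with hc'
  have hc'a : ∀ x, c' x = c ⬝ᵥ x := fun x => rfl
  have hA'a : ∀ x, A' x = A *ᵥ x := fun x => rfl
  -- The sector constraints bound both hybrid states by the plant state, so the decay of the latter
  -- suffices.
  have hz : ∀ z, IsCascadeSolution A b c (HIGS.balanced 1 one_pos) (HIGS.balanced κ hκ) z →
      ∀ t, 0 ≤ t → ‖z t‖ ≤ (1 + ‖c'‖) * ‖(z t).1‖ := by
    intro z hz t ht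
    have h1 : |(z t).2.1| ≤ ‖c'‖ * ‖(z t).1‖ := by
      have := hz.first.abs_le ht
      rw [one_mul] at this
      exact this.trans (c'.le_opNorm _)
    have h2 : |(z t).2.2| ≤ ‖c'‖ * ‖(z t).1‖ :=
      ((hz.second.abs_le ht).trans (mul_le_of_le_one_left (abs_nonneg _) hκ1)).trans h1
    have h3 : 0 ≤ ‖c'‖ * ‖(z t).1‖ := by positivity
    have h4 := norm_nonneg (z t).1
    simp only [Prod.norm_def, Real.norm_eq_abs, max_le_iff]
    refine ⟨?_, ?_, ?_⟩ <;> linarith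
  refine ⟨?_, ?_, ?_⟩
  · rintro ⟨x₀, w₁, w₂⟩ ⟨h1, h2⟩
    replace h1 : w₁ ^ 2 ≤ c' x₀ * w₁ := by
      rw [hc'a]
      simpa [HIGS.balanced] using h1
    replace h2 : 1 / κ * w₂ ^ 2 ≤ w₁ * w₂ := h2
    have habs : ∀ a w : ℝ, w ^ 2 ≤ a * w → |w| ≤ |a| := fun a w h => by
      by_contra! hc
      have := mul_lt_mul_of_pos_right hc ((abs_nonneg a).trans_lt hc)
      rw [abs_mul_abs_self, ← abs_mul] at this
      linarith [le_abs_self (a * w)]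
    -- The second stage is built as κ times a unit system, which has to start at κ⁻¹ w₂.
    have h2' : (κ⁻¹ * w₂) ^ 2 ≤ w₁ * (κ⁻¹ * w₂) := by
      calc (κ⁻¹ * w₂) ^ 2 = κ⁻¹ * (1 / κ * w₂ ^ 2) := by field_simp
        _ ≤ κ⁻¹ * (w₁ * w₂) := mul_le_mul_of_nonneg_left h2 (inv_pos.2 hκ).le
        _ = _ := by ring
    have hw₁ := habs _ _ h1
    have hw₂ := habs _ _ h2'
    have hs₁ := (sq_nonneg w₁).trans h1
    have hs₂ := (sq_nonneg _).trans h2'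
    obtain ⟨x, rfl, hxc, hxL, hx⟩ := exists_cascade_trajectory A' b c' hκ.le x₀ hw₁ hs₁ hw₂
    have hyc : Continuous fun t => c' (x t) := c'.continuous.comp hxc
    set p := higsOutput (fun t => c' (x t)) w₁ with hp
    have hp0 : p 0 = w₁ := higsOutput_zero hw₁ hs₁
    have hw₂' : |κ⁻¹ * w₂| ≤ |p 0| := by rwa [hp0]
    have hpsol := isSolution_higsOutput hyc hxL hw₁ one_pos
    simp only [one_mul] at hpsol
    refine ⟨fun t => (x t, p t, κ * higsOutput p (κ⁻¹ * w₂) t),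
      ⟨fun t ht => (hx t ht).hasDerivWithinAt, hpsol,
        isSolution_higsOutput (continuous_higsOutput hyc hw₁)
          (isLocallyLipschitzOnNonneg_higsOutput hyc hw₁ hxL) hw₂' hκ⟩, ?_⟩
    simp only [hp0]
    rw [higsOutput_zero hw₂' (by rwa [hp0]), mul_inv_cancel_left₀ hκ.ne']
  · intro ε hε
    set Q : ℝ := (1 + ‖c'‖) * √K with hQ
    have hQ0 : 0 < Q := by positivity
    refine ⟨ε / Q, by positivity, fun z hs h0 t ht => ?_⟩
    have h1 : ‖(z t).1‖ ≤ √K * ‖(z 0).1‖ := by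
      rw [← Real.sqrt_sq (norm_nonneg (z t).1), ← Real.sqrt_sq (norm_nonneg (z 0).1),
        ← Real.sqrt_mul hK.le]
      refine Real.sqrt_le_sqrt ((h z hs t ht).trans ?_)
      refine mul_le_mul_of_nonneg_right ?_ (sq_nonneg _)
      exact mul_le_of_le_one_right hK.le (pow_le_one₀ hρ hρ1.le)
    have h2 : ‖(z 0).1‖ ≤ ‖z 0‖ := norm_fst_le _
    calc ‖z t‖ ≤ (1 + ‖c'‖) * ‖(z t).1‖ := hz z hs t ht
      _ ≤ (1 + ‖c'‖) * (√K * ‖z 0‖) := by gcongr; exact h1.trans (by gcongr)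
      _ = Q * ‖z 0‖ := by ring
      _ < Q * (ε / Q) := by gcongr
      _ = ε := mul_div_cancel₀ ε hQ0.ne'
  · intro z hs
    have hfl : Tendsto (fun t : ℝ => K * ρ ^ ⌊t / T⌋₊ * ‖(z 0).1‖ ^ 2) atTop (𝓝 0) := by
      have := ((tendsto_pow_atTop_nhds_zero_of_lt_one hρ hρ1).comp
        (tendsto_nat_floor_atTop.comp (tendsto_id.atTop_div_const hT))).const_mul K
      simpa using this.mul_const (‖(z 0).1‖ ^ 2)
    have hsq : Tendsto (fun t => ‖(z t).1‖ ^ 2) atTop (𝓝 0) :=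
      squeeze_zero' (Eventually.of_forall fun t => sq_nonneg _)
        ((eventually_ge_atTop 0).mono fun t ht => h z hs t ht) hfl
    have hn : Tendsto (fun t => ‖(z t).1‖) atTop (𝓝 0) := by
      have := hsq.sqrt
      simpa [Real.sqrt_sq] using this
    have hn' : Tendsto (fun t => (1 + ‖c'‖) * ‖(z t).1‖) atTop (𝓝 0) := by
      simpa using hn.const_mul (1 + ‖c'‖)
    exact squeeze_zero_norm' ((eventually_ge_atTop 0).mono fun t ht => hz z hs t ht) hn'

theorem theorem6 {n : ℕ} (A : Matrix (Fin n) (Fin n) ℝ) (b c : Fin n → ℝ)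
    (hmin : IsMinimalRealization A b c)
    (hNI : IsNegativeImaginary (transferFunction A b c)) :
    ∃ H₁ H₂ : HIGS,
      IsAsymptoticallyStable (cascadeStates c H₁ H₂) (IsCascadeSolution A b c H₁ H₂) := by
  obtain ⟨P, N, hsym, hpos, hdec, hloss, hker, hinj⟩ := exists_storage hmin hNI
  set A' : (Fin n → ℝ) →L[ℝ] (Fin n → ℝ) := LinearMap.toContinuousLinearMap A.mulVecLin with hA'
  have hpow : ∀ (i : ℕ) x, (A' ^ i) x = (A ^ i) *ᵥ x := by
    intro i
    induction i with
    | zero => intro x; simp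
    | succ i ih =>
      intro x
      rw [pow_succ, mul_apply_eq_comp, ih, pow_succ, ← Matrix.mulVec_mulVec]
      rfl
  obtain ⟨κ, hκ, T, K, ρ, hκ1, hT, hK, hρ, hρ1, h⟩ := exists_cascade_decay (A := A') b
    (c := LinearMap.toContinuousLinearMap (dotProductBilin ℝ ℝ c))
    (P := P.toContinuousBilinearMap) (N := LinearMap.toContinuousLinearMap N)
    hsym hpos hdec hloss hker hinj
    (fun x hx => hmin.2 x fun i => by
      rw [← hpow]
      exact hx i)
  exact ⟨_, _, isAsymptoticallyStable_cascade hκ hκ1 hT hK hρ hρ1 fun z hz =>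
    h one_pos (fun t => (z t).1) (fun t => (z t).2.1) (fun t => (z t).2.2) hz.plant hz.first
      hz.second⟩
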